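/- Notation. $\mathbb{C}^+=\{z:\Im z>0\}$; $\|\cdot\|_F$ is the Frobenius norm, $\|\cdot\|$ the spectral norm. For a real symmetric $A\in\mathbb{R}^{n\times n}$ put $\mathcal{G}_A(z)=(A-zI_n)^{-1}$, $g_A(z)=\frac1n\mathrm{Tr}\,\mathcal{G}_A(z)$, and let $\mu_A$ be its empirical spectral distribution. For a measure $\mu$ on $\mathbb{R}$ put $g_\mu(z)=\int\frac{\mu(dt)}{t-z}$ (extended linearly to signed measures). For $\gamma>0$ and a probability measure $\mu$ on $[0,\infty)$, $\mathrm{MP}(\gamma)\boxtimes\mu$ is the probability measure on $[0,\infty)$ whose Stieltjes transform $g$ solves $g(z)=\int\frac{\mu(dt)}{(1-\gamma-\gamma z g(z))t-z}$ on $\mathbb{C}^+$. Given $\gamma_n>0$, a (random) positive semi-definite $\Sigma=\Sigma_n\in\mathbb{R}^{n\times n}$, deterministic probability measures $\tau=\tau_n$ on $[0,\infty)$ and deterministic functions $\mathbf{H}=\mathbf{H}_n:\mathbb{C}^+\to\mathbb{C}^{n\times n}$, let $\nu=\mathrm{MP}(\gamma_n)\boxtimes\mu_\Sigma$, $\check\nu=(1-\gamma_n)\delta_0+\gamma_n\nu$,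 $\mathbf{G}_\boxtimes^\Sigma(z)=(-z\,g_{\check\nu}(z)\Sigma-zI_n)^{-1}$, $\chi=\mathrm{MP}(\gamma_n)\boxtimes\tau$, $\check\chi=(1-\gamma_n)\delta_0+\gamma_n\chi$, $l_{\check\chi}(z)=-1/g_{\check\chi}(z)$ and $\mathbf{K}(z)=z^{-1}l_{\check\chi}(z)\,\mathbf{H}(l_{\check\chi}(z))$. For $\epsilon_n>0$, $\zeta(n,z)\le O_z(\epsilon_n)$ means: there is $\alpha\ge0$ such that for every $M>0$ there is $C>0$ with $\zeta(n,z)\le C\epsilon_n|z|^\alpha/\Im(z)^{2\alpha}$ for all $n\ge1$ and all $z$ with $0<\Im z\le M$. When $\zeta$ is random, "$\zeta\le O_z(\epsilon_n)$ a.s." means that for a deterministic $\alpha$: for every $M>0$ there is a deterministic $C$ such that, almost surely, the bound holds for all large enough $n$ and all $z$ with $0<\Im z\le M$; and, almost surely, for every $M>0$ there is a $C$ (depending on the outcome) such that it holds for all $n\ge1$ and all such $z$. For random vectors $X_n$ in normed spaces $E_n$, $X\propto\mathcal{E}(\sigma_n)$ means: there is $C>0$ such that $\mathbb{P}(|f(X_n)-\mathbb{E}f(X_n)|\ge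 t)\le Ce^{-(t/\sigma_n)^2/C}$ for all $n\ge1$, all $1$-Lipschitz $f:E_n\to\mathbb{C}$ (for which $f(X_n)$ is integrable) and all $t\ge0$; and $X\in Z\pm\mathcal{E}(\sigma_n)$, with $Z_n$ deterministic, means the same bound for $|f(X_n)-f(Z_n)|$ and all $1$-Lipschitz linear $f$. With $\mathcal{E}(O_z(\epsilon_n))$ in place of $\mathcal E(\sigma_n)$, this means: there is $\alpha\ge0$ such that for every $M>0$ the bound holds with $\sigma_n=\epsilon_n|z|^\alpha/\Im(z)^{2\alpha}$ and a single constant $C$ for all $n\ge 1$ and all $z$ with $0<\Im z\le M$. Proposition. Let $\gamma_n$ be bounded from above and away from $0$, and let $\Sigma_n\in\mathbb{R}^{n\times n}$ be random positive semi-definite matrices on one probability space, such that $\Sigma\propto\mathcal{E}(1/\sqrt n)$ for the Frobenius norm. Then: 1. $g_\nu(z)\propto\mathcal{E}(O_z(1/n))$, and $\mathbf{G}_\boxtimes^\Sigma(z)\propto\mathcal{E}(O_z(1/\sqrt n))$ for the spectral norm. 2. Let $\tau_n$ be deterministic probability measures on $[0,\infty)$ with uniformly bounded second moments, and let $\epsilon_n>0$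 be such that $|\mathbb{E}[g_\Sigma(z)]-g_\tau(z)|\le O_z(\epsilon_n)$. Then $|g_\nu(z)-g_\chi(z)|\le O_z(\epsilon_n+\sqrt{\log n}/n)$ a.s. 3. If in addition $\epsilon'_n>0$ and $\mathbf{H}_n:\mathbb{C}^+\to\mathbb{C}^{n\times n}$ are deterministic functions with $\|\mathbb{E}[\mathcal{G}_\Sigma(z)]-\mathbf{H}(z)\|\le O_z(\epsilon'_n)$, then $\mathbf{G}_\boxtimes^\Sigma(z)\in\mathbf{K}(z)\pm\mathcal{E}(O_z(\epsilon_n+\epsilon'_n+1/\sqrt n))$ for the spectral norm. -/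

import Mathlib

open MeasureTheory Filter

noncomputable section

/-! ### Norms, resolvents, Stieltjes transforms -/

/-- The Frobenius norm of a real matrix. -/
def frobNorm {n : ℕ} (A : Matrix (Fin n) (Fin n) ℝ) : ℝ :=
  Matrix.frobeniusNormedAddCommGroup.toNorm.norm A

/-- The spectral norm (operator norm for the Euclidean norm) of a complex matrix. -/
def specNorm {n : ℕ} (A : Matrix (Fin n) (Fin n) ℂ) : ℝ :=
  Matrix.instL2OpNormedAddCommGroup.toNorm.norm A

/-- A real matrix seen as a complex matrix. -/
def toC {n : ℕ} (A : Matrix (Fin n) (Fin n) ℝ) : Matrix (Fin n) (Fin n) ℂ :=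
  A.map Complex.ofReal

/-- The resolvent `(A - z I)⁻¹`. -/
def resolventMatrix {n : ℕ} (A : Matrix (Fin n) (Fin n) ℝ) (z : ℂ) : Matrix (Fin n) (Fin n) ℂ :=
  (toC A - z • (1 : Matrix (Fin n) (Fin n) ℂ))⁻¹

/-- The Stieltjes transform `(1/n) Tr (A - z I)⁻¹` of a matrix. -/
def matrixStieltjes {n : ℕ} (A : Matrix (Fin n) (Fin n) ℝ) (z : ℂ) : ℂ :=
  (1 / (n : ℂ)) * (resolventMatrix A z).trace

/-- The Stieltjes transform `∫ μ(dt) / (t - z)` of a measure on the real line. -/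
def stieltjes (μ : Measure ℝ) (z : ℂ) : ℂ := ∫ t, 1 / ((t : ℂ) - z) ∂μ

/-- It is the same as Mathlib's `resolventTransform`. -/
theorem stieltjes_eq_resolventTransform (μ : Measure ℝ) (z : ℂ) :
    stieltjes μ z = resolventTransform μ z := by
  simp [stieltjes, resolventTransform, resolvent]

/-- The empirical spectral distribution `(1/n) ∑ δ_λ`, the sum being over the eigenvalues `λ`
counted with multiplicity (the roots of the characteristic polynomial). -/
def esd {n : ℕ} (A : Matrix (Fin n) (Fin n) ℝ) : Measure ℝ :=
  (n : ENNReal)⁻¹ • (A.charpoly.roots.map (fun x => Measure.dirac x)).sum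

/-! ### Free multiplicative convolution with a Marčenko–Pastur distribution -/

/-- `ν` is the distribution `MP(γ) ⊠ μ`: the probability measure on `[0, ∞)` whose Stieltjes
transform `g` solves `g(z) = ∫ μ(dt) / ((1 - γ - γ z g(z)) t - z)` on the upper half-plane. -/
structure IsMPConv (γ : ℝ) (μ ν : Measure ℝ) : Prop where
  isProbabilityMeasure : IsProbabilityMeasure ν
  supported : ν (Set.Iio 0) = 0
  selfConsistent : ∀ z : ℂ, 0 < z.im →
    stieltjes ν z = ∫ t, 1 / ((1 - (γ : ℂ) - γ * z * stieltjes ν z) * (t : ℂ) - z) ∂μ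

open Classical in
/-- The measure `MP(γ) ⊠ μ` (which exists and is unique when `γ > 0` and `μ` is a probability
measure on `[0, ∞)`). -/
def mpConv (γ : ℝ) (μ : Measure ℝ) : Measure ℝ :=
  if h : ∃ ν, IsMPConv γ μ ν then h.choose else 0

/-- The Stieltjes transform of the measure `(1 - γ) δ₀ + γ (MP(γ) ⊠ μ)`, written by linearity
since the weight `1 - γ` may be negative. -/
def checkStieltjes (γ : ℝ) (μ : Measure ℝ) (z : ℂ) : ℂ :=
  (1 - (γ : ℂ)) * stieltjes (Measure.dirac 0) z + γ * stieltjes (mpConv γ μ) z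

/-- The reciprocal Cauchy transform `l(z) = -1 / g(z)` of the measure
`(1 - γ) δ₀ + γ (MP(γ) ⊠ μ)`. -/
def recipCauchy (γ : ℝ) (μ : Measure ℝ) (z : ℂ) : ℂ := -1 / checkStieltjes γ μ z

/-- The matrix function `G_⊠^A(z) = (- z g(z) A - z I)⁻¹`, where `g` is the Stieltjes transform of
`(1 - γ) δ₀ + γ (MP(γ) ⊠ μ_A)` and `μ_A` is the empirical spectral distribution of `A`. -/
def GBox {n : ℕ} (γ : ℝ) (A : Matrix (Fin n) (Fin n) ℝ) (z : ℂ) : Matrix (Fin n) (Fin n) ℂ :=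
  ((-z * checkStieltjes γ (esd A) z) • toC A - z • (1 : Matrix (Fin n) (Fin n) ℂ))⁻¹

/-- The matrix function `K(z) = z⁻¹ l(z) H(l(z))`, where `l` is the reciprocal Cauchy transform of
`(1 - γ) δ₀ + γ (MP(γ) ⊠ τ)`. -/
def KMat {n : ℕ} (γ : ℝ) (τ : Measure ℝ) (H : ℂ → Matrix (Fin n) (Fin n) ℂ) (z : ℂ) :
    Matrix (Fin n) (Fin n) ℂ :=
  (z⁻¹ * recipCauchy γ τ z) • H (recipCauchy γ τ z)

/-! ### Polynomial bounds in `z` -/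

/-- The weight `|z|^α / Im(z)^(2α)`. -/
def zWeight (α : ℝ) (z : ℂ) : ℝ := ‖z‖ ^ α / z.im ^ (2 * α)

/-- `ζ(n, z) ≤ O_z(ε n)`: for some `α ≥ 0`, one has `ζ(n, z) ≤ O(ε n |z|^α / Im(z)^(2α))`, uniformly
in `z` in the upper half-plane with bounded imaginary part. -/
def IsOz (ζ : ℕ → ℂ → ℝ) (ε : ℕ → ℝ) : Prop :=
  ∃ α : ℝ, 0 ≤ α ∧ ∀ M : ℝ, 0 < M → ∃ C : ℝ, 0 < C ∧
    ∀ n : ℕ, 1 ≤ n → ∀ z : ℂ, 0 < z.im → z.im ≤ M → ζ n z ≤ C * (ε n * zWeight α z)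

section Random

variable {Ω : Type*} [MeasurableSpace Ω]

/-- `ζ(n, ω, z) ≤ O_z(ε n)` almost surely: there is a deterministic exponent such that
almost surely the bound holds for all large `n`, uniformly in `z`, with a deterministic constant,
and almost surely it holds for all `n ≥ 1`, uniformly in `z`, with a constant that may depend on the
outcome. -/
def AEIsOz (P : Measure Ω) (ζ : ℕ → Ω → ℂ → ℝ) (ε : ℕ → ℝ) : Prop :=
  ∃ α : ℝ, 0 ≤ α ∧
    (∀ M : ℝ, 0 < M → ∃ C : ℝ, 0 < C ∧ ∀ᵐ ω ∂P, ∀ᶠ n in atTop,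
      ∀ z : ℂ, 0 < z.im → z.im ≤ M → ζ n ω z ≤ C * (ε n * zWeight α z)) ∧
    (∀ᵐ ω ∂P, ∀ M : ℝ, 0 < M → ∃ C : ℝ, 0 < C ∧ ∀ n : ℕ, 1 ≤ n →
      ∀ z : ℂ, 0 < z.im → z.im ≤ M → ζ n ω z ≤ C * (ε n * zWeight α z))

/-! ### Concentration of random vectors -/

/-- Lipschitz concentration of a random vector `X` for the norm `N`, with explicit constant `C` and
parameter `σ`: for every `1`-Lipschitz `f : E → ℂ`, `f(X)` has an expectation and
`ℙ(|f(X) - 𝔼 f(X)| ≥ t) ≤ C exp(-(t/σ)² / C)` for all `t ≥ 0`. -/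
def LipConcWith {E : Type*} [AddCommGroup E] (P : Measure Ω) (N : E → ℝ) (X : Ω → E)
    (C σ : ℝ) : Prop :=
  ∀ f : E → ℂ, (∀ x y, ‖f x - f y‖ ≤ N (x - y)) →
    Integrable (fun ω => f (X ω)) P ∧
    ∀ t : ℝ, 0 ≤ t → P.real {ω | t ≤ ‖f (X ω) - ∫ ω', f (X ω') ∂P‖} ≤
      C * Real.exp (-(1 / C) * (t / σ) ^ 2)

/-- Linear concentration of a random vector `X` around `Z` for the norm `N`, with explicit constant
`C` and parameter `σ`. -/
def LinConcWith {E : Type*} [AddCommGroup E] [Module ℂ E] (P : Measure Ω) (N : E → ℝ) (X : Ω → E)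
    (Z : E) (C σ : ℝ) : Prop :=
  ∀ f : E →ₗ[ℂ] ℂ, (∀ x, ‖f x‖ ≤ N x) →
    ∀ t : ℝ, 0 ≤ t → P.real {ω | t ≤ ‖f (X ω) - f Z‖} ≤
      C * Real.exp (-(1 / C) * (t / σ) ^ 2)

/-- `X ∝ ℰ(σ n)` for the norms `N n`. -/
def LipConc {E : ℕ → Type*} [∀ n, AddCommGroup (E n)] (P : Measure Ω) (N : ∀ n, E n → ℝ)
    (X : ∀ n, Ω → E n) (σ : ℕ → ℝ) : Prop :=
  ∃ C : ℝ, 0 < C ∧ ∀ n : ℕ, 1 ≤ n → LipConcWith P (N n) (X n) C (σ n)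

/-- `X(z) ∝ ℰ(O_z(ε n))` for the norms `N n`: for some `α ≥ 0`, the vectors `X(z)` are Lipschitz
concentrated with parameter `O(ε n |z|^α / Im(z)^(2α))`, uniformly in `z` in the upper half-plane
with bounded imaginary part (the implicit factor is absorbed by `C`). -/
def LipConcOz {E : ℕ → Type*} [∀ n, AddCommGroup (E n)] (P : Measure Ω) (N : ∀ n, E n → ℝ)
    (X : ∀ n, ℂ → Ω → E n) (ε : ℕ → ℝ) : Prop :=
  ∃ α : ℝ, 0 ≤ α ∧ ∀ M : ℝ, 0 < M → ∃ C : ℝ, 0 < C ∧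
    ∀ n : ℕ, 1 ≤ n → ∀ z : ℂ, 0 < z.im → z.im ≤ M →
      LipConcWith P (N n) (X n z) C (ε n * zWeight α z)

/-- `X(z) ∈ Z(z) ± ℰ(O_z(ε n))` for the norms `N n`, with the same uniformity in `z`. -/
def LinConcOz {E : ℕ → Type*} [∀ n, AddCommGroup (E n)] [∀ n, Module ℂ (E n)] (P : Measure Ω)
    (N : ∀ n, E n → ℝ) (X : ∀ n, ℂ → Ω → E n) (Z : ∀ n, ℂ → E n) (ε : ℕ → ℝ) : Prop :=
  ∃ α : ℝ, 0 ≤ α ∧ ∀ M : ℝ, 0 < M → ∃ C : ℝ, 0 < C ∧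
    ∀ n : ℕ, 1 ≤ n → ∀ z : ℂ, 0 < z.im → z.im ≤ M →
      LinConcWith P (N n) (X n z) (Z n z) C (ε n * zWeight α z)

/-- The (entrywise) expectation of a random matrix. -/
def expMatrix {n : ℕ} (P : Measure Ω) (X : Ω → Matrix (Fin n) (Fin n) ℂ) :
    Matrix (Fin n) (Fin n) ℂ :=
  Matrix.of fun i j => ∫ ω, X ω i j ∂P

end Random

end

/-! Everything runs through the subordination equation `w = z + γ ∫ t w / (t - w) dμ(t)` in the
upper half-plane. Its solution is the reciprocal Cauchy transform of `(1 - γ) δ₀ + γ (MP(γ) ⊠ μ)`,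
so that `γ g_ν(z) = (1 - γ) / z - 1 / w` and, for `μ = μ_Σ`, the matrix function is `z⁻¹ w (Σ -
w)⁻¹`. The three claims become statements about how `w` depends on `μ`.

Stability comes from imaginary parts: at a solution, `γ ∫ t² / |t - w|² dμ = 1 - Im z / Im w < 1`,
so the right-hand side of the equation is contracting with an explicit gap, and a perturbation `δ`
of the equation moves `1 / w` by at most `2 |δ| / Im(z)²` (`IsSub.norm_inv_sub_inv_le`). Since `μ`
lives on `[0, ∞)`, `z / w` has nonpositive imaginary part, whence `|t - w| ≥ Im z |w| / |z|` for `t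
≥ 0` (`IsSub.dist_le`). In the estimates that compare two matrices this makes the powers of `|w|`
harmless, so the bounds do not involve the size of `Σ`.

Claim 1: `g_ν` is Lipschitz in `Σ` with constant `O_z(1/√n)`, the normalized trace gaining `1/√n` by
Cauchy–Schwarz, and the matrix function is `O_z(1)`-Lipschitz. Claim 2: `g_ν - g_χ` is controlled by
`g_Σ - g_τ` at the deterministic point `l(z)`; the bias is the hypothesis, and the fluctuations are
uniform by a union bound over a net and Borel–Cantelli. Claim 3: replace `w` by `l`, then the
resolvent at `l` by its mean, then the mean by `H(l)`.

The measure `MP(γ) ⊠ μ` also has to be constructed, for `μ` with a second moment. Iterating the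
equation from `w = z` converges by a hyperbolic contraction. For finitely supported `μ`, `-1 / w` is
at each stage a diagonal resolvent entry of a tree-like positive semi-definite matrix, hence a
Stieltjes transform (`isResolventEntry_subMap`); tightness carries this to the limit, and stability
carries it to general `μ`. -/

open scoped Topology Matrix

noncomputable section

/-! ### The subordination function -/

/-- The Nevanlinna function `w ↦ ∫ t w / (t - w) dμ(t)`. -/
def subKernel (μ : Measure ℝ) (w : ℂ) : ℂ := ∫ t, (t : ℂ) * w / (t - w) ∂μ

/-- The quantity `∫ t² / |t - w|² dμ(t)`. -/
def subSquare (μ : Measure ℝ) (w : ℂ) : ℝ := ∫ t, t ^ 2 / ‖(t : ℂ) - w‖ ^ 2 ∂μ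

/-- `w` is the value at `z` of the subordination function of `MP(γ) ⊠ μ`. -/
structure IsSub (γ : ℝ) (μ : Measure ℝ) (z w : ℂ) : Prop where
  im_pos : 0 < w.im
  eq : w = z + γ * subKernel μ w

theorem im_le_norm_ofReal_sub (t : ℝ) (w : ℂ) : w.im ≤ ‖(t : ℂ) - w‖ := by
  have := Complex.abs_im_le_norm ((t : ℂ) - w)
  simp only [Complex.sub_im, Complex.ofReal_im, zero_sub, abs_neg] at this
  exact (le_abs_self _).trans this

theorem ofReal_sub_ne_zero {w : ℂ} (hw : w.im ≠ 0) (t : ℝ) : (t : ℂ) - w ≠ 0 := by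
  intro h
  apply hw
  have := congrArg Complex.im h
  simpa using this

theorem abs_im_le_norm_ofReal_sub (t : ℝ) (w : ℂ) : |w.im| ≤ ‖(t : ℂ) - w‖ := by
  have := Complex.abs_im_le_norm ((t : ℂ) - w)
  simpa using this

theorem norm_inv_ofReal_sub_le {w : ℂ} (hw : w.im ≠ 0) (t : ℝ) :
    ‖1 / ((t : ℂ) - w)‖ ≤ 1 / |w.im| := by
  rw [norm_div, norm_one]
  exact one_div_le_one_div_of_le (abs_pos.2 hw) (abs_im_le_norm_ofReal_sub t w)

theorem norm_ratio_le {w : ℂ} (hw : w.im ≠ 0) (t : ℝ) :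
    ‖(t : ℂ) / ((t : ℂ) - w)‖ ≤ 1 + ‖w‖ / |w.im| := by
  have h0 := ofReal_sub_ne_zero hw t
  have : (t : ℂ) / ((t : ℂ) - w) = 1 + w * (1 / ((t : ℂ) - w)) := by field_simp; ring
  rw [this]
  refine (norm_add_le _ _).trans ?_
  rw [norm_one, norm_mul, div_eq_mul_one_div ‖w‖]
  gcongr
  exact norm_inv_ofReal_sub_le hw t

/-! ### Integrability, imaginary part and divided differences of the kernel -/

section Integrability

variable {μ : Measure ℝ} [IsFiniteMeasure μ] {w : ℂ}

theorem integrable_inv_sub (hw : w.im ≠ 0) : Integrable (fun t : ℝ => 1 / ((t : ℂ) - w)) μ := by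
  refine Integrable.of_bound (C := 1 / |w.im|) ?_ ?_
  · exact Measurable.aestronglyMeasurable (by fun_prop)
  · exact ae_of_all _ (norm_inv_ofReal_sub_le hw)

theorem integrable_ratio (hw : w.im ≠ 0) : Integrable (fun t : ℝ => (t : ℂ) / ((t : ℂ) - w)) μ := by
  refine Integrable.of_bound (C := 1 + ‖w‖ / |w.im|) ?_ ?_
  · exact Measurable.aestronglyMeasurable (by fun_prop)
  · exact ae_of_all _ (norm_ratio_le hw)

theorem integrable_subKernel (hw : w.im ≠ 0) :
    Integrable (fun t : ℝ => (t : ℂ) * w / ((t : ℂ) - w)) μ := by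
  refine ((integrable_ratio (μ := μ) hw).mul_const w).congr (ae_of_all _ fun t => ?_)
  simp only; ring

theorem integrable_subSquare (hw : w.im ≠ 0) :
    Integrable (fun t : ℝ => t ^ 2 / ‖(t : ℂ) - w‖ ^ 2) μ := by
  refine Integrable.of_bound (C := (1 + ‖w‖ / |w.im|) ^ 2) ?_ ?_
  · exact Measurable.aestronglyMeasurable (by fun_prop)
  · refine ae_of_all _ fun t => ?_
    have := norm_ratio_le hw t
    rw [norm_div, Complex.norm_real, Real.norm_eq_abs] at this
    rw [Real.norm_eq_abs, abs_div, abs_pow, abs_pow, abs_norm, ← div_pow]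
    gcongr

theorem integrable_subProduct {w' : ℂ} (hw : w.im ≠ 0) (hw' : w'.im ≠ 0) :
    Integrable (fun t : ℝ => (t : ℂ) / ((t : ℂ) - w) * ((t : ℂ) / ((t : ℂ) - w'))) μ := by
  refine Integrable.of_bound (C := (1 + ‖w‖ / |w.im|) * (1 + ‖w'‖ / |w'.im|)) ?_ ?_
  · exact Measurable.aestronglyMeasurable (by fun_prop)
  · refine ae_of_all _ fun t => ?_
    rw [norm_mul]
    have := norm_ratio_le hw t
    have := norm_ratio_le hw' t
    gcongr

/-- Pointwise, `Im (t w / (t - w)) = t² Im w / |t - w|²`. This turns the imaginary part of the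
subordination equation into an identity for `subSquare`. -/
theorem subKernel_im (hw : w.im ≠ 0) : (subKernel μ w).im = w.im * subSquare μ w := by
  have h := integrable_subKernel (μ := μ) hw
  have : (subKernel μ w).im = ∫ t : ℝ, ((t : ℂ) * w / ((t : ℂ) - w)).im ∂μ := by
    have := integral_im h
    simpa [subKernel] using this.symm
  rw [this, subSquare, ← integral_const_mul]
  congr 1; ext t
  have h0 := ofReal_sub_ne_zero hw t
  have h1 : Complex.normSq ((t : ℂ) - w) ≠ 0 := (Complex.normSq_pos.2 h0).ne'
  rw [← Complex.normSq_eq_norm_sq, Complex.div_im]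
  simp only [Complex.mul_im, Complex.mul_re, Complex.sub_re, Complex.sub_im, Complex.ofReal_re,
    Complex.ofReal_im]
  field_simp
  ring

omit [IsFiniteMeasure μ] in
theorem subSquare_nonneg : 0 ≤ subSquare μ w := integral_nonneg fun t => by positivity

/-- The divided difference of `w ↦ t w / (t - w)` is exactly `t² / ((t - w) (t - w'))`, so
increments are controlled by the two values of `subSquare`, the quantities that the imaginary parts
determine. -/
theorem subKernel_sub {w' : ℂ} (hw : w.im ≠ 0) (hw' : w'.im ≠ 0) :
    subKernel μ w - subKernel μ w' =
      (w - w') * ∫ t : ℝ, (t : ℂ) / ((t : ℂ) - w) * ((t : ℂ) / ((t : ℂ) - w')) ∂μ := by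
  rw [subKernel, subKernel, ← integral_sub (integrable_subKernel hw) (integrable_subKernel hw'),
    ← integral_const_mul]
  congr 1; ext t
  have h0 := ofReal_sub_ne_zero hw t
  have h1 := ofReal_sub_ne_zero hw' t
  field_simp
  ring

/-- A weighted arithmetic-geometric mean bound for the divided differences of `subKernel`. -/
theorem norm_subProduct_le {w' : ℂ} (hw : w.im ≠ 0) (hw' : w'.im ≠ 0) {s : ℝ} (hs : 0 < s) :
    ‖∫ t : ℝ, (t : ℂ) / ((t : ℂ) - w) * ((t : ℂ) / ((t : ℂ) - w')) ∂μ‖ ≤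
      (s * subSquare μ w + s⁻¹ * subSquare μ w') / 2 := by
  refine (norm_integral_le_integral_norm _).trans ?_
  rw [subSquare, subSquare, ← integral_const_mul, ← integral_const_mul, ← integral_add
    ((integrable_subSquare hw).const_mul _) ((integrable_subSquare hw').const_mul _),
    ← integral_div]
  refine integral_mono (integrable_subProduct hw hw').norm
    ((((integrable_subSquare hw).const_mul _).add
      ((integrable_subSquare hw').const_mul _)).div_const _) fun t => ?_
  simp only [norm_mul, norm_div, Complex.norm_real, Real.norm_eq_abs]
  have e1 : t ^ 2 / ‖(t : ℂ) - w‖ ^ 2 = (|t| / ‖(t : ℂ) - w‖) ^ 2 := by rw [div_pow, sq_abs]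
  have e2 : t ^ 2 / ‖(t : ℂ) - w'‖ ^ 2 = (|t| / ‖(t : ℂ) - w'‖) ^ 2 := by rw [div_pow, sq_abs]
  rw [e1, e2]
  set a := |t| / ‖(t : ℂ) - w‖
  set b := |t| / ‖(t : ℂ) - w'‖
  have : s * a ^ 2 + s⁻¹ * b ^ 2 - 2 * (a * b) = s⁻¹ * (s * a - b) ^ 2 := by field_simp; ring
  have h3 : 0 ≤ s⁻¹ * (s * a - b) ^ 2 := by positivity
  linarith

/-- The weight is left free: `s = 1` serves for stability and continuity, while the hyperbolic
contraction chooses `s` to balance different heights. -/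
theorem norm_subKernel_sub_le {w' : ℂ} (hw : w.im ≠ 0) (hw' : w'.im ≠ 0) {s : ℝ} (hs : 0 < s) :
    ‖subKernel μ w - subKernel μ w'‖ ≤
      ‖w - w'‖ * ((s * subSquare μ w + s⁻¹ * subSquare μ w') / 2) := by
  rw [subKernel_sub hw hw', norm_mul]
  gcongr
  exact norm_subProduct_le hw hw' hs

theorem subSquare_le (hw : w.im ≠ 0) (h2 : Integrable (fun t : ℝ => t ^ 2) μ) :
    subSquare μ w ≤ (∫ t, t ^ 2 ∂μ) / w.im ^ 2 := by
  rw [subSquare, ← integral_div]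
  refine integral_mono (integrable_subSquare hw) (h2.div_const _) fun t => ?_
  have := abs_im_le_norm_ofReal_sub t w
  have h3 : w.im ^ 2 ≤ ‖(t : ℂ) - w‖ ^ 2 := by
    rw [← sq_abs w.im]; gcongr
  have : 0 < w.im ^ 2 := by positivity
  simp only
  gcongr

end Integrability

section Prob

variable {μ : Measure ℝ} [IsProbabilityMeasure μ] {w : ℂ}

theorem integral_ratio_eq (hw : w.im ≠ 0) :
    ∫ t : ℝ, (t : ℂ) / ((t : ℂ) - w) ∂μ = 1 + w * stieltjes μ w := by
  have : ∫ t : ℝ, (t : ℂ) / ((t : ℂ) - w) ∂μ = ∫ t : ℝ, (1 + w * (1 / ((t : ℂ) - w))) ∂μ := by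
    congr 1; ext t
    have h0 := ofReal_sub_ne_zero hw t
    field_simp; ring
  rw [this, integral_add (integrable_const _) ((integrable_inv_sub hw).const_mul _),
    integral_const_mul]
  simp [stieltjes]

theorem subKernel_eq (hw : w.im ≠ 0) : subKernel μ w = w * (1 + w * stieltjes μ w) := by
  rw [← integral_ratio_eq hw, subKernel, ← integral_const_mul]
  congr 1; ext t; ring

theorem norm_stieltjes_le (hw : w.im ≠ 0) : ‖stieltjes μ w‖ ≤ 1 / |w.im| := by
  have := norm_integral_le_of_norm_le_const (μ := μ) (ae_of_all _ (norm_inv_ofReal_sub_le hw))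
  simpa [stieltjes] using this

omit [IsProbabilityMeasure μ] in
theorem integral_sq_nonneg : 0 ≤ ∫ t : ℝ, t ^ 2 ∂μ := integral_nonneg fun t => by positivity

/-- Writing `t w / (t - w) = t² / (t - w) - t` removes `w` from the numerator; with `|t| ≤ 1 + t²`,
only the second moment and the height of `w` enter. -/
theorem norm_subKernel_le (hw : w.im ≠ 0) (h2 : Integrable (fun t : ℝ => t ^ 2) μ) :
    ‖subKernel μ w‖ ≤ 1 + (∫ t, t ^ 2 ∂μ) * (1 + 1 / |w.im|) := by
  have e : 1 + (∫ t, t ^ 2 ∂μ) * (1 + 1 / |w.im|) =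
      ∫ t, (1 + t ^ 2 * (1 + 1 / |w.im|)) ∂μ := by
    rw [integral_add (integrable_const _) (h2.mul_const _), integral_mul_const]
    simp
  rw [e]
  refine norm_integral_le_of_norm_le ((integrable_const _).add (h2.mul_const _))
    (ae_of_all _ fun t => ?_)
  have h0 := ofReal_sub_ne_zero hw t
  have e2 : (t : ℂ) * w / ((t : ℂ) - w) = (t : ℂ) ^ 2 * (1 / ((t : ℂ) - w)) - t := by
    field_simp; ring
  have h1 := norm_inv_ofReal_sub_le hw t
  rw [e2]
  calc ‖(t : ℂ) ^ 2 * (1 / ((t : ℂ) - w)) - t‖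
      ≤ t ^ 2 * (1 / |w.im|) + |t| := by
        refine (norm_sub_le _ _).trans ?_
        rw [norm_mul, norm_pow, Complex.norm_real, Real.norm_eq_abs, sq_abs]
        gcongr
    _ ≤ 1 + t ^ 2 * (1 + 1 / |w.im|) := by
        nlinarith [sq_nonneg (|t| - 1), sq_abs t, abs_nonneg t]

end Prob

/-! ### A priori bounds and stability for solutions of the subordination equation -/

namespace IsSub

variable {γ : ℝ} {μ : Measure ℝ} {z w : ℂ}

theorem ne_zero (h : IsSub γ μ z w) : w ≠ 0 := by
  rintro rfl; simpa using h.im_pos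

variable [IsProbabilityMeasure μ]

theorem im_eq (h : IsSub γ μ z w) : w.im = z.im + γ * (w.im * subSquare μ w) := by
  have := congrArg Complex.im h.eq
  rw [Complex.add_im, Complex.im_ofReal_mul, subKernel_im h.im_pos.ne'] at this
  exact this

theorem im_le (h : IsSub γ μ z w) (hγ : 0 < γ) : z.im ≤ w.im := by
  have := h.im_eq
  have : 0 ≤ γ * (w.im * subSquare μ w) :=
    mul_nonneg hγ.le (mul_nonneg h.im_pos.le subSquare_nonneg)
  linarith

/-- Division of the imaginary part of the equation by `Im w` yields the quantitative gap `Im z / Im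
w` below `1`, on which the stability estimate rests. -/
theorem gamma_mul_subSquare (h : IsSub γ μ z w) : γ * subSquare μ w = 1 - z.im / w.im := by
  have := h.im_eq
  have := h.im_pos.ne'
  field_simp
  linarith

theorem norm_inv_le (h : IsSub γ μ z w) (hγ : 0 < γ) (hz : 0 < z.im) : ‖w⁻¹‖ ≤ 1 / z.im := by
  rw [norm_inv, ← one_div]
  exact one_div_le_one_div_of_le hz ((h.im_le hγ).trans ((le_abs_self _).trans
    (Complex.abs_im_le_norm w)))

theorem div_eq (h : IsSub γ μ z w) : z / w = 1 - γ * (1 + w * stieltjes μ w) := by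
  have h0 := h.ne_zero
  have := h.eq
  rw [subKernel_eq h.im_pos.ne'] at this
  field_simp
  linear_combination -this

/-- By `div_eq`, `z / w = 1 - γ ∫ t / (t - w) dμ`, and the integrand has nonnegative imaginary part
when `t ≥ 0`. The support of `μ` enters here. -/
theorem div_im_nonpos (h : IsSub γ μ z w) (hγ : 0 < γ) (hμ : μ (Set.Iio 0) = 0) :
    (z / w).im ≤ 0 := by
  rw [h.div_eq, ← integral_ratio_eq h.im_pos.ne', Complex.sub_im, Complex.one_im,
    Complex.im_ofReal_mul]
  have hi := integrable_ratio (μ := μ) h.im_pos.ne'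
  have : (∫ t : ℝ, (t : ℂ) / ((t : ℂ) - w) ∂μ).im = ∫ t : ℝ, ((t : ℂ) / ((t : ℂ) - w)).im ∂μ := by
    simpa using (integral_im hi).symm
  rw [this]
  have hae : ∀ᵐ t ∂μ, 0 ≤ t := by
    rw [ae_iff]; simpa [Set.Iio_def] using hμ
  have : 0 ≤ ∫ t : ℝ, ((t : ℂ) / ((t : ℂ) - w)).im ∂μ := by
    refine integral_nonneg_of_ae (hae.mono fun t ht => ?_)
    have h0 := ofReal_sub_ne_zero h.im_pos.ne' t
    have h1 : 0 < Complex.normSq ((t : ℂ) - w) := Complex.normSq_pos.2 h0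
    have hw := h.im_pos
    simp only [Pi.zero_apply, Complex.div_im, Complex.ofReal_im, Complex.ofReal_re,
      Complex.sub_im, Complex.sub_re]
    have : 0 * (t - w.re) / Complex.normSq ((t : ℂ) - w) -
        t * (0 - w.im) / Complex.normSq ((t : ℂ) - w) =
        t * w.im / Complex.normSq ((t : ℂ) - w) := by ring
    rw [this]
    positivity
  nlinarith

/-- One has `z (t - w) = (t (z / w) - z) w`, where the first factor has imaginary part at most `-Im
z`. Unlike the bound `Im w ≤ |t - w|`, this one scales with `|w|`, so factors `|w|` can cancel
later. -/
theorem dist_le (h : IsSub γ μ z w) (hγ : 0 < γ) (hμ : μ (Set.Iio 0) = 0) {t : ℝ}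
    (ht : 0 ≤ t) : z.im * ‖w‖ ≤ ‖z‖ * ‖(t : ℂ) - w‖ := by
  have h0 := h.ne_zero
  have h1 := h.div_im_nonpos hγ hμ
  have e : z * ((t : ℂ) - w) = ((t : ℂ) * (z / w) - z) * w := by field_simp
  rw [← norm_mul, e, norm_mul]
  gcongr
  refine le_trans ?_ (Complex.abs_im_le_norm _)
  refine le_trans ?_ (neg_le_abs _)
  rw [Complex.sub_im, Complex.im_ofReal_mul]
  nlinarith

/-- When `Im w > 1`, the product `Im w * subSquare μ w` is at most the second moment. The bound
keeps the subordination point in a strip of bounded height, where the `O_z` hypotheses can be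
evaluated. -/
theorem im_bound (h : IsSub γ μ z w) (hγ : 0 < γ) (h2 : Integrable (fun t : ℝ => t ^ 2) μ) :
    w.im ≤ max 1 (z.im + γ * ∫ t, t ^ 2 ∂μ) := by
  by_cases h1 : w.im ≤ 1
  · exact h1.trans (le_max_left _ _)
  · refine le_trans ?_ (le_max_right _ _)
    push Not at h1
    have e := h.im_eq
    have hb := subSquare_le (μ := μ) h.im_pos.ne' h2
    have hn := integral_sq_nonneg (μ := μ)
    have : w.im * subSquare μ w ≤ ∫ t, t ^ 2 ∂μ := by
      calc w.im * subSquare μ w ≤ w.im * ((∫ t, t ^ 2 ∂μ) / w.im ^ 2) := by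
            have := h.im_pos; gcongr
        _ = (∫ t, t ^ 2 ∂μ) / w.im := by have := h.im_pos.ne'; field_simp
        _ ≤ ∫ t, t ^ 2 ∂μ := div_le_self hn h1.le
    nlinarith

theorem norm_le (h : IsSub γ μ z w) (hγ : 0 < γ) (hz : 0 < z.im)
    (h2 : Integrable (fun t : ℝ => t ^ 2) μ) :
    ‖w‖ ≤ ‖z‖ + γ * (1 + (∫ t, t ^ 2 ∂μ) * (1 + 1 / z.im)) := by
  conv_lhs => rw [h.eq]
  refine (norm_add_le _ _).trans ?_
  rw [norm_mul, Complex.norm_real, Real.norm_of_nonneg hγ.le]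
  gcongr
  refine (norm_subKernel_le h.im_pos.ne' h2).trans ?_
  have hn := integral_sq_nonneg (μ := μ)
  have := h.im_le hγ
  rw [abs_of_pos h.im_pos]
  gcongr

/-- Stability of the subordination function with respect to the measure. -/
theorem norm_sub_le {μ' : Measure ℝ} [IsProbabilityMeasure μ'] {w' : ℂ} (hγ : 0 < γ)
    (hz : 0 < z.im) (h : IsSub γ μ z w) (h' : IsSub γ μ' z w')
    (hδ : ‖(γ : ℂ) * (subKernel μ w' - subKernel μ' w')‖ ≤ z.im) :
    ‖w - w'‖ ≤ 2 * ‖(γ : ℂ) * (subKernel μ w' - subKernel μ' w')‖ * w.im / z.im := by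
  set δ := (γ : ℂ) * (subKernel μ w' - subKernel μ' w') with hδdef
  have hw := h.im_pos
  have hw' := h'.im_pos
  have e : w - w' = γ * (subKernel μ w - subKernel μ w') + δ := by
    conv_lhs => rw [h.eq, h'.eq]
    rw [hδdef]; ring
  -- Mixed pair: `w'` solves the equation of `μ'`, not of `μ`. The imaginary part of `δ` is the
  -- difference of the two square terms at `w'`, and `Im δ ≤ Im z` is just what keeps the term of
  -- `μ` at most `1`.
  have hb' : γ * subSquare μ w' ≤ 1 := by
    have e1 : δ.im = γ * (w'.im * subSquare μ w') - γ * (w'.im * subSquare μ' w') := by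
      rw [hδdef, Complex.im_ofReal_mul, Complex.sub_im, subKernel_im hw'.ne',
        subKernel_im hw'.ne']
      ring
    have e2 := h'.im_eq
    have e3 : δ.im ≤ z.im := ((le_abs_self _).trans (Complex.abs_im_le_norm δ)).trans hδ
    have : γ * subSquare μ w' * w'.im ≤ 1 * w'.im := by linarith
    exact le_of_mul_le_mul_right this hw'
  have ha := h.gamma_mul_subSquare
  -- The average of the bounds `1 - Im z / Im w` and `1` is a contraction factor `1 - Im z / (2 Im
  -- w)`, so the increment can be absorbed on the left.
  have h1 : ‖w - w'‖ ≤ ‖w - w'‖ * (1 - z.im / w.im / 2) + ‖δ‖ := by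
    conv_lhs => rw [e]
    refine (norm_add_le _ _).trans ?_
    gcongr
    rw [norm_mul, Complex.norm_real, Real.norm_of_nonneg hγ.le]
    have := norm_subKernel_sub_le (μ := μ) hw.ne' hw'.ne' one_pos
    calc γ * ‖subKernel μ w - subKernel μ w'‖
        ≤ γ * (‖w - w'‖ * ((1 * subSquare μ w + 1⁻¹ * subSquare μ w') / 2)) := by gcongr
      _ = ‖w - w'‖ * ((γ * subSquare μ w + γ * subSquare μ w') / 2) := by rw [inv_one]; ring
      _ ≤ ‖w - w'‖ * (1 - z.im / w.im / 2) := by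
          gcongr
          rw [ha]; linarith
  have h3 : ‖w - w'‖ * (z.im / w.im / 2) ≤ ‖δ‖ := by linarith
  have e4 : ‖w - w'‖ = ‖w - w'‖ * (z.im / w.im / 2) * (2 * w.im / z.im) := by field_simp
  calc ‖w - w'‖ = ‖w - w'‖ * (z.im / w.im / 2) * (2 * w.im / z.im) := e4
    _ ≤ ‖δ‖ * (2 * w.im / z.im) := by gcongr
    _ = 2 * ‖δ‖ * w.im / z.im := by ring

/-- For reciprocals no smallness is required: a perturbation larger than `Im z` is beaten by `|1 /
w| + |1 / w'| ≤ 2 / Im z`. For a small one, the factor `Im w` in `norm_sub_le` is compensated by `|1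
/ w|`. -/
theorem norm_inv_sub_inv_le {μ' : Measure ℝ} [IsProbabilityMeasure μ'] {w' : ℂ} (hγ : 0 < γ)
    (hz : 0 < z.im) (h : IsSub γ μ z w) (h' : IsSub γ μ' z w') :
    ‖w⁻¹ - w'⁻¹‖ ≤ 2 * ‖(γ : ℂ) * (subKernel μ w' - subKernel μ' w')‖ / z.im ^ 2 := by
  set δ := (γ : ℂ) * (subKernel μ w' - subKernel μ' w') with hδdef
  have b := h.norm_inv_le hγ hz
  have b' := h'.norm_inv_le hγ hz
  by_cases hδ : ‖δ‖ ≤ z.im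
  · have hs := norm_sub_le hγ hz h h' hδ
    have h0 := h.ne_zero
    have h0' := h'.ne_zero
    have hw := h.im_pos
    have e : w⁻¹ - w'⁻¹ = -((w - w') * w⁻¹ * w'⁻¹) := by field_simp; ring
    rw [e, norm_neg, norm_mul, norm_mul]
    have h1 : w.im * ‖w⁻¹‖ ≤ 1 := by
      rw [norm_inv, ← div_eq_mul_inv]
      exact div_le_one_of_le₀ ((le_abs_self _).trans (Complex.abs_im_le_norm w)) (norm_nonneg _)
    calc ‖w - w'‖ * ‖w⁻¹‖ * ‖w'⁻¹‖ ≤ (2 * ‖δ‖ * w.im / z.im) * ‖w⁻¹‖ * (1 / z.im) := by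
          gcongr
      _ = 2 * ‖δ‖ / z.im ^ 2 * (w.im * ‖w⁻¹‖) := by field_simp
      _ ≤ 2 * ‖δ‖ / z.im ^ 2 * 1 := by gcongr
      _ = _ := mul_one _
  · push Not at hδ
    calc ‖w⁻¹ - w'⁻¹‖ ≤ 1 / z.im + 1 / z.im := (_root_.norm_sub_le _ _).trans (add_le_add b b')
      _ = 2 * z.im / z.im ^ 2 := by field_simp; ring
      _ ≤ 2 * ‖δ‖ / z.im ^ 2 := by gcongr

end IsSub

/-- The measure `MP(γ) ⊠ μ` has an analytic subordination function. -/
theorem IsMPConv.exists_isSub {γ : ℝ} {μ ν : Measure ℝ} [IsProbabilityMeasure μ]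
    (hμ : μ (Set.Iio 0) = 0) (hγ : 0 < γ) (h : IsMPConv γ μ ν) {z : ℂ} (hz : 0 < z.im) :
    ∃ w, IsSub γ μ z w ∧ z / w = 1 - γ - γ * z * stieltjes ν z := by
  have := h.isProbabilityMeasure
  have hz0 : z ≠ 0 := by rintro rfl; simp at hz
  have hγ0 : (γ : ℂ) ≠ 0 := by exact_mod_cast hγ.ne'
  set g := stieltjes ν z with hg
  set u : ℂ := 1 - γ - γ * z * g with hu
  have haeν : ∀ᵐ t ∂ν, 0 ≤ t := by
    rw [ae_iff]; simpa [Set.Iio_def] using h.supported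
  have haeμ : ∀ᵐ t ∂μ, 0 ≤ t := by
    rw [ae_iff]; simpa [Set.Iio_def] using hμ
  have hpos : ∀ (v : ℂ), 0 < v.im → ∀ t : ℝ, 0 ≤ t → 0 ≤ ((t : ℂ) / ((t : ℂ) - v)).im := by
    intro v hv t ht
    have h1 : 0 < Complex.normSq ((t : ℂ) - v) := Complex.normSq_pos.2 (ofReal_sub_ne_zero hv.ne' t)
    have : ((t : ℂ) / ((t : ℂ) - v)).im = t * v.im / Complex.normSq ((t : ℂ) - v) := by
      simp only [Complex.div_im, Complex.ofReal_im, Complex.ofReal_re,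
        Complex.sub_im, Complex.sub_re]
      ring
    rw [this]; positivity
  -- Here `u = 1 - γ ∫ t / (t - z) dν`, and `ν` lives on `[0, ∞)`.
  have himu : u.im ≤ 0 := by
    have e : u = 1 - γ * (1 + z * g) := by rw [hu]; ring
    have hi := integrable_ratio (μ := ν) hz.ne'
    have e2 : (∫ t : ℝ, (t : ℂ) / ((t : ℂ) - z) ∂ν).im =
        ∫ t : ℝ, ((t : ℂ) / ((t : ℂ) - z)).im ∂ν := by
      simpa using (integral_im hi).symm
    have e3 : u.im = 0 - γ * (∫ t : ℝ, ((t : ℂ) / ((t : ℂ) - z)).im ∂ν) := by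
      rw [e, hg, ← integral_ratio_eq hz.ne', Complex.sub_im, Complex.one_im, Complex.im_ofReal_mul,
        e2]
    have : 0 ≤ ∫ t : ℝ, ((t : ℂ) / ((t : ℂ) - z)).im ∂ν :=
      integral_nonneg_of_ae (haeν.mono fun t ht => hpos z hz t ht)
    rw [e3]; nlinarith
  have hsc : g = ∫ t, 1 / (u * (t : ℂ) - z) ∂μ := h.selfConsistent z hz
  -- If `u = 0`, the self-consistent equation gives `g = -1 / z`, and then the definition of `u`
  -- gives `u = 1`.
  have hu0 : u ≠ 0 := by
    intro h0
    have e1 : g = -1 / z := by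
      rw [hsc, h0]
      simp
      field_simp
    have : u = 1 := by rw [hu, e1]; field_simp; ring
    rw [this] at h0
    exact one_ne_zero h0
  set w := z / u with hw
  have hw0 : w ≠ 0 := div_ne_zero hz0 hu0
  have hden : ∀ t : ℝ, 0 ≤ t → u * (t : ℂ) - z ≠ 0 := by
    intro t ht h0
    have := congrArg Complex.im h0
    rw [mul_comm, Complex.sub_im, Complex.im_ofReal_mul, Complex.zero_im] at this
    nlinarith
  have hden' : ∀ t : ℝ, 0 ≤ t → (t : ℂ) - w ≠ 0 := by
    intro t ht h0
    apply hden t ht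
    have : (t : ℂ) = z / u := by rw [← hw]; linear_combination h0
    rw [this]; field_simp; ring
  have huw : u = z / w := by rw [hw]; field_simp
  -- the ratio `t / (t - w)` is bounded on the support of `μ`
  have hbd : ∀ᵐ t : ℝ ∂μ, ‖(t : ℂ) / ((t : ℂ) - w)‖ ≤ 1 + ‖z‖ / z.im := by
    filter_upwards [haeμ] with t ht
    have h1 := hden' t ht
    have h2 := hden t ht
    have e : (t : ℂ) / ((t : ℂ) - w) = 1 + z / (u * t - z) := by
      rw [hw]
      rw [hw] at h1
      have h3 : (t : ℂ) * u - z ≠ 0 := by rw [mul_comm]; exact h2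
      have h4 : (t : ℂ) - z / u = (t * u - z) / u := by field_simp
      rw [h4, mul_comm u (t : ℂ)]
      field_simp
      ring
    rw [e]
    refine (norm_add_le _ _).trans ?_
    rw [norm_one, norm_div]
    gcongr
    refine le_trans ?_ (Complex.abs_im_le_norm _)
    refine le_trans ?_ (neg_le_abs _)
    rw [mul_comm, Complex.sub_im, Complex.im_ofReal_mul]
    nlinarith
  have hir : Integrable (fun t : ℝ => (t : ℂ) / ((t : ℂ) - w)) μ :=
    Integrable.of_bound (Measurable.aestronglyMeasurable (by fun_prop)) _ hbd
  have hratio : ∫ t : ℝ, (t : ℂ) / ((t : ℂ) - w) ∂μ = 1 + z * g := by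
    rw [hsc, ← integral_const_mul]
    have hone : ∀ x : ℂ, 1 + x = (∫ t : ℝ, (1 : ℂ) ∂μ) + x := by simp
    rw [hone, ← integral_add (integrable_const _)]
    · refine integral_congr_ae (haeμ.mono fun t ht => ?_)
      have h1 := hden' t ht
      have h2 := hden t ht
      simp only
      rw [huw] at h2 ⊢
      have h3 : (t : ℂ) - w ≠ 0 := h1
      have h4 : z / w * t - z = z * (t - w) / w := by field_simp
      rw [h4]
      field_simp
      ring
    · refine Integrable.of_bound (C := ‖z‖ / z.im)
        (Measurable.aestronglyMeasurable (by fun_prop)) ?_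
      filter_upwards [haeμ] with t ht
      rw [norm_mul, norm_div, norm_one, mul_one_div]
      gcongr
      refine le_trans ?_ (Complex.abs_im_le_norm _)
      refine le_trans ?_ (neg_le_abs _)
      rw [mul_comm, Complex.sub_im, Complex.im_ofReal_mul]
      nlinarith
  have hu2 : u = 1 - γ * ∫ t : ℝ, (t : ℂ) / ((t : ℂ) - w) ∂μ := by rw [hratio, hu]; ring
  have hweq : w = z + γ * subKernel μ w := by
    have e1 : subKernel μ w = w * ∫ t : ℝ, (t : ℂ) / ((t : ℂ) - w) ∂μ := by
      rw [subKernel, ← integral_const_mul]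
      congr 1; ext t; ring
    have e2 : z = w * (1 - γ * ∫ t : ℝ, (t : ℂ) / ((t : ℂ) - w) ∂μ) := by
      rw [← hu2, huw]; field_simp
    rw [e1]; linear_combination -e2
  -- If `Im w < 0`, the integral formula gives `Im u ≥ 0`; with `Im u ≤ 0` the integrand vanishes
  -- almost everywhere, so `u = 1` and `w = z`, a contradiction. If `w` is real, so is `subKernel μ
  -- w`, and the equation forces `Im w = Im z`.
  have him : 0 < w.im := by
    rcases lt_trichotomy w.im 0 with hneg | hzero | hp
    · exfalso
      have hpos' : ∀ t : ℝ, 0 ≤ t → ((t : ℂ) / ((t : ℂ) - w)).im =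
          - (t * (-w.im) / Complex.normSq ((t : ℂ) - w)) := by
        intro t ht
        simp only [Complex.div_im, Complex.ofReal_im, Complex.ofReal_re,
          Complex.sub_im, Complex.sub_re]
        ring
      have e2 : (∫ t : ℝ, (t : ℂ) / ((t : ℂ) - w) ∂μ).im =
          ∫ t : ℝ, ((t : ℂ) / ((t : ℂ) - w)).im ∂μ := by
        simpa using (integral_im hir).symm
      have e3 : u.im = 0 - γ * (∫ t : ℝ, ((t : ℂ) / ((t : ℂ) - w)).im ∂μ) := by
        conv_lhs => rw [hu2]
        rw [Complex.sub_im, Complex.one_im, Complex.im_ofReal_mul, e2]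
      have hle : 0 ≤ᵐ[μ] fun t : ℝ => -((t : ℂ) / ((t : ℂ) - w)).im := by
        filter_upwards [haeμ] with t ht
        rw [hpos' t ht, neg_neg]
        have := Complex.normSq_nonneg ((t : ℂ) - w)
        have : 0 ≤ -w.im := by linarith
        simp only [Pi.zero_apply]
        positivity
      have hint0 : ∫ t : ℝ, -((t : ℂ) / ((t : ℂ) - w)).im ∂μ = 0 := by
        refine le_antisymm ?_ (integral_nonneg_of_ae hle)
        rw [integral_neg]
        rw [e3] at himu
        have : 0 ≤ γ * ∫ t : ℝ, ((t : ℂ) / ((t : ℂ) - w)).im ∂μ := by linarith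
        have := nonneg_of_mul_nonneg_right this hγ
        linarith
      have h0 := (integral_eq_zero_iff_of_nonneg_ae hle hir.im.neg).1 hint0
      have ht0 : ∀ᵐ t : ℝ ∂μ, (t : ℂ) / ((t : ℂ) - w) = 0 := by
        filter_upwards [haeμ, h0] with t ht h0t
        have h1 : 0 < Complex.normSq ((t : ℂ) - w) := Complex.normSq_pos.2 (hden' t ht)
        simp only [Pi.zero_apply] at h0t
        rw [hpos' t ht, neg_neg, div_eq_zero_iff] at h0t
        rcases h0t with h0t | h0t
        · rcases mul_eq_zero.1 h0t with h0t | h0t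
          · rw [h0t]; simp
          · linarith
        · exact absurd h0t h1.ne'
      rw [integral_congr_ae ht0] at hu2
      simp only [integral_zero, mul_zero, sub_zero] at hu2
      rw [hw, hu2, div_one] at hneg
      linarith
    · exfalso
      have hrw : (w.re : ℂ) = w := by
        apply Complex.ext <;> simp [hzero]
      have : (subKernel μ w).im = 0 := by
        have : subKernel μ w = ((∫ t, t * w.re / (t - w.re) ∂μ : ℝ) : ℂ) := by
          rw [subKernel, ← integral_complex_ofReal]
          congr 1; ext t
          push_cast
          rw [hrw]
        rw [this, Complex.ofReal_im]
      have := congrArg Complex.im hweq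
      rw [Complex.add_im, Complex.im_ofReal_mul] at this
      nlinarith
    · exact hp
  exact ⟨w, ⟨him, hweq⟩, huw.symm⟩

/-! ### Existence of the subordination function -/

section FixedPoint

variable {γ : ℝ} {μ : Measure ℝ} [IsProbabilityMeasure μ]

/-- The map whose fixed point is the subordination function. -/
def subMap (γ : ℝ) (μ : Measure ℝ) (z w : ℂ) : ℂ := z + γ * subKernel μ w

theorem subMap_im {z w : ℂ} (hw : w.im ≠ 0) :
    (subMap γ μ z w).im = z.im + γ * (w.im * subSquare μ w) := by
  rw [subMap, Complex.add_im, Complex.im_ofReal_mul, subKernel_im hw]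

theorem subMap_im_ge (hγ : 0 < γ) {z w : ℂ} (hw : 0 < w.im) : z.im ≤ (subMap γ μ z w).im := by
  rw [subMap_im hw.ne']
  have : 0 ≤ γ * (w.im * subSquare μ w) :=
    mul_nonneg hγ.le (mul_nonneg hw.le subSquare_nonneg)
  linarith

/-- Together with `subMap_im_ge`, this confines the iterates to a horizontal strip on which the
contraction factor is uniform. -/
theorem subMap_im_le (hγ : 0 < γ) (h2 : Integrable (fun t : ℝ => t ^ 2) μ) {z w : ℂ}
    (hz : 0 < z.im) (hw : z.im ≤ w.im) :
    (subMap γ μ z w).im ≤ z.im + γ * ((∫ t, t ^ 2 ∂μ) / z.im) := by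
  have hw0 : 0 < w.im := hz.trans_le hw
  rw [subMap_im hw0.ne']
  have hn := integral_sq_nonneg (μ := μ)
  gcongr
  calc w.im * subSquare μ w ≤ w.im * ((∫ t, t ^ 2 ∂μ) / w.im ^ 2) := by
        gcongr; exact subSquare_le hw0.ne' h2
    _ = (∫ t, t ^ 2 ∂μ) / w.im := by field_simp
    _ ≤ (∫ t, t ^ 2 ∂μ) / z.im := by gcongr

/-- `subMap` contracts the hyperbolic pseudo-distance `|w - w'| / √(Im w Im w')`. -/
theorem norm_subMap_sub_le (hγ : 0 < γ) {z w w' : ℂ} {L : ℝ} (hz : 0 < z.im) (hw : 0 < w.im)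
    (hw' : 0 < w'.im) (hL : (subMap γ μ z w).im ≤ L) (hL' : (subMap γ μ z w').im ≤ L) :
    ‖subMap γ μ z w - subMap γ μ z w'‖ / (√(subMap γ μ z w).im * √(subMap γ μ z w').im) ≤
      (1 - z.im / L) * (‖w - w'‖ / (√w.im * √w'.im)) := by
  have hp := hz.trans_le (subMap_im_ge (μ := μ) (z := z) hγ hw)
  have hp' := hz.trans_le (subMap_im_ge (μ := μ) (z := z) hγ hw')
  -- The imaginary part of the map gives `γ * subSquare μ v = (Im F(v) - Im z) / Im v`, and `Im F(v)
  -- ≤ L` turns the subtracted `Im z` into a proportion of `Im F(v)`.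
  have key : ∀ v : ℂ, 0 < v.im → (subMap γ μ z v).im ≤ L → 0 < (subMap γ μ z v).im →
      γ * subSquare μ v ≤ (1 - z.im / L) * (√(subMap γ μ z v).im ^ 2 / √v.im ^ 2) := by
    intro v hv hvL hv0
    rw [Real.sq_sqrt hv.le, Real.sq_sqrt hv0.le, ← mul_div_assoc, le_div_iff₀ hv]
    have e := subMap_im (γ := γ) (μ := μ) (z := z) hv.ne'
    have : z.im / L * (subMap γ μ z v).im ≤ z.im := by
      have hL0 : 0 < L := hv0.trans_le hvL
      rw [div_mul_eq_mul_div, div_le_iff₀ hL0]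
      gcongr
    linarith
  have k1 := key w hw hL hp
  have k2 := key w' hw' hL' hp'
  set p := √(subMap γ μ z w).im
  set p' := √(subMap γ μ z w').im
  set q := √w.im
  set q' := √w'.im
  have hp0 : 0 < p := Real.sqrt_pos.2 hp
  have hp0' : 0 < p' := Real.sqrt_pos.2 hp'
  have hq0 : 0 < q := Real.sqrt_pos.2 hw
  have hq0' : 0 < q' := Real.sqrt_pos.2 hw'
  -- With this weight both terms of the arithmetic-geometric bound become `(1 - Im z / L) p p' / (q
  -- q')`, which is the ratio of the hyperbolic denominators.
  have hs : 0 < p' * q / (p * q') := by positivity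
  have hle := norm_subKernel_sub_le (μ := μ) hw.ne' hw'.ne' hs
  have e : subMap γ μ z w - subMap γ μ z w' = γ * (subKernel μ w - subKernel μ w') := by
    rw [subMap, subMap]; ring
  rw [e, norm_mul, Complex.norm_real, Real.norm_of_nonneg hγ.le, div_le_iff₀ (by positivity)]
  calc γ * ‖subKernel μ w - subKernel μ w'‖
      ≤ γ * (‖w - w'‖ * ((p' * q / (p * q') * subSquare μ w +
          (p' * q / (p * q'))⁻¹ * subSquare μ w') / 2)) := by gcongr
    _ = ‖w - w'‖ * ((p' * q / (p * q') * (γ * subSquare μ w) +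
          (p' * q / (p * q'))⁻¹ * (γ * subSquare μ w')) / 2) := by ring
    _ ≤ ‖w - w'‖ * ((p' * q / (p * q') * ((1 - z.im / L) * (p ^ 2 / q ^ 2)) +
          (p' * q / (p * q'))⁻¹ * ((1 - z.im / L) * (p' ^ 2 / q' ^ 2))) / 2) := by gcongr
    _ = (1 - z.im / L) * (‖w - w'‖ / (q * q')) * (p * p') := by field_simp; ring

/-- Banach iteration in the hyperbolic pseudo-distance. The convergence of the iterates started at
`z`, not merely the existence of a fixed point, is what later lets Stieltjes transforms pass to the
limit. -/
theorem exists_isSub_tendsto (hγ : 0 < γ) (h2 : Integrable (fun t : ℝ => t ^ 2) μ) {z : ℂ}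
    (hz : 0 < z.im) :
    ∃ w, IsSub γ μ z w ∧ Tendsto (fun k => (subMap γ μ z)^[k] z) atTop (𝓝 w) := by
  set m2 := ∫ t, t ^ 2 ∂μ with hm2
  have hn : 0 ≤ m2 := integral_sq_nonneg (μ := μ)
  set L := z.im + γ * (m2 / z.im) with hLdef
  have hLz : z.im ≤ L := by rw [hLdef]; have : 0 ≤ γ * (m2 / z.im) := by positivity
                            linarith
  have hL0 : 0 < L := hz.trans_le hLz
  set u : ℕ → ℂ := fun k => (subMap γ μ z)^[k] z with hu
  have hstep : ∀ k, u (k + 1) = subMap γ μ z (u k) := fun k =>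
    Function.iterate_succ_apply' _ _ _
  have hbd : ∀ k, z.im ≤ (u k).im ∧ (u k).im ≤ L := by
    intro k
    induction k with
    | zero => exact ⟨le_rfl, hLz⟩
    | succ k ih =>
      rw [hstep]
      exact ⟨subMap_im_ge hγ (hz.trans_le ih.1), subMap_im_le hγ h2 hz ih.1⟩
  have hpos : ∀ k, 0 < (u k).im := fun k => hz.trans_le (hbd k).1
  set κ := 1 - z.im / L with hκ
  have hκ0 : 0 ≤ κ := by
    have : z.im / L ≤ 1 := div_le_one_of_le₀ hLz hL0.le
    rw [hκ]; linarith
  have hκ1 : κ < 1 := by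
    have : 0 < z.im / L := by positivity
    rw [hκ]; linarith
  set D := ‖u 1 - u 0‖ / (√(u 1).im * √(u 0).im) with hD
  have hd : ∀ k, ‖u (k + 1) - u k‖ / (√(u (k + 1)).im * √(u k).im) ≤ κ ^ k * D := by
    intro k
    induction k with
    | zero => simp [hD]
    | succ k ih =>
      have := norm_subMap_sub_le (γ := γ) (μ := μ) (z := z) (L := L) hγ hz (hpos (k + 1)) (hpos k)
        (by rw [← hstep]; exact (hbd _).2) (by rw [← hstep]; exact (hbd _).2)
      rw [← hstep, ← hstep] at this
      calc _ ≤ _ := this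
        _ ≤ κ * (κ ^ k * D) := by gcongr
        _ = κ ^ (k + 1) * D := by ring
  -- All heights are at most `L`, so the Euclidean distance is at most `L` times the pseudo-distance
  -- and inherits the geometric decay.
  have hdist : ∀ k, dist (u k) (u (k + 1)) ≤ (L * D) * κ ^ k := by
    intro k
    rw [dist_comm, dist_eq_norm]
    have h1 := hd k
    have hs : √(u (k + 1)).im * √(u k).im ≤ L := by
      calc √(u (k + 1)).im * √(u k).im ≤ √L * √L := by
            gcongr
            · exact (hbd _).2
            · exact (hbd _).2
        _ = L := Real.mul_self_sqrt hL0.le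
    have := Real.sqrt_pos.2 (hpos k)
    have := Real.sqrt_pos.2 (hpos (k + 1))
    rw [div_le_iff₀ (by positivity)] at h1
    have hD0 : 0 ≤ D := by rw [hD]; positivity
    calc ‖u (k + 1) - u k‖ ≤ κ ^ k * D * (√(u (k + 1)).im * √(u k).im) := h1
      _ ≤ κ ^ k * D * L := by gcongr
      _ = L * D * κ ^ k := by ring
  have hcauchy := cauchySeq_of_le_geometric κ (L * D) hκ1 hdist
  obtain ⟨w, hw⟩ := cauchySeq_tendsto_of_complete hcauchy
  have him : z.im ≤ w.im :=
    ge_of_tendsto' ((Complex.continuous_im.tendsto w).comp hw) fun k => (hbd k).1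
  have hw0 : 0 < w.im := hz.trans_le him
  refine ⟨w, ⟨hw0, ?_⟩, hw⟩
  have hlim : Tendsto (fun k => subMap γ μ z (u k)) atTop (𝓝 (subMap γ μ z w)) := by
    rw [tendsto_iff_norm_sub_tendsto_zero]
    have hz0 : Tendsto (fun k => γ * (‖u k - w‖ * (m2 / z.im ^ 2))) atTop (𝓝 0) := by
      have := (((tendsto_iff_norm_sub_tendsto_zero.1 hw).mul_const (m2 / z.im ^ 2)).const_mul γ)
      simpa using this
    refine squeeze_zero (fun _ => norm_nonneg _) (fun k => ?_) hz0
    have e : subMap γ μ z (u k) - subMap γ μ z w = γ * (subKernel μ (u k) - subKernel μ w) := by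
      rw [subMap, subMap]; ring
    rw [e, norm_mul, Complex.norm_real, Real.norm_of_nonneg hγ.le]
    gcongr
    refine (norm_subKernel_sub_le (μ := μ) (hpos k).ne' hw0.ne' one_pos).trans ?_
    refine mul_le_mul_of_nonneg_left ?_ (norm_nonneg _)
    have hb : ∀ v : ℂ, z.im ≤ v.im → subSquare μ v ≤ m2 / z.im ^ 2 := by
      intro v hv
      refine (subSquare_le (hz.trans_le hv).ne' h2).trans ?_
      gcongr
    have h1 := hb _ (hbd k).1
    have h3 := hb _ him
    rw [inv_one]
    linarith
  have hlim' : Tendsto (fun k => u (k + 1)) atTop (𝓝 (subMap γ μ z w)) := by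
    simpa only [hstep] using hlim
  exact tendsto_nhds_unique (hw.comp (tendsto_add_atTop_nat 1)) hlim'

end FixedPoint

/-! ### Resolvents of real symmetric matrices -/

section Spectral

variable {K : Type*} [Fintype K] [DecidableEq K]

/-- The eigenvector matrix of a real symmetric matrix, with complex entries. -/
def complexEigenvectors {T : Matrix K K ℝ} (hT : T.IsHermitian) : Matrix K K ℂ :=
  (hT.eigenvectorUnitary : Matrix K K ℝ).map Complex.ofReal

omit [Fintype K] [DecidableEq K] in
theorem conjTranspose_map_ofReal (A : Matrix K K ℝ) :
    (A.map Complex.ofReal)ᴴ = (Aᵀ).map Complex.ofReal := by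
  ext i j; simp

theorem complexEigenvectors_mul_conjTranspose {T : Matrix K K ℝ} (hT : T.IsHermitian) :
    complexEigenvectors hT * (complexEigenvectors hT)ᴴ = 1 := by
  have h : (hT.eigenvectorUnitary : Matrix K K ℝ) * (hT.eigenvectorUnitary : Matrix K K ℝ)ᵀ = 1 := by
    have := Unitary.coe_mul_star_self hT.eigenvectorUnitary
    rwa [Unitary.coe_star, Matrix.star_eq_conjTranspose,
      Matrix.conjTranspose_eq_transpose_of_trivial] at this
  rw [complexEigenvectors, conjTranspose_map_ofReal]
  have := congrArg (fun A : Matrix K K ℝ => A.map Complex.ofRealHom) h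
  simp only [Matrix.map_mul, Matrix.map_one _ (map_zero _) (map_one _)] at this
  exact this

theorem conjTranspose_mul_complexEigenvectors {T : Matrix K K ℝ} (hT : T.IsHermitian) :
    (complexEigenvectors hT)ᴴ * complexEigenvectors hT = 1 :=
  mul_eq_one_comm.1 (complexEigenvectors_mul_conjTranspose hT)

theorem map_ofReal_eq {T : Matrix K K ℝ} (hT : T.IsHermitian) :
    T.map Complex.ofReal = complexEigenvectors hT *
      Matrix.diagonal (fun i => (hT.eigenvalues i : ℂ)) * (complexEigenvectors hT)ᴴ := by
  have h := hT.spectral_theorem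
  rw [Unitary.conjStarAlgAut_apply, Matrix.star_eq_conjTranspose,
    Matrix.conjTranspose_eq_transpose_of_trivial] at h
  rw [complexEigenvectors, conjTranspose_map_ofReal]
  have := congrArg (fun A : Matrix K K ℝ => A.map Complex.ofRealHom) h
  simp only [Matrix.map_mul] at this
  rw [Matrix.diagonal_map (map_zero _)] at this
  exact this

theorem sub_smul_one_eq {T : Matrix K K ℝ} (hT : T.IsHermitian) (z : ℂ) :
    T.map Complex.ofReal - z • (1 : Matrix K K ℂ) = complexEigenvectors hT *
      Matrix.diagonal (fun i => (hT.eigenvalues i : ℂ) - z) * (complexEigenvectors hT)ᴴ := by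
  have e : Matrix.diagonal (fun i => (hT.eigenvalues i : ℂ) - z) =
      Matrix.diagonal (fun i => (hT.eigenvalues i : ℂ)) - z • (1 : Matrix K K ℂ) := by
    rw [← Matrix.diagonal_one, ← Matrix.diagonal_smul, Matrix.diagonal_sub]
    congr 1; ext i; simp
  rw [e, Matrix.mul_sub, Matrix.sub_mul, ← map_ofReal_eq, Matrix.mul_smul, Matrix.smul_mul,
    Matrix.mul_one, complexEigenvectors_mul_conjTranspose]

theorem resolvent_mul_aux {T : Matrix K K ℝ} (hT : T.IsHermitian) {z : ℂ}
    (hz : ∀ i, (hT.eigenvalues i : ℂ) - z ≠ 0) :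
    (T.map Complex.ofReal - z • (1 : Matrix K K ℂ)) * (complexEigenvectors hT *
      Matrix.diagonal (fun i => 1 / ((hT.eigenvalues i : ℂ) - z)) * (complexEigenvectors hT)ᴴ)
      = 1 := by
  rw [sub_smul_one_eq hT]
  set V := complexEigenvectors hT
  set D := Matrix.diagonal (fun i => (hT.eigenvalues i : ℂ) - z)
  set D' := Matrix.diagonal (fun i => 1 / ((hT.eigenvalues i : ℂ) - z)) with hD'
  have hV : Vᴴ * V = 1 := conjTranspose_mul_complexEigenvectors hT
  have hD : D * D' = 1 := by
    rw [Matrix.diagonal_mul_diagonal, ← Matrix.diagonal_one]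
    congr 1; ext i
    have := hz i
    field_simp
  calc V * D * Vᴴ * (V * D' * Vᴴ) = V * D * (Vᴴ * V) * D' * Vᴴ := by
        simp only [Matrix.mul_assoc]
    _ = V * (D * D') * Vᴴ := by rw [hV, Matrix.mul_one, Matrix.mul_assoc V D D']
    _ = 1 := by rw [hD, Matrix.mul_one]; exact complexEigenvectors_mul_conjTranspose hT

theorem resolvent_eq {T : Matrix K K ℝ} (hT : T.IsHermitian) {z : ℂ}
    (hz : ∀ i, (hT.eigenvalues i : ℂ) - z ≠ 0) :
    (T.map Complex.ofReal - z • (1 : Matrix K K ℂ))⁻¹ = complexEigenvectors hT *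
      Matrix.diagonal (fun i => 1 / ((hT.eigenvalues i : ℂ) - z)) * (complexEigenvectors hT)ᴴ :=
  Matrix.inv_eq_right_inv (resolvent_mul_aux hT hz)

theorem isUnit_det_sub_smul {T : Matrix K K ℝ} (hT : T.IsHermitian) {z : ℂ}
    (hz : ∀ i, (hT.eigenvalues i : ℂ) - z ≠ 0) :
    IsUnit (T.map Complex.ofReal - z • (1 : Matrix K K ℂ)).det :=
  Matrix.isUnit_det_of_right_inverse (resolvent_mul_aux hT hz)

theorem isUnit_det_sub_smul' {T : Matrix K K ℝ} (hT : T.IsHermitian) {z : ℂ} (hz : 0 < z.im) :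
    IsUnit (T.map Complex.ofReal - z • (1 : Matrix K K ℂ)).det :=
  isUnit_det_sub_smul hT fun _ => ofReal_sub_ne_zero hz.ne' _

/-- A diagonal entry of the resolvent of a positive semi-definite matrix is the Stieltjes transform
of a probability measure on `[0, ∞)`. -/
theorem exists_spectralMeasure {T : Matrix K K ℝ} (hT : T.PosSemidef) (k : K) :
    ∃ ρ : Measure ℝ, IsProbabilityMeasure ρ ∧ ρ (Set.Iio 0) = 0 ∧ ∀ z : ℂ, 0 < z.im →
      stieltjes ρ z = (T.map Complex.ofReal - z • (1 : Matrix K K ℂ))⁻¹ k k := by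
  have hH := hT.1
  set U : Matrix K K ℝ := (hH.eigenvectorUnitary : Matrix K K ℝ) with hU
  have hsum : ∑ i, U k i ^ 2 = 1 := by
    have := congrFun (congrFun (Unitary.coe_mul_star_self hH.eigenvectorUnitary) k) k
    rw [Matrix.mul_apply] at this
    simpa [Matrix.star_apply, sq, hU] using this
  refine ⟨∑ i, ENNReal.ofReal (U k i ^ 2) • Measure.dirac (hH.eigenvalues i), ⟨?_⟩, ?_, ?_⟩
  · simp only [Measure.coe_finsetSum, Finset.sum_apply, Measure.smul_apply, measure_univ,
      smul_eq_mul, mul_one]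
    rw [← ENNReal.ofReal_sum_of_nonneg (fun i _ => by positivity), hsum, ENNReal.ofReal_one]
  · simp only [Measure.coe_finsetSum, Finset.sum_apply, Measure.smul_apply, smul_eq_mul]
    refine Finset.sum_eq_zero fun i _ => ?_
    rw [Measure.dirac_apply' _ measurableSet_Iio]
    have := hT.eigenvalues_nonneg i
    simp [this]
  · intro z hz
    rw [stieltjes, integral_finsetSum_measure]
    · rw [resolvent_eq hH fun _ => ofReal_sub_ne_zero hz.ne' _, Matrix.mul_apply]
      refine Finset.sum_congr rfl fun i _ => ?_
      rw [integral_smul_measure, integral_dirac, ENNReal.toReal_ofReal (by positivity),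
        Matrix.mul_diagonal, Matrix.conjTranspose_apply]
      simp only [complexEigenvectors, Matrix.map_apply, Complex.real_smul]
      rw [← hU]
      simp only [RCLike.star_def, Complex.conj_ofReal]
      push_cast
      ring
    · intro i _
      exact (integrable_inv_sub hz.ne').smul_measure ENNReal.ofReal_ne_top

end Spectral

/-! ### Subordination for finitely supported measures -/

section Tree

variable {J K : Type*} [Fintype J] [DecidableEq J] [Fintype K] [DecidableEq K]

/-- The coordinate projection onto the `j`-th copy of `K`. -/
def branchProj (K : Type*) [DecidableEq K] (j : J) : Matrix K (Option (J × K)) ℝ :=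
  Matrix.of fun k o => if o = some (j, k) then 1 else 0

/-- The vector `c e_root + e_(j, k)`. -/
def branchVec (c : ℝ) (j : J) (k : K) : Option (J × K) → ℝ :=
  fun o => (if o = none then c else 0) + if o = some (j, k) then 1 else 0

/-- The matrix obtained from copies of `T` indexed by `J` by attaching them to a new root. -/
def branchMatrix (c t : J → ℝ) (T : Matrix K K ℝ) (k : K) :
    Matrix (Option (J × K)) (Option (J × K)) ℝ :=
  ∑ j, ((branchProj K j)ᵀ * T * branchProj K j +
    t j • Matrix.vecMulVec (branchVec (c j) j k) (branchVec (c j) j k))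

theorem branchMatrix_posSemidef {c t : J → ℝ} (ht : ∀ j, 0 ≤ t j) {T : Matrix K K ℝ}
    (hT : T.PosSemidef) (k : K) : (branchMatrix c t T k).PosSemidef := by
  refine Matrix.posSemidef_sum _ fun j _ => Matrix.PosSemidef.add ?_ ?_
  · have := hT.conjTranspose_mul_mul_same (branchProj K j)
    rwa [Matrix.conjTranspose_eq_transpose_of_trivial] at this
  · refine Matrix.PosSemidef.smul ?_ (ht j)
    have := Matrix.posSemidef_vecMulVec_self_star (branchVec (c j) j k)
    simpa using this

/-- Distinct copies interact only through the root, each by a single rank-one term; the formula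
makes the resolvent equation solvable copy by copy. -/
theorem branchMatrix_mulVec (c t : J → ℝ) (T : Matrix K K ℝ) (k : K) (x : Option (J × K) → ℂ) :
    (branchMatrix c t T k).map Complex.ofReal *ᵥ x = fun o => ∑ j,
      ((∑ k₁, if o = some (j, k₁) then (T.map Complex.ofReal *ᵥ fun k₂ => x (some (j, k₂))) k₁
        else 0) +
        t j * (c j * x none + x (some (j, k))) *
          ((if o = none then (c j : ℂ) else 0) + if o = some (j, k) then 1 else 0)) := by
  ext o
  have e : ∀ o', ((branchMatrix c t T k) o o' : ℂ) = ∑ j, ((∑ k₁, if o = some (j, k₁) then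
      ∑ k₂, (T k₁ k₂ : ℂ) * (if o' = some (j, k₂) then 1 else 0) else 0) +
      t j * ((((if o = none then (c j : ℂ) else 0) + if o = some (j, k) then 1 else 0)) *
        ((if o' = none then (c j : ℂ) else 0) + if o' = some (j, k) then 1 else 0))) := by
    intro o'
    simp only [branchMatrix, Matrix.sum_apply, Matrix.add_apply, Matrix.smul_apply,
      Matrix.vecMulVec_apply, smul_eq_mul, Matrix.mul_assoc]
    push_cast
    refine Finset.sum_congr rfl fun j _ => ?_
    congr 1
    · rw [Matrix.mul_apply]
      push_cast
      refine Finset.sum_congr rfl fun k₁ _ => ?_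
      simp only [Matrix.transpose_apply, branchProj, Matrix.of_apply, Matrix.mul_apply]
      split_ifs
      · push_cast
        simp only [one_mul]
        refine Finset.sum_congr rfl fun k₂ _ => ?_
        split_ifs <;> simp
      · simp
    · simp only [branchVec]
      split_ifs <;> simp
  simp only [Matrix.mulVec, dotProduct, Matrix.map_apply]
  simp only [e, Finset.sum_mul]
  rw [Finset.sum_comm]
  refine Finset.sum_congr rfl fun j _ => ?_
  simp only [add_mul, Finset.sum_add_distrib, Finset.sum_mul]
  rw [Finset.sum_comm]
  congr 1
  · refine Finset.sum_congr rfl fun k₁ _ => ?_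
    split_ifs
    · simp only [Finset.sum_mul]
      rw [Finset.sum_comm]
      refine Finset.sum_congr rfl fun k₂ _ => ?_
      simp
    · simp
  · rw [Fintype.sum_option, Fintype.sum_eq_single (j, k)]
    · simp only [if_true, reduceCtorEq, if_false, zero_add, add_zero]
      ring
    · intro p hp
      simp [hp]

/-- The column of the resolvent at the root is guessed and verified. On the `j`-th copy it must be a
multiple of the `k`-th column of the resolvent of `T`, because the coupling only excites the vertex
`k`; the root equation then fixes the entry sought. -/
theorem branchMatrix_resolvent {c t : J → ℝ} (ht : ∀ j, 0 ≤ t j) {T : Matrix K K ℝ}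
    (hT : T.PosSemidef) (k : K) {z s : ℂ} (hz : 0 < z.im)
    (hs : s = (T.map Complex.ofReal - z • (1 : Matrix K K ℂ))⁻¹ k k)
    (hne : ∀ j, 1 + t j * s ≠ 0) (hne' : -z + ∑ j, (c j : ℂ) ^ 2 * t j / (1 + t j * s) ≠ 0) :
    ((branchMatrix c t T k).map Complex.ofReal - z • (1 : Matrix (Option (J × K)) (Option (J × K)) ℂ))⁻¹ none none =
      1 / (-z + ∑ j, (c j : ℂ) ^ 2 * t j / (1 + t j * s)) := by
  set R := (T.map Complex.ofReal - z • (1 : Matrix K K ℂ))⁻¹ with hR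
  set s' := 1 / (-z + ∑ j, (c j : ℂ) ^ 2 * t j / (1 + t j * s)) with hs'
  set B := (branchMatrix c t T k).map Complex.ofReal - z • (1 : Matrix (Option (J × K)) (Option (J × K)) ℂ) with hB
  -- The equation on the `j`-th copy reduces to `β + t (c s' + β s) = 0`, which this value solves.
  let β : J → ℂ := fun j => -(t j * c j * s') / (1 + t j * s)
  let x : Option (J × K) → ℂ := fun o => o.elim s' fun q => β q.1 * R q.2 k
  have hRT : ∀ k₁, (T.map Complex.ofReal *ᵥ fun k₂ => R k₂ k) k₁ - z * R k₁ k =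
      if k₁ = k then 1 else 0 := by
    intro k₁
    have h1 : (T.map Complex.ofReal - z • (1 : Matrix K K ℂ)) * R = 1 :=
      Matrix.mul_nonsing_inv _ (isUnit_det_sub_smul' hT.1 hz)
    have h2 := congrFun (congrFun h1 k₁) k
    rw [Matrix.sub_mul, Matrix.smul_mul, Matrix.one_mul, Matrix.sub_apply, Matrix.smul_apply,
      Matrix.one_apply, Matrix.mul_apply] at h2
    exact h2
  have hx : B *ᵥ x = Pi.single none 1 := by
    rw [hB, Matrix.sub_mulVec, branchMatrix_mulVec, Matrix.smul_mulVec, Matrix.one_mulVec]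
    ext o
    rcases o with _ | ⟨j₀, k₀⟩
    · simp only [reduceCtorEq, if_false, Finset.sum_const_zero, if_true, add_zero, zero_add,
        Pi.sub_apply, Pi.smul_apply, smul_eq_mul, Pi.single_eq_same]
      have e : ∀ j, t j * (c j * x none + x (some (j, k))) * c j =
          s' * ((c j : ℂ) ^ 2 * t j / (1 + t j * s)) := by
        intro j
        simp only [x, β, Option.elim, ← hs]
        have := hne j
        field_simp
        ring
      simp only [e]
      rw [← Finset.mul_sum]
      simp only [x, Option.elim]
      rw [mul_comm z s', ← mul_sub, sub_eq_neg_add, hs', one_div, inv_mul_cancel₀ hne']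
    · simp only [Option.some.injEq, Prod.mk.injEq, reduceCtorEq, if_false, zero_add, 
        Pi.sub_apply, Pi.smul_apply, smul_eq_mul]
      rw [Pi.single_eq_of_ne (by simp)]
      rw [Finset.sum_eq_single j₀]
      · rw [Finset.sum_eq_single k₀]
        · simp only [true_and, if_true]
          have h3 : (T.map Complex.ofReal *ᵥ fun k₂ => x (some (j₀, k₂))) k₀ =
              β j₀ * (T.map Complex.ofReal *ᵥ fun k₂ => R k₂ k) k₀ := by
            have : (fun k₂ => x (some (j₀, k₂))) = β j₀ • fun k₂ => R k₂ k := by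
              ext; simp [x]
            rw [this, Matrix.mulVec_smul]; rfl
          have h4 := hRT k₀
          have h5 : (T.map Complex.ofReal *ᵥ fun k₂ => R k₂ k) k₀ =
            (if k₀ = k then 1 else 0) + z * R k₀ k := by rw [← h4]; ring
          rw [h3, h5]
          simp only [x, Option.elim, ← hs]
          have h6 : β j₀ + t j₀ * (c j₀ * s' + β j₀ * s) = 0 := by
            simp only [β]
            have := hne j₀
            field_simp
            ring
          linear_combination (if k₀ = k then (1 : ℂ) else 0) * h6
        · intro b _ hb
          rw [if_neg]
          exact fun h => hb h.2.symm
        · simp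
      · intro b _ hb
        rw [Finset.sum_eq_zero]
        · rw [if_neg (fun h => hb h.1.symm)]; simp
        · intro k₁ _
          rw [if_neg]
          exact fun h => hb h.1.symm
      · simp
  have hu := isUnit_det_sub_smul' (branchMatrix_posSemidef (c := c) ht hT k).1 hz
  have hfin : x = B⁻¹ *ᵥ Pi.single none 1 := by
    rw [← hx, Matrix.mulVec_mulVec, Matrix.nonsing_inv_mul _ hu, Matrix.one_mulVec]
  have := congrFun hfin none
  rw [Matrix.mulVec_single_one] at this
  simpa [x] using this.symm

end Tree

/-- The function `s` is, on the upper half-plane, a diagonal entry of the resolvent of some positive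
semi-definite real matrix. -/
def IsResolventEntry (s : ℂ → ℂ) : Prop :=
  ∃ (K : Type) (_ : Fintype K) (_ : DecidableEq K) (T : Matrix K K ℝ) (k : K), T.PosSemidef ∧
    ∀ z : ℂ, 0 < z.im → s z = (T.map Complex.ofReal - z • (1 : Matrix K K ℂ))⁻¹ k k

theorem isResolventEntry_neg_inv : IsResolventEntry fun z => -1 / z := by
  refine ⟨Unit, inferInstance, inferInstance, 0, (), Matrix.PosSemidef.zero, fun z hz => ?_⟩
  have hz0 : z ≠ 0 := by rintro rfl; simp at hz
  have : ((0 : Matrix Unit Unit ℝ).map Complex.ofReal - z • (1 : Matrix Unit Unit ℂ))⁻¹ =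
      (-1 / z) • (1 : Matrix Unit Unit ℂ) := by
    refine Matrix.inv_eq_right_inv ?_
    ext i j
    simp
    field_simp
  rw [this]
  simp

/-- With coupling weights `c² = γ p` and old entry `s = -1 / w`, the denominator `-z + ∑ c² t / (1 +
t s)` equals `-subMap γ μ z w`. One step of the fixed-point iteration is thus one more level of the
tree. -/
theorem isResolventEntry_subMap {γ : ℝ} (hγ : 0 < γ) {μ : Measure ℝ} [IsProbabilityMeasure μ]
    {J : Type} [Fintype J] {p t : J → ℝ} (hp : ∀ j, 0 ≤ p j) (ht : ∀ j, 0 ≤ t j)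
    (hμ : ∀ f : ℝ → ℂ, Measurable f → ∫ x, f x ∂μ = ∑ j, (p j : ℂ) * f (t j)) {w : ℂ → ℂ}
    (hw : ∀ z : ℂ, 0 < z.im → 0 < (w z).im) (h : IsResolventEntry fun z => -1 / w z) :
    IsResolventEntry fun z => -1 / subMap γ μ z (w z) := by
  classical
  obtain ⟨K, _, _, T, k, hT, hs⟩ := h
  refine ⟨Option (J × K), inferInstance, inferInstance,
    branchMatrix (fun j => √(γ * p j)) t T k, none, branchMatrix_posSemidef ht hT k,
    fun z hz => ?_⟩
  have hwz := hw z hz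
  have hw0 : w z ≠ 0 := by intro h0; rw [h0] at hwz; simp at hwz
  have htw := fun j => ofReal_sub_ne_zero hwz.ne' (t j)
  have hne : ∀ j, 1 + (t j : ℂ) * (-1 / w z) ≠ 0 := by
    intro j h0
    apply htw j
    have : (t j : ℂ) - w z = -(w z) * (1 + (t j : ℂ) * (-1 / w z)) := by field_simp; ring
    rw [this, h0, mul_zero]
  have hsum : -z + ∑ j, ((√(γ * p j) : ℝ) : ℂ) ^ 2 * t j / (1 + t j * (-1 / w z)) =
      -subMap γ μ z (w z) := by
    rw [subMap, subKernel, hμ _ (by fun_prop), neg_add, Finset.mul_sum, ← Finset.sum_neg_distrib]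
    congr 1
    refine Finset.sum_congr rfl fun j _ => ?_
    have e : ((√(γ * p j) : ℝ) : ℂ) ^ 2 = γ * p j := by
      rw [← Complex.ofReal_pow, Real.sq_sqrt (mul_nonneg hγ.le (hp j))]; push_cast; rfl
    rw [e]
    have h1 := hne j
    have h2 := htw j
    have h3 : 1 + (t j : ℂ) * (-1 / w z) = -((t j : ℂ) - w z) / w z := by field_simp; ring
    rw [h3]
    field_simp
  have him : (subMap γ μ z (w z)) ≠ 0 := by
    intro h0
    have := subMap_im_ge (μ := μ) (z := z) hγ hwz
    rw [h0] at this
    simp at this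
    linarith
  rw [branchMatrix_resolvent ht hT k hz (hs z hz) hne (by rw [hsum]; exact neg_ne_zero.2 him), hsum]
  rw [div_neg]
  exact neg_div _ _

/-! ### A continuity theorem for Stieltjes transforms -/

/-- At `z = i r` the real part of `t / (t - z)` is `t² / (t² + r²)`, which exceeds `1/2` for `|t| >
r`. Tightness can therefore be read off the Stieltjes transform on the imaginary axis. -/
theorem measureReal_norm_gt_le {ρ : Measure ℝ} [IsProbabilityMeasure ρ] {r : ℝ} (hr : 0 < r) :
    ρ {x | r < ‖x‖} ≤
      ENNReal.ofReal (2 * ‖1 + (r : ℂ) * Complex.I * stieltjes ρ (r * Complex.I)‖) := by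
  have hz : ((r : ℂ) * Complex.I).im ≠ 0 := by simpa using hr.ne'
  have hi := integrable_ratio (μ := ρ) hz
  rw [← integral_ratio_eq hz]
  have e : ∀ t : ℝ, ((t : ℂ) / ((t : ℂ) - r * Complex.I)).re = t ^ 2 / (t ^ 2 + r ^ 2) := by
    intro t
    rw [Complex.div_re]
    simp [Complex.normSq_apply]
    ring
  have hint : Integrable (fun t : ℝ => t ^ 2 / (t ^ 2 + r ^ 2)) ρ := by
    refine hi.re.congr (ae_of_all _ fun t => ?_)
    exact e t
  have hre : ∫ t : ℝ, t ^ 2 / (t ^ 2 + r ^ 2) ∂ρ ≤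
      ‖∫ t : ℝ, (t : ℂ) / ((t : ℂ) - r * Complex.I) ∂ρ‖ := by
    refine le_trans ?_ (Complex.re_le_norm _)
    have := integral_re hi
    simp only [RCLike.re_to_complex] at this
    rw [← this]
    simp only [e]
    exact le_rfl
  have hmeas : MeasurableSet {x : ℝ | r < ‖x‖} := measurableSet_lt (by fun_prop) (by fun_prop)
  have hmk : ρ.real {x | r < ‖x‖} ≤ 2 * ∫ t : ℝ, t ^ 2 / (t ^ 2 + r ^ 2) ∂ρ := by
    rw [← integral_const_mul, ← integral_indicator_one hmeas]
    refine integral_mono ((integrable_const (1 : ℝ)).indicator hmeas) (hint.const_mul 2) fun t => ?_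
    by_cases ht : r < ‖t‖
    · rw [Set.indicator_of_mem (by exact ht)]
      rw [Real.norm_eq_abs] at ht
      have : r ^ 2 ≤ t ^ 2 := by rw [← sq_abs t]; gcongr
      simp only [Pi.one_apply]
      rw [← mul_div_assoc, le_div_iff₀ (by positivity)]
      linarith
    · rw [Set.indicator_of_notMem (by exact ht)]
      positivity
  rw [← ENNReal.ofReal_toReal (measure_ne_top ρ _)]
  refine ENNReal.ofReal_le_ofReal (hmk.trans ?_)
  gcongr

/-- Pointwise limits of Stieltjes transforms of probability measures on `[0, ∞)` are again Stieltjes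
transforms of probability measures on `[0, ∞)`, provided no mass escapes. -/
theorem exists_stieltjes_eq_of_tendsto {ρ : ℕ → Measure ℝ} (hρ : ∀ k, IsProbabilityMeasure (ρ k))
    (hρ0 : ∀ k, ρ k (Set.Iio 0) = 0) {s : ℂ → ℂ}
    (hs : ∀ z : ℂ, 0 < z.im → Tendsto (fun k => stieltjes (ρ k) z) atTop (𝓝 (s z)))
    (hinf : Tendsto (fun r : ℝ => (r : ℂ) * Complex.I * s (r * Complex.I)) atTop (𝓝 (-1))) :
    ∃ ρ' : Measure ℝ, IsProbabilityMeasure ρ' ∧ ρ' (Set.Iio 0) = 0 ∧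
      ∀ z : ℂ, 0 < z.im → stieltjes ρ' z = s z := by
  have htight : IsTightMeasureSet (Set.range ρ) := by
    refine isTightMeasureSet_range_of_tendsto_limsup_measure_norm_gt ?_
    have hlim : Tendsto (fun r : ℝ => ENNReal.ofReal
        (2 * ‖1 + (r : ℂ) * Complex.I * s (r * Complex.I)‖)) atTop (𝓝 0) := by
      have h1 : Tendsto (fun r : ℝ => 2 * ‖1 + (r : ℂ) * Complex.I * s (r * Complex.I)‖) atTop
          (𝓝 (2 * ‖(1 : ℂ) + -1‖)) := ((hinf.const_add 1).norm).const_mul 2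
      have := ENNReal.tendsto_ofReal h1
      simpa using this
    refine tendsto_of_tendsto_of_tendsto_of_le_of_le' tendsto_const_nhds hlim
      (Eventually.of_forall fun _ => zero_le) ?_
    filter_upwards [eventually_gt_atTop 0] with r hr
    have hz : 0 < ((r : ℂ) * Complex.I).im := by simpa using hr
    have h1 : Tendsto (fun k => ENNReal.ofReal
        (2 * ‖1 + (r : ℂ) * Complex.I * stieltjes (ρ k) (r * Complex.I)‖)) atTop
        (𝓝 (ENNReal.ofReal (2 * ‖1 + (r : ℂ) * Complex.I * s (r * Complex.I)‖))) :=
      ENNReal.tendsto_ofReal (((((hs _ hz).const_mul _).const_add 1).norm).const_mul 2)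
    rw [← h1.limsup_eq]
    exact limsup_le_limsup (Eventually.of_forall fun k => measureReal_norm_gt_le hr)
  let P : ℕ → ProbabilityMeasure ℝ := fun k => ⟨ρ k, hρ k⟩
  have hcomp : IsCompact (closure (Set.range P)) := by
    refine isCompact_closure_of_isTightMeasureSet (htight.subset ?_)
    rintro _ ⟨_, ⟨k, rfl⟩, rfl⟩
    exact ⟨k, rfl⟩
  -- A limit along one ultrafilter suffices: the transforms converge along the whole sequence, which
  -- identifies the transform of the limit measure.
  let F : Ultrafilter ℕ := hyperfilter ℕ
  have hF : (F : Filter ℕ) ≤ atTop := Nat.hyperfilter_le_atTop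
  obtain ⟨Q, -, hQ⟩ := hcomp.ultrafilter_le_nhds (F.map P) (by
    rw [le_principal_iff]
    exact Filter.mem_map.2 (Filter.mem_of_superset Filter.univ_mem fun k _ =>
      subset_closure ⟨k, rfl⟩))
  have hQ' : Tendsto P F (𝓝 Q) := hQ
  refine ⟨Q, inferInstance, ?_, fun z hz => ?_⟩
  · have h := ProbabilityMeasure.le_liminf_measure_open_of_tendsto hQ' (isOpen_Iio (a := (0 : ℝ)))
    have h0 : ∀ k, (P k : Measure ℝ) (Set.Iio 0) = 0 := hρ0
    simp only [h0] at h
    simpa using h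
  · rw [ProbabilityMeasure.tendsto_iff_forall_integral_rclike_tendsto ℂ] at hQ'
    let f : BoundedContinuousFunction ℝ ℂ := BoundedContinuousFunction.ofNormedAddCommGroup
      (fun t : ℝ => 1 / ((t : ℂ) - z))
      (by
        refine Continuous.div continuous_const (by fun_prop) fun t => ofReal_sub_ne_zero hz.ne' t)
      (1 / |z.im|) (norm_inv_ofReal_sub_le hz.ne')
    exact tendsto_nhds_unique (hQ' f) ((hs z hz).mono_left hF)

/-! ### Existence of `MP(γ) ⊠ μ` -/

section Existence

variable {γ : ℝ} {μ : Measure ℝ} [IsProbabilityMeasure μ]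

/-- The error is `γ * subKernel μ w / w`, whose numerator stays bounded while `|w| ≥ r`. This is the
condition that no mass escapes. -/
theorem tendsto_neg_inv_sub (hγ : 0 < γ) (h2 : Integrable (fun t : ℝ => t ^ 2) μ) {w : ℂ → ℂ}
    (hw : ∀ z : ℂ, 0 < z.im → IsSub γ μ z (w z)) :
    Tendsto (fun r : ℝ => (r : ℂ) * Complex.I * (-1 / w (r * Complex.I))) atTop (𝓝 (-1)) := by
  set m2 := ∫ t, t ^ 2 ∂μ with hm2
  have hm : 0 ≤ m2 := integral_sq_nonneg (μ := μ)
  rw [tendsto_iff_norm_sub_tendsto_zero]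
  have hlim : Tendsto (fun r : ℝ => γ * (1 + m2 * (1 + 1 / 1)) * r⁻¹) atTop (𝓝 0) := by
    have := tendsto_inv_atTop_zero.const_mul (γ * (1 + m2 * (1 + 1 / (1 : ℝ))))
    simpa using this
  refine squeeze_zero' (Eventually.of_forall fun _ => norm_nonneg _) ?_ hlim
  filter_upwards [eventually_ge_atTop 1] with r hr
  have hr0 : 0 < r := by linarith
  have hz : 0 < ((r : ℂ) * Complex.I).im := by simpa using hr0
  have h := hw _ hz
  set v := w (r * Complex.I)
  have hv0 := h.ne_zero
  have e : (r : ℂ) * Complex.I * (-1 / v) - -1 = (γ * subKernel μ v) * v⁻¹ := by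
    have : γ * subKernel μ v = v - (r : ℂ) * Complex.I := by
      have := h.eq; linear_combination -this
    rw [this]; field_simp; ring
  have hinv := h.norm_inv_le hγ hz
  have him := h.im_le hγ
  have him' : ((r : ℂ) * Complex.I).im = r := by simp
  rw [him'] at hinv him
  rw [one_div] at hinv
  rw [e, norm_mul, norm_mul, Complex.norm_real, Real.norm_of_nonneg hγ.le]
  gcongr
  refine (norm_subKernel_le h.im_pos.ne' h2).trans ?_
  rw [abs_of_pos h.im_pos, ← hm2]
  have : 1 ≤ v.im := hr.trans him
  gcongr

/-- Existence of the free compound Poisson distribution, for finitely supported `μ`. -/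
theorem exists_check_of_finite (hγ : 0 < γ) (h2 : Integrable (fun t : ℝ => t ^ 2) μ)
    {J : Type} [Fintype J] {p t : J → ℝ} (hp : ∀ j, 0 ≤ p j) (ht : ∀ j, 0 ≤ t j)
    (hμ : ∀ f : ℝ → ℂ, Measurable f → ∫ x, f x ∂μ = ∑ j, (p j : ℂ) * f (t j)) :
    ∃ (ρ : Measure ℝ) (w : ℂ → ℂ), IsProbabilityMeasure ρ ∧ ρ (Set.Iio 0) = 0 ∧
      ∀ z : ℂ, 0 < z.im → IsSub γ μ z (w z) ∧ stieltjes ρ z = -1 / w z := by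
  have hex : ∀ z : ℂ, ∃ w, 0 < z.im → IsSub γ μ z w ∧
      Tendsto (fun k => (subMap γ μ z)^[k] z) atTop (𝓝 w) := by
    intro z
    by_cases hz : 0 < z.im
    · obtain ⟨w, hw⟩ := exists_isSub_tendsto hγ h2 hz
      exact ⟨w, fun _ => hw⟩
    · exact ⟨0, fun h => absurd h hz⟩
  choose w hw using hex
  have hpos : ∀ k, ∀ z : ℂ, 0 < z.im → 0 < ((subMap γ μ z)^[k] z).im := by
    intro k z hz
    induction k with
    | zero => exact hz
    | succ k ih =>
      rw [Function.iterate_succ_apply']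
      exact hz.trans_le (subMap_im_ge hγ ih)
  have hres : ∀ k, IsResolventEntry fun z => -1 / (subMap γ μ z)^[k] z := by
    intro k
    induction k with
    | zero => exact isResolventEntry_neg_inv
    | succ k ih =>
      have := isResolventEntry_subMap hγ hp ht hμ (hpos k) ih
      simpa only [Function.iterate_succ_apply'] using this
  have hρ : ∀ k, ∃ ρ : Measure ℝ, IsProbabilityMeasure ρ ∧ ρ (Set.Iio 0) = 0 ∧
      ∀ z : ℂ, 0 < z.im → stieltjes ρ z = -1 / (subMap γ μ z)^[k] z := by
    intro k
    obtain ⟨K, _, _, T, i, hT, hs⟩ := hres k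
    obtain ⟨ρ, h1, h2, h3⟩ := exists_spectralMeasure hT i
    exact ⟨ρ, h1, h2, fun z hz => by rw [h3 z hz, ← hs z hz]⟩
  choose ρ h1 h3 h4 using hρ
  obtain ⟨ρ', a, b, c⟩ := exists_stieltjes_eq_of_tendsto h1 h3 (s := fun z => -1 / w z)
    (fun z hz => by
      simp only [h4 _ z hz]
      exact tendsto_const_nhds.div (hw z hz).2 (hw z hz).1.ne_zero)
    (tendsto_neg_inv_sub hγ h2 fun z hz => (hw z hz).1)
  exact ⟨ρ', w, a, b, fun z hz => ⟨(hw z hz).1, c z hz⟩⟩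

/-- The image of `μ` under a simple function is finitely supported, in the form that
`exists_check_of_finite` requires. -/
theorem integral_comp_simpleFunc (φ : SimpleFunc ℝ ℝ) {f : ℝ → ℂ} (hf : Measurable f) :
    ∫ x, f x ∂(μ.map φ) = ∑ j : φ.range, (μ.real (φ ⁻¹' {(j : ℝ)}) : ℂ) * f j := by
  rw [integral_map φ.measurable.aemeasurable hf.aestronglyMeasurable]
  have e : ∀ t, f (φ t) =
      ∑ j : φ.range, (φ ⁻¹' {(j : ℝ)}).indicator (fun _ => f j) t := by
    intro t
    rw [Finset.sum_eq_single ⟨φ t, SimpleFunc.mem_range_self φ t⟩]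
    · rw [Set.indicator_of_mem (by simp)]
    · intro j _ hj
      rw [Set.indicator_of_notMem]
      intro h
      exact hj (Subtype.ext h.symm)
    · simp
  simp only [e]
  rw [integral_finsetSum]
  · refine Finset.sum_congr rfl fun j _ => ?_
    rw [integral_indicator_const _ (φ.measurableSet_fiber _), Complex.real_smul]
  · intro j _
    exact (integrable_const _).indicator (φ.measurableSet_fiber _)

/-- Existence of the free compound Poisson distribution. -/
theorem exists_check (hγ : 0 < γ) (hμ : μ (Set.Iio 0) = 0)
    (h2 : Integrable (fun t : ℝ => t ^ 2) μ) :
    ∃ (ρ : Measure ℝ) (w : ℂ → ℂ), IsProbabilityMeasure ρ ∧ ρ (Set.Iio 0) = 0 ∧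
      ∀ z : ℂ, 0 < z.im → IsSub γ μ z (w z) ∧ stieltjes ρ z = -1 / w z := by
  have hae : ∀ᵐ t ∂μ, 0 ≤ t := by
    rw [ae_iff]; simpa [Set.Iio_def] using hμ
  -- Approximating within `[0, ∞)` keeps the supports nonnegative, as the positivity of the tree
  -- matrices demands.
  let φ : ℕ → SimpleFunc ℝ ℝ := fun k =>
    SimpleFunc.approxOn (id : ℝ → ℝ) measurable_id (Set.Ici 0) 0 (by simp) k
  have hφ0 : ∀ k t, 0 ≤ φ k t := fun k t =>
    SimpleFunc.approxOn_mem (f := (id : ℝ → ℝ)) (s := Set.Ici 0) measurable_id (by simp) k t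
  have hφ : ∀ᵐ t ∂μ, Tendsto (fun k => φ k t) atTop (𝓝 t) := by
    filter_upwards [hae] with t ht
    exact SimpleFunc.tendsto_approxOn measurable_id (by simp) (subset_closure ht)
  have hprob : ∀ k, IsProbabilityMeasure (μ.map (φ k)) := fun k =>
    Measure.isProbabilityMeasure_map (φ k).measurable.aemeasurable
  have hk := fun k => @exists_check_of_finite γ (μ.map (φ k)) (hprob k) hγ (by
      rw [integrable_map_measure (by fun_prop) (φ k).measurable.aemeasurable]
      exact SimpleFunc.integrable_of_isFiniteMeasure (μ := μ) ((φ k).map (fun t => t ^ 2)))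
    (φ k).range _ (fun j => μ.real (φ k ⁻¹' {(j : ℝ)})) (fun j => j)
    (fun j => measureReal_nonneg)
    (fun j => by
      obtain ⟨t, ht⟩ := SimpleFunc.mem_range.1 j.2
      rw [← ht]; exact hφ0 k t)
    (fun f hf => integral_comp_simpleFunc (φ k) hf)
  choose ρ w h1 h3 h4 using hk
  have hex : ∀ z : ℂ, ∃ w, 0 < z.im → IsSub γ μ z w := by
    intro z
    by_cases hz : 0 < z.im
    · obtain ⟨w, hw, -⟩ := exists_isSub_tendsto hγ h2 hz
      exact ⟨w, fun _ => hw⟩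
    · exact ⟨0, fun h => absurd h hz⟩
  choose v hv using hex
  obtain ⟨ρ', a, b, c⟩ := exists_stieltjes_eq_of_tendsto h1 h3 (s := fun z => -1 / v z)
    (fun z hz => by
      simp only [fun k => (h4 k z hz).2, neg_div, one_div]
      refine Tendsto.neg ?_
      rw [tendsto_iff_norm_sub_tendsto_zero]
      have him := (hv z hz).im_pos
      -- The stability bound evaluates the perturbation only at the limiting solution `v z`, so
      -- convergence of the kernels at this one point is enough; there the integrands are uniformly
      -- bounded.
      have hker : Tendsto (fun k => subKernel (μ.map (φ k)) (v z)) atTop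
          (𝓝 (subKernel μ (v z))) := by
        have e : ∀ k, subKernel (μ.map (φ k)) (v z) =
            ∫ t, (φ k t : ℂ) * v z / (φ k t - v z) ∂μ := fun k =>
          integral_map (φ k).measurable.aemeasurable
            (Measurable.aestronglyMeasurable (by fun_prop))
        simp only [e]
        refine tendsto_integral_of_dominated_convergence
          (fun _ => (1 + ‖v z‖ / |(v z).im|) * ‖v z‖) (fun k => ?_) (integrable_const _)
          (fun k => ae_of_all _ fun t => ?_) ?_
        · have := (φ k).measurable
          exact Measurable.aestronglyMeasurable (by fun_prop)
        · rw [mul_div_right_comm, norm_mul]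
          gcongr
          exact norm_ratio_le him.ne' _
        · filter_upwards [hφ] with t ht
          have ht' : Tendsto (fun k => (φ k t : ℂ)) atTop (𝓝 (t : ℂ)) :=
            (Complex.continuous_ofReal.tendsto t).comp ht
          exact (ht'.mul_const _).div (ht'.sub_const _) (ofReal_sub_ne_zero him.ne' t)
      have hlim : Tendsto (fun k => 2 * ‖(γ : ℂ) * (subKernel (μ.map (φ k)) (v z) -
          subKernel μ (v z))‖ / z.im ^ 2) atTop (𝓝 0) := by
        have := (((hker.sub_const (subKernel μ (v z))).const_mul (γ : ℂ)).norm.const_mul 2).div_const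
          (z.im ^ 2)
        simpa using this
      exact squeeze_zero (fun _ => norm_nonneg _)
        (fun k => IsSub.norm_inv_sub_inv_le hγ hz (h4 k z hz).1 (hv z hz)) hlim)
    (tendsto_neg_inv_sub hγ h2 hv)
  exact ⟨ρ', v, a, b, fun z hz => ⟨hv z hz, c z hz⟩⟩

/-- The measure `MP(γ) ⊠ μ` exists. -/
theorem exists_isMPConv (hγ : 0 < γ) (hμ : μ (Set.Iio 0) = 0)
    (h2 : Integrable (fun t : ℝ => t ^ 2) μ) : ∃ ν, IsMPConv γ μ ν := by
  obtain ⟨ρ, w, hρ, hρ0, hw⟩ := exists_check hγ hμ h2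
  have hγ0 : (γ : ℂ) ≠ 0 := by exact_mod_cast hγ.ne'
  -- the mass of `ρ` at zero
  have hmass : 1 - γ ≤ ρ.real {0} := by
    have hlim : Tendsto (fun r : ℝ => ∫ t : ℝ, (r ^ 2 / (t ^ 2 + r ^ 2)) ∂ρ) (𝓝[>] 0)
        (𝓝 (ρ.real {0})) := by
      rw [← integral_indicator_one (measurableSet_singleton (0 : ℝ))]
      refine tendsto_integral_filter_of_dominated_convergence (fun _ => 1) ?_ ?_
        (integrable_const _) ?_
      · exact Eventually.of_forall fun r => Measurable.aestronglyMeasurable (by fun_prop)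
      · refine Eventually.of_forall fun r => ae_of_all _ fun t => ?_
        rw [Real.norm_of_nonneg (by positivity)]
        exact div_le_one_of_le₀ (by nlinarith [sq_nonneg t]) (by positivity)
      · refine ae_of_all _ fun t => ?_
        by_cases ht : t = 0
        · rw [ht, Set.indicator_of_mem (by simp)]
          refine tendsto_const_nhds.congr' ?_
          filter_upwards [self_mem_nhdsWithin] with r hr
          have : r ≠ 0 := (show (0 : ℝ) < r from hr).ne'
          simp [this]
        · rw [Set.indicator_of_notMem (by simpa using ht)]
          have : ContinuousAt (fun r : ℝ => r ^ 2 / (t ^ 2 + r ^ 2)) 0 := by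
            refine ContinuousAt.div (by fun_prop) (by fun_prop) ?_
            have : 0 < t ^ 2 := by positivity
            simpa using this.ne'
          have h := this.tendsto
          simp only [ne_eq, OfNat.ofNat_ne_zero, not_false_eq_true, zero_pow, add_zero,
            zero_div] at h
          exact h.mono_left nhdsWithin_le_nhds
    -- At `z = i r` the integral is `Re (z / w) = 1 - γ ∫ Re (t / (t - w)) dμ`. Since `ρ` lives on
    -- `[0, ∞)`, `Re w ≤ 0`, and then `Re (t / (t - w)) ≤ 1` for `t ≥ 0`.
    refine ge_of_tendsto hlim ?_
    filter_upwards [self_mem_nhdsWithin] with r hr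
    have hr : 0 < r := hr
    set z : ℂ := r * Complex.I with hzdef
    have hz : 0 < z.im := by simpa [hzdef] using hr
    obtain ⟨hs, hst⟩ := hw z hz
    have haeρ : ∀ᵐ t ∂ρ, 0 ≤ t := by
      rw [ae_iff]; simpa [Set.Iio_def] using hρ0
    have hi := integrable_inv_sub (μ := ρ) hz.ne'
    -- `Re (z / w)` is the integral
    have e1 : ∫ t : ℝ, r ^ 2 / (t ^ 2 + r ^ 2) ∂ρ = (z / w (z)).re := by
      have : z / w z = -(z * stieltjes ρ z) := by rw [hst]; ring
      rw [this, stieltjes, ← integral_const_mul, ← integral_neg]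
      have h3 := integral_re ((hi.const_mul z).neg)
      simp only [RCLike.re_to_complex, Pi.neg_apply] at h3
      rw [← h3]
      congr 1; ext t
      rw [mul_one_div, Complex.neg_re, Complex.div_re]
      simp [hzdef, Complex.normSq_apply]
      ring
    -- `Re w ≤ 0`
    have hre : (w z).re ≤ 0 := by
      have h3 := integral_re hi
      simp only [RCLike.re_to_complex] at h3
      have h4 : 0 ≤ (stieltjes ρ z).re := by
        rw [stieltjes, ← h3]
        refine integral_nonneg_of_ae (haeρ.mono fun t ht => ?_)
        simp only [Pi.zero_apply]
        rw [Complex.div_re]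
        simp [hzdef, Complex.normSq_apply]
        positivity
      have h5 : w z = -1 / stieltjes ρ z := by
        rw [hst]; have := hs.ne_zero; field_simp
      rw [h5, Complex.div_re]
      simp only [Complex.neg_re, Complex.one_re, Complex.neg_im, Complex.one_im, neg_zero, zero_mul,
        zero_div, add_zero]
      rw [neg_one_mul, neg_div]
      have := Complex.normSq_nonneg (stieltjes ρ z)
      have := div_nonneg h4 this
      linarith
    rw [e1, hs.div_eq, ← integral_ratio_eq hs.im_pos.ne']
    have hir := integrable_ratio (μ := μ) hs.im_pos.ne'
    have h3 := integral_re hir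
    simp only [RCLike.re_to_complex] at h3
    rw [Complex.sub_re, Complex.re_ofReal_mul, Complex.one_re, ← h3]
    have : ∫ t : ℝ, ((t : ℂ) / ((t : ℂ) - w z)).re ∂μ ≤ ∫ t : ℝ, 1 ∂μ := by
      refine integral_mono_ae hir.re (integrable_const _) ?_
      have haeμ : ∀ᵐ t ∂μ, 0 ≤ t := by
        rw [ae_iff]; simpa [Set.Iio_def] using hμ
      filter_upwards [haeμ] with t ht
      have h6 := Complex.normSq_pos.2 (ofReal_sub_ne_zero hs.im_pos.ne' t)
      rw [Complex.div_re, ← add_div, div_le_one h6, Complex.normSq_apply]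
      simp only [Complex.ofReal_re, Complex.sub_re, Complex.ofReal_im, zero_mul, add_zero]
      nlinarith [mul_self_nonneg ((t : ℂ) - w z).im]
    simp only [integral_const, probReal_univ, smul_eq_mul, mul_one] at this
    nlinarith
  -- the measure `γ ν`
  have hexν : ∃ ν : Measure ℝ, IsProbabilityMeasure ν ∧ ν (Set.Iio 0) = 0 ∧
      ∀ z : ℂ, 0 < z.im → γ * stieltjes ν z = stieltjes ρ z + (1 - γ) / z := by
    have hc : 0 ≤ ρ.real {0} - (1 - γ) := by linarith
    -- This solves `ρ = (1 - γ) δ₀ + γ ν` for `ν`. The mass bound at zero is what makes it a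
    -- positive measure when `γ < 1`.
    refine ⟨ENNReal.ofReal (1 / γ) • (ρ.restrict {0}ᶜ +
      ENNReal.ofReal (ρ.real {0} - (1 - γ)) • Measure.dirac 0), ⟨?_⟩, ?_, fun z hz => ?_⟩
    · have h1 : ρ {0}ᶜ = ENNReal.ofReal (1 - ρ.real {0}) := by
        rw [← probReal_compl_eq_one_sub (measurableSet_singleton _), ofReal_measureReal]
      simp only [Measure.smul_apply, Measure.add_apply, Measure.restrict_apply_univ, smul_eq_mul,
        measure_univ, mul_one, h1]
      rw [← ENNReal.ofReal_add (by have := measureReal_le_one (μ := ρ) (s := {0}); linarith) hc,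
        ← ENNReal.ofReal_mul (by positivity)]
      have : 1 / γ * (1 - ρ.real {0} + (ρ.real {0} - (1 - γ))) = 1 := by field_simp; ring
      rw [this, ENNReal.ofReal_one]
    · simp only [Measure.smul_apply, Measure.add_apply, smul_eq_mul]
      have h1 : ρ.restrict {0}ᶜ (Set.Iio 0) = 0 :=
        le_antisymm ((Measure.restrict_apply_le _ _).trans hρ0.le) zero_le
      rw [h1, Measure.dirac_apply' _ measurableSet_Iio]
      simp
    · have hi := integrable_inv_sub (μ := ρ) hz.ne'
      have hz0 : z ≠ 0 := by rintro rfl; simp at hz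
      have h1 := integral_add_compl (measurableSet_singleton (0 : ℝ)) hi
      rw [integral_singleton, Complex.real_smul] at h1
      rw [stieltjes, integral_smul_measure, integral_add_measure hi.restrict
        ((integrable_inv_sub hz.ne').smul_measure ENNReal.ofReal_ne_top), integral_smul_measure,
        integral_dirac, ENNReal.toReal_ofReal hc, ENNReal.toReal_ofReal (by positivity),
        Complex.real_smul, Complex.real_smul, stieltjes, ← h1]
      push_cast
      field_simp
      ring
  obtain ⟨ν, hν, hν0, hνs⟩ := hexν
  refine ⟨ν, hν, hν0, fun z hz => ?_⟩
  obtain ⟨hs, hst⟩ := hw z hz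
  have h3 := hνs z hz
  have hz0 : z ≠ 0 := by rintro rfl; simp at hz
  have hw0 := hs.ne_zero
  have hu : 1 - (γ : ℂ) - γ * z * stieltjes ν z = z / w z := by
    have : (γ : ℂ) * z * stieltjes ν z = z * (γ * stieltjes ν z) := by ring
    rw [this, h3, hst]
    field_simp
    ring
  rw [hu]
  have e : ∀ t : ℝ, 1 / (z / w z * t - z) = (w z / z) * (1 / ((t : ℂ) - w z)) := by
    intro t
    have h4 := ofReal_sub_ne_zero hs.im_pos.ne' t
    have h5 : z / w z * t - z = z * (t - w z) / w z := by field_simp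
    rw [h5]
    field_simp
  simp only [e]
  rw [integral_const_mul]
  have h6 := hs.div_eq
  rw [stieltjes] at h6
  have h7 : stieltjes ν z = (1 - γ - z / w z) / (γ * z) := by
    rw [← hu]; field_simp; ring
  rw [h7, h6]
  field_simp
  ring

end Existence

/-! ### Consequences for `mpConv`, `checkStieltjes` and `recipCauchy` -/

section MPConv

variable {γ : ℝ} {μ : Measure ℝ} [IsProbabilityMeasure μ]

theorem mpConv_isMPConv (hγ : 0 < γ) (hμ : μ (Set.Iio 0) = 0)
    (h2 : Integrable (fun t : ℝ => t ^ 2) μ) : IsMPConv γ μ (mpConv γ μ) := by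
  have h := exists_isMPConv hγ hμ h2
  rw [mpConv, dif_pos h]
  exact h.choose_spec

/-- Since `z / w = 1 - γ - γ z g`, the check transform is exactly `-1 / w`, so `recipCauchy` is the
subordination point itself. Only the defining properties of the chosen measure matter, so no
uniqueness is needed. -/
theorem isSub_recipCauchy (hγ : 0 < γ) (hμ : μ (Set.Iio 0) = 0)
    (h2 : Integrable (fun t : ℝ => t ^ 2) μ) {z : ℂ} (hz : 0 < z.im) :
    IsSub γ μ z (recipCauchy γ μ z) ∧
      γ * stieltjes (mpConv γ μ) z = (1 - γ) / z - (recipCauchy γ μ z)⁻¹ := by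
  obtain ⟨w, hw, hg⟩ := (mpConv_isMPConv hγ hμ h2).exists_isSub hμ hγ hz
  have hz0 : z ≠ 0 := by rintro rfl; simp at hz
  have hw0 := hw.ne_zero
  have hγg : γ * stieltjes (mpConv γ μ) z = (1 - γ) / z - w⁻¹ := by
    field_simp at hg ⊢
    linear_combination hg
  have hc : checkStieltjes γ μ z = -w⁻¹ := by
    rw [checkStieltjes, hγg, stieltjes, integral_dirac]
    simp only [Complex.ofReal_zero, zero_sub]
    field_simp
    ring
  have : recipCauchy γ μ z = w := by
    rw [recipCauchy, hc]; field_simp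
  rw [this]
  exact ⟨hw, hγg⟩

theorem checkStieltjes_eq (γ : ℝ) (μ : Measure ℝ) (z : ℂ) :
    checkStieltjes γ μ z = -(recipCauchy γ μ z)⁻¹ := by
  rw [recipCauchy, inv_div, div_neg, div_one, neg_neg]

end MPConv

/-! ### The empirical spectral distribution -/

section Esd

variable {n : ℕ} {A : Matrix (Fin n) (Fin n) ℝ}

theorem esd_eq (hA : A.IsHermitian) :
    esd A = (n : ENNReal)⁻¹ • ∑ i, Measure.dirac (hA.eigenvalues i) := by
  rw [esd, hA.roots_charpoly_eq_eigenvalues, Multiset.map_map]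
  rfl

theorem esd_isProbabilityMeasure (hn : 1 ≤ n) (hA : A.IsHermitian) :
    IsProbabilityMeasure (esd A) := by
  constructor
  rw [esd_eq hA]
  simp only [Measure.smul_apply, Measure.coe_finsetSum, Finset.sum_apply, measure_univ,
    Finset.sum_const, Finset.card_univ, Fintype.card_fin, smul_eq_mul, nsmul_eq_mul, mul_one]
  exact ENNReal.inv_mul_cancel (by simpa using (by omega : n ≠ 0)) (ENNReal.natCast_ne_top n)

theorem esd_Iio_zero (hA : A.PosSemidef) : esd A (Set.Iio 0) = 0 := by
  rw [esd_eq hA.1]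
  simp only [Measure.smul_apply, Measure.coe_finsetSum, Finset.sum_apply, smul_eq_mul]
  rw [Finset.sum_eq_zero, mul_zero]
  intro i _
  rw [Measure.dirac_apply' _ measurableSet_Iio]
  have := hA.eigenvalues_nonneg i
  simp [this]

theorem integrable_sq_esd (hn : 1 ≤ n) (hA : A.IsHermitian) :
    Integrable (fun t : ℝ => t ^ 2) (esd A) := by
  rw [esd_eq hA]
  refine Integrable.smul_measure ?_ (by simpa using (by omega : n ≠ 0))
  rw [integrable_finsetSum_measure]
  intro i _
  exact integrable_dirac (by simp)

theorem stieltjes_esd (hA : A.IsHermitian) {z : ℂ} (hz : 0 < z.im) :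
    stieltjes (esd A) z = matrixStieltjes A z := by
  rw [stieltjes, esd_eq hA, integral_smul_measure, integral_finsetSum_measure
    fun i _ => integrable_inv_sub hz.ne', matrixStieltjes, resolventMatrix, toC,
    resolvent_eq hA fun _ => ofReal_sub_ne_zero hz.ne' _, Matrix.trace_mul_comm, ← Matrix.mul_assoc,
    conjTranspose_mul_complexEigenvectors, Matrix.one_mul, Matrix.trace_diagonal]
  simp

end Esd

/-! ### Matrix norms -/

section Norms

variable {n : ℕ}

theorem frobNorm_eq (A : Matrix (Fin n) (Fin n) ℝ) : frobNorm A = √(∑ i, ∑ j, A i j ^ 2) := by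
  have := Matrix.frobenius_norm_def A
  rw [frobNorm]
  refine this.trans ?_
  rw [Real.sqrt_eq_rpow]
  simp

theorem frobNorm_nonneg (A : Matrix (Fin n) (Fin n) ℝ) : 0 ≤ frobNorm A := by
  rw [frobNorm_eq]; exact Real.sqrt_nonneg _

theorem frobNorm_sq (A : Matrix (Fin n) (Fin n) ℝ) : frobNorm A ^ 2 = ∑ i, ∑ j, A i j ^ 2 := by
  rw [frobNorm_eq]
  exact Real.sq_sqrt (Finset.sum_nonneg fun i _ => Finset.sum_nonneg fun j _ => sq_nonneg _)

theorem mul_mul_le_mul_mul {a b c a' b' c' : ℝ} (ha : 0 ≤ a) (hb : 0 ≤ b) (hc : 0 ≤ c) (h1 : a ≤ a')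
    (h2 : b ≤ b') (h3 : c ≤ c') : a * b * c ≤ a' * b' * c' := by
  have := ha.trans h1
  have := hb.trans h2
  gcongr

theorem frobNorm_sub_comm (A B : Matrix (Fin n) (Fin n) ℝ) :
    frobNorm (A - B) = frobNorm (B - A) := by
  rw [frobNorm_eq, frobNorm_eq]
  congr 1
  refine Finset.sum_congr rfl fun i _ => Finset.sum_congr rfl fun j _ => ?_
  simp only [Matrix.sub_apply]; ring

open scoped Matrix.Norms.L2Operator

theorem specNorm_eq (A : Matrix (Fin n) (Fin n) ℂ) : specNorm A = ‖A‖ := rfl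

theorem specNorm_nonneg (A : Matrix (Fin n) (Fin n) ℂ) : 0 ≤ specNorm A := norm_nonneg A

theorem specNorm_mul_le (A B : Matrix (Fin n) (Fin n) ℂ) :
    specNorm (A * B) ≤ specNorm A * specNorm B := Matrix.l2_opNorm_mul A B

theorem specNorm_add_le (A B : Matrix (Fin n) (Fin n) ℂ) :
    specNorm (A + B) ≤ specNorm A + specNorm B := norm_add_le A B

theorem specNorm_mul_three_le (A B C : Matrix (Fin n) (Fin n) ℂ) {a b c : ℝ}
    (ha : specNorm A ≤ a) (hb : specNorm B ≤ b) (hc : specNorm C ≤ c) :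
    specNorm (A * B * C) ≤ a * b * c := by
  refine (specNorm_mul_le _ _).trans ((mul_le_mul_of_nonneg_right (specNorm_mul_le A B)
    (specNorm_nonneg C)).trans ?_)
  exact mul_mul_le_mul_mul (specNorm_nonneg A) (specNorm_nonneg B) (specNorm_nonneg C) ha hb hc

theorem specNorm_sub_le (A B : Matrix (Fin n) (Fin n) ℂ) :
    specNorm (A - B) ≤ specNorm A + specNorm B := norm_sub_le A B

theorem specNorm_smul (c : ℂ) (A : Matrix (Fin n) (Fin n) ℂ) :
    specNorm (c • A) = ‖c‖ * specNorm A := norm_smul c A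

theorem specNorm_one_le : specNorm (1 : Matrix (Fin n) (Fin n) ℂ) ≤ 1 := by
  rw [specNorm_eq, ← Matrix.diagonal_one, Matrix.l2_opNorm_diagonal]
  exact (pi_norm_le_iff_of_nonneg zero_le_one).2 fun i => by simp

theorem sum_norm_mulVec_sq_le (A : Matrix (Fin n) (Fin n) ℂ) (x : Fin n → ℂ) :
    ∑ i, ‖(A *ᵥ x) i‖ ^ 2 ≤ specNorm A ^ 2 * ∑ i, ‖x i‖ ^ 2 := by
  have h := Matrix.l2_opNorm_mulVec A (WithLp.toLp 2 x)
  have h2 := pow_le_pow_left₀ (norm_nonneg _) h 2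
  rw [mul_pow, EuclideanSpace.norm_sq_eq, EuclideanSpace.norm_sq_eq] at h2
  exact h2

theorem specNorm_toC_le (A : Matrix (Fin n) (Fin n) ℝ) : specNorm (toC A) ≤ frobNorm A := by
  rw [specNorm_eq, Matrix.l2_opNorm_def]
  refine ContinuousLinearMap.opNorm_le_bound _ (frobNorm_nonneg _) fun x => ?_
  refine (sq_le_sq₀ (norm_nonneg _) (mul_nonneg (frobNorm_nonneg _) (norm_nonneg _))).1 ?_
  rw [mul_pow, EuclideanSpace.norm_sq_eq, EuclideanSpace.norm_sq_eq, frobNorm_sq,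
    Finset.sum_mul]
  refine Finset.sum_le_sum fun i _ => ?_
  have e : ((LinearEquiv.trans Matrix.toEuclideanLin LinearMap.toContinuousLinearMap) (toC A) x) i =
      ∑ j, (A i j : ℂ) * x j := rfl
  rw [e]
  calc ‖∑ j, (A i j : ℂ) * x j‖ ^ 2 ≤ (∑ j, |A i j| * ‖x j‖) ^ 2 := by
        gcongr
        refine (norm_sum_le _ _).trans (Finset.sum_le_sum fun j _ => ?_)
        rw [norm_mul, Complex.norm_real, Real.norm_eq_abs]
    _ ≤ (∑ j, |A i j| ^ 2) * ∑ j, ‖x j‖ ^ 2 := Finset.sum_mul_sq_le_sq_mul_sq _ _ _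
    _ = _ := by simp only [sq_abs]

/-- Cauchy–Schwarz for the trace pairing; every column of `X` has Euclidean norm at most the
spectral norm, so the Frobenius norm of `X` costs a factor `√n`. -/
theorem norm_trace_mul_le (A : Matrix (Fin n) (Fin n) ℝ) (X : Matrix (Fin n) (Fin n) ℂ) :
    ‖(toC A * X).trace‖ ≤ √n * frobNorm A * specNorm X := by
  have hX : ∑ j, ∑ i, ‖X j i‖ ^ 2 ≤ n * specNorm X ^ 2 := by
    rw [Finset.sum_comm]
    calc ∑ i, ∑ j, ‖X j i‖ ^ 2 ≤ ∑ i : Fin n, specNorm X ^ 2 := by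
          refine Finset.sum_le_sum fun i _ => ?_
          have := sum_norm_mulVec_sq_le X (Pi.single i 1)
          simp only [Matrix.mulVec_single_one] at this
          refine this.trans_eq ?_
          rw [Finset.sum_eq_single i]
          · simp
          · intro b _ hb; simp [hb]
          · simp
      _ = n * specNorm X ^ 2 := by simp
  refine (sq_le_sq₀ (norm_nonneg _) (by
    have := frobNorm_nonneg A; have := specNorm_nonneg X; positivity)).1 ?_
  rw [mul_pow, mul_pow, Real.sq_sqrt (Nat.cast_nonneg n), frobNorm_sq]
  calc ‖(toC A * X).trace‖ ^ 2 ≤ (∑ p : Fin n × Fin n, |A p.1 p.2| * ‖X p.2 p.1‖) ^ 2 := by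
        gcongr
        rw [Matrix.trace, Fintype.sum_prod_type]
        refine (norm_sum_le _ _).trans (Finset.sum_le_sum fun i _ => ?_)
        rw [Matrix.diag_apply, Matrix.mul_apply]
        refine (norm_sum_le _ _).trans (Finset.sum_le_sum fun j _ => ?_)
        rw [norm_mul, toC, Matrix.map_apply, Complex.norm_real, Real.norm_eq_abs]
    _ ≤ (∑ p : Fin n × Fin n, |A p.1 p.2| ^ 2) * ∑ p : Fin n × Fin n, ‖X p.2 p.1‖ ^ 2 :=
        Finset.sum_mul_sq_le_sq_mul_sq _ _ _
    _ = (∑ i, ∑ j, A i j ^ 2) * ∑ j, ∑ i, ‖X j i‖ ^ 2 := by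
        rw [Fintype.sum_prod_type, Fintype.sum_prod_type, Finset.sum_comm (γ := Fin n)
          (f := fun i j => ‖X j i‖ ^ 2)]
        simp only [sq_abs]
    _ ≤ (∑ i, ∑ j, A i j ^ 2) * (n * specNorm X ^ 2) := by
        gcongr
    _ = n * (∑ i, ∑ j, A i j ^ 2) * specNorm X ^ 2 := by ring

/-! ### Resolvent bounds -/

variable {A B : Matrix (Fin n) (Fin n) ℝ} {w l : ℂ} {d : ℝ}

theorem isUnit_det_resolvent (hA : A.IsHermitian) (hw : 0 < w.im) :
    IsUnit (toC A - w • (1 : Matrix (Fin n) (Fin n) ℂ)).det := isUnit_det_sub_smul' hA hw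

/-- The distance `d` from `w` to `[0, ∞)` is kept abstract: it will be either `Im w` or the
scale-invariant bound of `IsSub.dist_le`. -/
theorem specNorm_resolventMatrix_le (hA : A.PosSemidef) (hw : 0 < w.im) (hd : 0 < d)
    (hdw : ∀ t : ℝ, 0 ≤ t → d ≤ ‖(t : ℂ) - w‖) : specNorm (resolventMatrix A w) ≤ 1 / d := by
  have hV : specNorm (complexEigenvectors hA.1) ≤ 1 := by
    have h1 : ‖(complexEigenvectors hA.1)ᴴ * complexEigenvectors hA.1‖ =
      ‖complexEigenvectors hA.1‖ * ‖complexEigenvectors hA.1‖ :=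
      Matrix.l2_opNorm_conjTranspose_mul_self _
    rw [conjTranspose_mul_complexEigenvectors] at h1
    have h2 : ‖complexEigenvectors hA.1‖ * ‖complexEigenvectors hA.1‖ ≤ 1 :=
      h1.symm.le.trans specNorm_one_le
    rw [specNorm_eq]
    nlinarith [norm_nonneg (complexEigenvectors hA.1)]
  have hV' : specNorm (complexEigenvectors hA.1)ᴴ ≤ 1 := by
    rw [specNorm_eq, Matrix.l2_opNorm_conjTranspose]; exact hV
  have hD : specNorm (Matrix.diagonal fun i => 1 / ((hA.1.eigenvalues i : ℂ) - w)) ≤ 1 / d := by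
    rw [specNorm_eq, Matrix.l2_opNorm_diagonal]
    refine (pi_norm_le_iff_of_nonneg (by positivity)).2 fun i => ?_
    rw [norm_div, norm_one]
    exact one_div_le_one_div_of_le hd (hdw _ (hA.eigenvalues_nonneg i))
  rw [resolventMatrix, toC, resolvent_eq hA.1 fun _ => ofReal_sub_ne_zero hw.ne' _]
  refine (specNorm_mul_three_le _ _ _ hV hD hV').trans_eq ?_
  ring

theorem specNorm_resolventMatrix_le_im (hA : A.PosSemidef) (hw : 0 < w.im) :
    specNorm (resolventMatrix A w) ≤ 1 / w.im :=
  specNorm_resolventMatrix_le hA hw hw fun t _ => im_le_norm_ofReal_sub t w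

theorem resolventMatrix_sub (hA : A.IsHermitian) (hB : B.IsHermitian) (hw : 0 < w.im) :
    resolventMatrix A w - resolventMatrix B w =
      resolventMatrix A w * toC (B - A) * resolventMatrix B w := by
  have hA' := isUnit_det_resolvent hA hw
  have hB' := isUnit_det_resolvent hB hw
  have e : toC (B - A) = (toC B - w • (1 : Matrix (Fin n) (Fin n) ℂ)) -
      (toC A - w • (1 : Matrix (Fin n) (Fin n) ℂ)) := by
    ext i j; simp [toC]
  rw [e, resolventMatrix, resolventMatrix, Matrix.mul_sub, Matrix.nonsing_inv_mul _ hA',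
    Matrix.sub_mul, Matrix.mul_assoc, Matrix.mul_nonsing_inv _ hB', Matrix.mul_one, Matrix.one_mul]

theorem specNorm_resolventMatrix_sub_le (hA : A.PosSemidef) (hB : B.PosSemidef) (hw : 0 < w.im)
    (hd : 0 < d) (hdw : ∀ t : ℝ, 0 ≤ t → d ≤ ‖(t : ℂ) - w‖) :
    specNorm (resolventMatrix A w - resolventMatrix B w) ≤ frobNorm (A - B) / d ^ 2 := by
  rw [resolventMatrix_sub hA.1 hB.1 hw, frobNorm_sub_comm]
  refine (specNorm_mul_three_le _ _ _ (specNorm_resolventMatrix_le hA hw hd hdw)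
    (specNorm_toC_le (B - A)) (specNorm_resolventMatrix_le hB hw hd hdw)).trans_eq ?_
  field_simp

/-- The normalization `1/n` against the `√n` of the trace pairing leaves a net gain `1/√n` over the
spectral-norm estimate. -/
theorem norm_matrixStieltjes_sub_le (hn : 1 ≤ n) (hA : A.PosSemidef) (hB : B.PosSemidef)
    (hw : 0 < w.im) (hd : 0 < d) (hdw : ∀ t : ℝ, 0 ≤ t → d ≤ ‖(t : ℂ) - w‖) :
    ‖matrixStieltjes A w - matrixStieltjes B w‖ ≤ frobNorm (A - B) / (√n * d ^ 2) := by
  have hn0 : (0 : ℝ) < n := by exact_mod_cast hn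
  have hs : (0 : ℝ) < √n := Real.sqrt_pos.2 hn0
  rw [matrixStieltjes, matrixStieltjes, ← mul_sub, ← Matrix.trace_sub,
    resolventMatrix_sub hA.1 hB.1 hw, Matrix.mul_assoc, Matrix.trace_mul_comm, Matrix.mul_assoc,
    norm_mul, norm_div, norm_one, Complex.norm_natCast, frobNorm_sub_comm]
  have n3 := frobNorm_nonneg (B - A)
  have h1 := specNorm_resolventMatrix_le hA hw hd hdw
  have h2 := specNorm_resolventMatrix_le hB hw hd hdw
  have h3 : specNorm (resolventMatrix B w * resolventMatrix A w) ≤ (1 / d) * (1 / d) :=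
    (specNorm_mul_le _ _).trans (mul_le_mul h2 h1 (specNorm_nonneg _) (by positivity))
  have h4 := norm_trace_mul_le (B - A) (resolventMatrix B w * resolventMatrix A w)
  have h5 := h4.trans (mul_le_mul_of_nonneg_left h3 (mul_nonneg hs.le n3))
  refine (mul_le_mul_of_nonneg_left h5 (by positivity)).trans_eq ?_
  have h6 : (n : ℝ) = √n * √n := (Real.mul_self_sqrt hn0.le).symm
  rw [h6]
  simp only [Real.sqrt_mul_self hs.le]
  field_simp

/-- The factor multiplying `w - l` contains only one resolvent at `w`, so a relative bound `|w - l|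
≤ r |w|` pairs `|w|` with that resolvent, and the product is bounded by `|z| / Im z`. -/
theorem smul_resolventMatrix_sub (hA : A.IsHermitian) (hw : 0 < w.im) (hl : 0 < l.im) :
    w • resolventMatrix A w - l • resolventMatrix A l =
      (w - l) • (resolventMatrix A w * (1 + l • resolventMatrix A l)) := by
  have hw' := isUnit_det_resolvent hA hw
  have hl' := isUnit_det_resolvent hA hl
  set R := resolventMatrix A w with hR
  set S := resolventMatrix A l with hS
  have h1 : R * (toC A - w • (1 : Matrix (Fin n) (Fin n) ℂ)) = 1 := Matrix.nonsing_inv_mul _ hw'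
  have h2 : (toC A - l • (1 : Matrix (Fin n) (Fin n) ℂ)) * S = 1 := Matrix.mul_nonsing_inv _ hl'
  have h3 : R - S = (w - l) • (R * S) := by
    have e : (w - l) • (1 : Matrix (Fin n) (Fin n) ℂ) =
      (toC A - l • (1 : Matrix (Fin n) (Fin n) ℂ)) - (toC A - w • (1 : Matrix (Fin n) (Fin n) ℂ)) := by
      rw [sub_smul]; abel
    calc R - S = R * ((toC A - l • (1 : Matrix (Fin n) (Fin n) ℂ)) * S) -
          (R * (toC A - w • (1 : Matrix (Fin n) (Fin n) ℂ))) * S := by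
          rw [h1, h2, Matrix.mul_one, Matrix.one_mul]
      _ = R * ((w - l) • (1 : Matrix (Fin n) (Fin n) ℂ)) * S := by
          rw [e]; noncomm_ring
      _ = (w - l) • (R * S) := by simp
  calc w • R - l • S = (w - l) • R + l • (R - S) := by rw [smul_sub, sub_smul]; abel
    _ = (w - l) • (R * (1 + l • S)) := by
        rw [h3, Matrix.mul_add, Matrix.mul_one, smul_add, Matrix.mul_smul, smul_comm l]

/-- Because `-z g = z / w`, the matrix being inverted is `(z / w) (A - w)`. -/
theorem GBox_eq (hA : A.IsHermitian) {γ : ℝ} {z : ℂ} (hz : z ≠ 0)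
    (hw : 0 < (recipCauchy γ (esd A) z).im) :
    GBox γ A z = z⁻¹ • (recipCauchy γ (esd A) z • resolventMatrix A (recipCauchy γ (esd A) z)) := by
  set w := recipCauchy γ (esd A) z with hwdef
  have hw0 : w ≠ 0 := by intro h; rw [h] at hw; simp at hw
  rw [GBox, checkStieltjes_eq, ← hwdef]
  refine Matrix.inv_eq_right_inv ?_
  have h1 : (toC A - w • (1 : Matrix (Fin n) (Fin n) ℂ)) * resolventMatrix A w = 1 :=
    Matrix.mul_nonsing_inv _ (isUnit_det_resolvent hA hw)
  have e : (-z * -w⁻¹) • toC A - z • (1 : Matrix (Fin n) (Fin n) ℂ) =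
      (z * w⁻¹) • (toC A - w • (1 : Matrix (Fin n) (Fin n) ℂ)) := by
    rw [smul_sub, smul_smul]
    congr 2
    · ring
    · field_simp
  rw [e, Matrix.smul_mul, Matrix.mul_smul, Matrix.mul_smul, h1, smul_smul, smul_smul]
  have : z * w⁻¹ * (z⁻¹ * w) = 1 := by field_simp
  rw [← mul_assoc] at this
  rw [this, one_smul]

end Norms

/-! ### The weight `|z| / Im(z)²` -/

/-- The base `|z| / Im(z)²` of the weights `zWeight α z`. -/
def zBase (z : ℂ) : ℝ := ‖z‖ / z.im ^ 2

section Weight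

variable {z : ℂ} {M : ℝ}

theorem zBase_pos (hz : 0 < z.im) : 0 < zBase z := by
  have : 0 < ‖z‖ := hz.trans_le ((le_abs_self _).trans (Complex.abs_im_le_norm z))
  rw [zBase]; positivity

theorem zWeight_eq (α : ℝ) (hz : 0 < z.im) : zWeight α z = zBase z ^ α := by
  rw [zWeight, zBase, Real.div_rpow (norm_nonneg _) (by positivity), Real.rpow_mul hz.le,
    Real.rpow_two]

theorem zWeight_natCast (k : ℕ) (hz : 0 < z.im) : zWeight k z = zBase z ^ k := by
  rw [zWeight_eq _ hz, Real.rpow_natCast]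

theorem inv_im_le (hz : 0 < z.im) : 1 / z.im ≤ zBase z := by
  have : z.im ≤ ‖z‖ := (le_abs_self _).trans (Complex.abs_im_le_norm z)
  rw [zBase, div_le_div_iff₀ hz (by positivity)]
  nlinarith

theorem norm_div_im_le (hz : 0 < z.im) (hM : z.im ≤ M) : ‖z‖ / z.im ≤ M * zBase z := by
  have : ‖z‖ / z.im = z.im * zBase z := by rw [zBase]; field_simp
  rw [this]
  have := (zBase_pos hz).le
  gcongr

theorem norm_le_zBase (hz : 0 < z.im) (hM : z.im ≤ M) : ‖z‖ ≤ M ^ 2 * zBase z := by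
  have : ‖z‖ = z.im ^ 2 * zBase z := by rw [zBase]; field_simp
  rw [this]
  have := (zBase_pos hz).le
  gcongr

/-- On `Im z ≤ M` the base is bounded below, so lower powers of it are dominated by higher ones at
the price of powers of `M`. This allows all exponents to be unified. -/
theorem one_le_mul_zBase (hz : 0 < z.im) (hM : z.im ≤ M) : 1 ≤ M * zBase z := by
  refine le_trans ?_ (norm_div_im_le hz hM)
  rw [le_div_iff₀ hz, one_mul]
  exact (le_abs_self _).trans (Complex.abs_im_le_norm z)

theorem zBase_pow_le (hz : 0 < z.im) (hM : z.im ≤ M) {i j : ℕ} (hij : i ≤ j) :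
    zBase z ^ i ≤ M ^ (j - i) * zBase z ^ j := by
  obtain ⟨k, rfl⟩ := Nat.exists_eq_add_of_le hij
  have h1 := one_le_mul_zBase hz hM
  have h2 := (zBase_pos hz).le
  rw [Nat.add_sub_cancel_left, pow_add]
  calc zBase z ^ i = zBase z ^ i * 1 := (mul_one _).symm
    _ ≤ zBase z ^ i * (M * zBase z) ^ k := by gcongr; exact one_le_pow₀ h1
    _ = _ := by rw [mul_pow]; ring

theorem zWeight_le_natCast {α : ℝ} {k : ℕ} (hk : α ≤ k) (hM0 : 0 < M) (hz : 0 < z.im)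
    (hM : z.im ≤ M) : zWeight α z ≤ M ^ ((k : ℝ) - α) * zBase z ^ k := by
  rw [zWeight_eq _ hz]
  have h1 := one_le_mul_zBase hz hM
  have h2 := zBase_pos hz
  have e : M ^ ((k : ℝ) - α) * zBase z ^ k = zBase z ^ α * (M * zBase z) ^ ((k : ℝ) - α) := by
    rw [Real.mul_rpow hM0.le h2.le, mul_left_comm, ← Real.rpow_add h2, ← Real.rpow_natCast]
    congr 2; ring
  rw [e]
  exact le_mul_of_one_le_right (by positivity) (Real.one_le_rpow h1 (by linarith))

/-- Rounding the exponent up to an integer only changes the constant depending on `M`, after which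
weights can be handled by ring arithmetic. -/
theorem IsOz.exists_nat {ζ : ℕ → ℂ → ℝ} {ε : ℕ → ℝ} (hε : ∀ n, 0 < ε n) (h : IsOz ζ ε) :
    ∃ k : ℕ, ∀ M : ℝ, 0 < M → ∃ C : ℝ, 0 < C ∧
      ∀ n : ℕ, 1 ≤ n → ∀ z : ℂ, 0 < z.im → z.im ≤ M → ζ n z ≤ C * (ε n * zBase z ^ k) := by
  obtain ⟨α, -, hα⟩ := h
  refine ⟨⌈α⌉₊, fun M hM => ?_⟩
  obtain ⟨C, hC, hb⟩ := hα M hM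
  refine ⟨C * M ^ ((⌈α⌉₊ : ℝ) - α), by positivity, fun n hn z hz hzM => (hb n hn z hz hzM).trans ?_⟩
  have h1 := zWeight_le_natCast (Nat.le_ceil α) hM hz hzM
  have := hε n
  calc C * (ε n * zWeight α z) ≤ C * (ε n * (M ^ ((⌈α⌉₊ : ℝ) - α) * zBase z ^ ⌈α⌉₊)) := by gcongr
    _ = _ := by ring

end Weight

/-! ### Deterministic comparison estimates -/

section Compare

variable {γ : ℝ} {z : ℂ}

theorem norm_subKernel_sub_eq {μ μ' : Measure ℝ} [IsProbabilityMeasure μ] [IsProbabilityMeasure μ']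
    (hγ : 0 < γ) {w : ℂ} (hw : 0 < w.im) :
    ‖(γ : ℂ) * (subKernel μ w - subKernel μ' w)‖ =
      γ * (‖w‖ ^ 2 * ‖stieltjes μ w - stieltjes μ' w‖) := by
  rw [subKernel_eq hw.ne', subKernel_eq hw.ne']
  have : w * (1 + w * stieltjes μ w) - w * (1 + w * stieltjes μ' w) =
    w ^ 2 * (stieltjes μ w - stieltjes μ' w) := by ring
  rw [this, norm_mul, norm_mul, norm_pow, Complex.norm_real, Real.norm_of_nonneg hγ.le]

/-- Comparison of the Stieltjes transforms of `MP(γ) ⊠ μ` and `MP(γ) ⊠ μ'`. -/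
theorem norm_stieltjes_mpConv_sub_le {μ μ' : Measure ℝ} [IsProbabilityMeasure μ]
    [IsProbabilityMeasure μ'] (hγ : 0 < γ) (hμ : μ (Set.Iio 0) = 0) (hμ' : μ' (Set.Iio 0) = 0)
    (h2 : Integrable (fun t : ℝ => t ^ 2) μ) (h2' : Integrable (fun t : ℝ => t ^ 2) μ')
    (hz : 0 < z.im) :
    ‖stieltjes (mpConv γ μ) z - stieltjes (mpConv γ μ') z‖ ≤
      2 * (‖recipCauchy γ μ' z‖ ^ 2 * ‖stieltjes μ (recipCauchy γ μ' z) -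
        stieltjes μ' (recipCauchy γ μ' z)‖) / z.im ^ 2 := by
  obtain ⟨h, hg⟩ := isSub_recipCauchy hγ hμ h2 hz
  obtain ⟨h', hg'⟩ := isSub_recipCauchy hγ hμ' h2' hz
  have hs := IsSub.norm_inv_sub_inv_le hγ hz h h'
  rw [norm_subKernel_sub_eq hγ h'.im_pos] at hs
  have e : γ * ‖stieltjes (mpConv γ μ) z - stieltjes (mpConv γ μ') z‖ =
      ‖(recipCauchy γ μ z)⁻¹ - (recipCauchy γ μ' z)⁻¹‖ := by
    have e1 : (γ : ℂ) * (stieltjes (mpConv γ μ) z - stieltjes (mpConv γ μ') z) =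
        -((recipCauchy γ μ z)⁻¹ - (recipCauchy γ μ' z)⁻¹) := by rw [mul_sub, hg, hg']; ring
    have e2 := congrArg norm e1
    rwa [norm_mul, norm_neg, Complex.norm_real, Real.norm_of_nonneg hγ.le] at e2
  refine le_of_mul_le_mul_left ?_ hγ
  rw [e]
  refine hs.trans_eq ?_
  ring

theorem norm_stieltjes_mpConv_le {μ : Measure ℝ} [IsProbabilityMeasure μ] (hγ : 0 < γ)
    (hμ : μ (Set.Iio 0) = 0) (h2 : Integrable (fun t : ℝ => t ^ 2) μ) (hz : 0 < z.im) :
    ‖stieltjes (mpConv γ μ) z‖ ≤ 1 / z.im := by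
  have := (mpConv_isMPConv hγ hμ h2).isProbabilityMeasure
  refine (norm_stieltjes_le hz.ne').trans_eq ?_
  rw [abs_of_pos hz]

variable {n : ℕ} {A B : Matrix (Fin n) (Fin n) ℝ}

theorem isSub_recipCauchy_esd (hn : 1 ≤ n) (hA : A.PosSemidef) (hγ : 0 < γ) (hz : 0 < z.im) :
    IsSub γ (esd A) z (recipCauchy γ (esd A) z) :=
  have := esd_isProbabilityMeasure hn hA.1
  (isSub_recipCauchy hγ (esd_Iio_zero hA) (integrable_sq_esd hn hA.1) hz).1

/-- The distance from a value of the subordination function to the half-line `[0, ∞)`. -/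
theorem dist_recipCauchy_esd_le (hn : 1 ≤ n) (hA : A.PosSemidef) (hγ : 0 < γ) (hz : 0 < z.im)
    (t : ℝ) (ht : 0 ≤ t) :
    z.im * ‖recipCauchy γ (esd A) z‖ / ‖z‖ ≤ ‖(t : ℂ) - recipCauchy γ (esd A) z‖ := by
  have hz0 : 0 < ‖z‖ := hz.trans_le ((le_abs_self _).trans (Complex.abs_im_le_norm z))
  have := esd_isProbabilityMeasure hn hA.1
  rw [div_le_iff₀ hz0, mul_comm _ ‖z‖]
  exact (isSub_recipCauchy_esd hn hA hγ hz).dist_le hγ (esd_Iio_zero hA) ht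

/-- The perturbation term in the stability of the subordination function. -/
theorem norm_subKernel_esd_sub_le (hn : 1 ≤ n) (hA : A.PosSemidef) (hB : B.PosSemidef)
    (hγ : 0 < γ) (hz : 0 < z.im) :
    ‖recipCauchy γ (esd B) z‖ ^ 2 * ‖stieltjes (esd A) (recipCauchy γ (esd B) z) -
      stieltjes (esd B) (recipCauchy γ (esd B) z)‖ ≤
        (‖z‖ / z.im) ^ 2 * (frobNorm (A - B) / √n) := by
  have hz0 : 0 < ‖z‖ := hz.trans_le ((le_abs_self _).trans (Complex.abs_im_le_norm z))
  have h := isSub_recipCauchy_esd hn hB hγ hz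
  have hd := dist_recipCauchy_esd_le hn hB hγ hz
  set w := recipCauchy γ (esd B) z
  have hw : 0 < ‖w‖ := norm_pos_iff.2 h.ne_zero
  have hn0 : (0 : ℝ) < √n := Real.sqrt_pos.2 (by exact_mod_cast hn)
  rw [stieltjes_esd hA.1 h.im_pos, stieltjes_esd hB.1 h.im_pos]
  have h1 := norm_matrixStieltjes_sub_le hn hA hB h.im_pos (by positivity) hd
  -- The prefactor `|w|²` cancels against the square of the distance bound `Im z |w| / |z|`, leaving
  -- no trace of the size of the matrices.
  calc _ ≤ ‖w‖ ^ 2 * (frobNorm (A - B) / (√n * (z.im * ‖w‖ / ‖z‖) ^ 2)) := by gcongr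
    _ = _ := by field_simp

theorem norm_stieltjes_mpConv_esd_sub_le (hn : 1 ≤ n) (hA : A.PosSemidef) (hB : B.PosSemidef)
    (hγ : 0 < γ) (hz : 0 < z.im) :
    ‖stieltjes (mpConv γ (esd A)) z - stieltjes (mpConv γ (esd B)) z‖ ≤
      2 * (‖z‖ / z.im) ^ 2 / (√n * z.im ^ 2) * frobNorm (A - B) := by
  have := esd_isProbabilityMeasure hn hA.1
  have := esd_isProbabilityMeasure hn hB.1
  refine (norm_stieltjes_mpConv_sub_le hγ (esd_Iio_zero hA) (esd_Iio_zero hB)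
    (integrable_sq_esd hn hA.1) (integrable_sq_esd hn hB.1) hz).trans ?_
  have := norm_subKernel_esd_sub_le hn hA hB hγ hz
  calc _ ≤ 2 * ((‖z‖ / z.im) ^ 2 * (frobNorm (A - B) / √n)) / z.im ^ 2 := by gcongr
    _ = _ := by field_simp

/-- The subordination point may belong to another matrix `B`: the distance bound concerns all of
`[0, ∞)` and hence covers the spectrum of `A`. -/
theorem norm_mul_specNorm_resolvent_le (hn : 1 ≤ n) (hA : A.PosSemidef) (hB : B.PosSemidef)
    (hγ : 0 < γ) (hz : 0 < z.im) :
    ‖recipCauchy γ (esd B) z‖ * specNorm (resolventMatrix A (recipCauchy γ (esd B) z)) ≤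
      ‖z‖ / z.im := by
  have hz0 : 0 < ‖z‖ := hz.trans_le ((le_abs_self _).trans (Complex.abs_im_le_norm z))
  have h := isSub_recipCauchy_esd hn hB hγ hz
  have hd := dist_recipCauchy_esd_le hn hB hγ hz
  set w := recipCauchy γ (esd B) z
  have hw : 0 < ‖w‖ := norm_pos_iff.2 h.ne_zero
  have h1 := specNorm_resolventMatrix_le hA h.im_pos (by positivity) hd
  refine (mul_le_mul_of_nonneg_left h1 hw.le).trans_eq ?_
  field_simp

theorem specNorm_GBox_le (hn : 1 ≤ n) (hA : A.PosSemidef) (hγ : 0 < γ) (hz : 0 < z.im) :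
    specNorm (GBox γ A z) ≤ 1 / z.im := by
  have hz0 : 0 < ‖z‖ := hz.trans_le ((le_abs_self _).trans (Complex.abs_im_le_norm z))
  have h := isSub_recipCauchy_esd hn hA hγ hz
  rw [GBox_eq hA.1 (norm_pos_iff.1 hz0) h.im_pos, specNorm_smul, specNorm_smul, norm_inv]
  refine (mul_le_mul_of_nonneg_left (norm_mul_specNorm_resolvent_le hn hA hA hγ hz)
    (by positivity)).trans_eq ?_
  field_simp

/-- Comparison of `GBox` with the resolvent at an arbitrary point of the upper half-plane. -/
theorem specNorm_GBox_sub_le (hn : 1 ≤ n) (hA : A.PosSemidef) (hγ : 0 < γ) (hz : 0 < z.im)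
    {l : ℂ} (hl : 0 < l.im) {c r : ℝ} (hc : ‖l‖ * specNorm (resolventMatrix A l) ≤ c)
    (hr : ‖recipCauchy γ (esd A) z - l‖ ≤ r * ‖recipCauchy γ (esd A) z‖) :
    specNorm (GBox γ A z - z⁻¹ • (l • resolventMatrix A l)) ≤ r * (1 + c) / z.im := by
  have hz0 : 0 < ‖z‖ := hz.trans_le ((le_abs_self _).trans (Complex.abs_im_le_norm z))
  have h := isSub_recipCauchy_esd hn hA hγ hz
  rw [GBox_eq hA.1 (norm_pos_iff.1 hz0) h.im_pos]
  have h1 := norm_mul_specNorm_resolvent_le hn hA hA hγ hz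
  have hw : 0 < ‖recipCauchy γ (esd A) z‖ := norm_pos_iff.2 h.ne_zero
  rw [← smul_sub, smul_resolventMatrix_sub hA.1 h.im_pos hl, specNorm_smul, specNorm_smul, norm_inv]
  set w := recipCauchy γ (esd A) z
  have h2 : specNorm (1 + l • resolventMatrix A l) ≤ 1 + c := by
    refine (specNorm_add_le _ _).trans (add_le_add specNorm_one_le ?_)
    rwa [specNorm_smul]
  have h3 := (specNorm_mul_le (resolventMatrix A w) (1 + l • resolventMatrix A l)).trans
    (mul_le_mul_of_nonneg_left h2 (specNorm_nonneg _))
  have hr0 : 0 ≤ r := by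
    by_contra hneg
    have := (norm_nonneg _).trans hr
    nlinarith
  have hc0 : 0 ≤ 1 + c := (specNorm_nonneg _).trans h2
  have h4 := mul_le_mul hr h3 (specNorm_nonneg _) (by positivity)
  refine (mul_le_mul_of_nonneg_left h4 (by positivity)).trans ?_
  have e : ‖z‖⁻¹ * (r * ‖w‖ * (specNorm (resolventMatrix A w) * (1 + c))) =
      ‖z‖⁻¹ * (r * (1 + c)) * (‖w‖ * specNorm (resolventMatrix A w)) := by ring
  rw [e]
  refine (mul_le_mul_of_nonneg_left h1 (by positivity)).trans_eq ?_
  field_simp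

/-- The change is made in two moves, first of the subordination point with `A` fixed, then of the
matrix with the point fixed. A perturbation above `Im z` is covered by the trivial bound `2 / Im z`.
-/
theorem specNorm_GBox_sub_GBox_le (hn : 1 ≤ n) (hA : A.PosSemidef) (hB : B.PosSemidef)
    (hγ : 0 < γ) (hz : 0 < z.im) :
    specNorm (GBox γ A z - GBox γ B z) ≤ ‖z‖ / z.im * (2 * γ * (‖z‖ / z.im) * (1 + ‖z‖ / z.im) + 1) /
      z.im ^ 2 * frobNorm (A - B) := by
  have := esd_isProbabilityMeasure hn hA.1
  have := esd_isProbabilityMeasure hn hB.1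
  have hzn : z.im ≤ ‖z‖ := (le_abs_self _).trans (Complex.abs_im_le_norm z)
  have hz0 : 0 < ‖z‖ := hz.trans_le hzn
  have hκ : 1 ≤ ‖z‖ / z.im := (one_le_div hz).2 hzn
  have h := isSub_recipCauchy_esd hn hA hγ hz
  have h' := isSub_recipCauchy_esd hn hB hγ hz
  have hδ := norm_subKernel_esd_sub_le hn hA hB hγ hz
  have hst := IsSub.norm_sub_le hγ hz h h'
  rw [norm_subKernel_sub_eq hγ h'.im_pos] at hst
  -- The gain `1/√n` in the perturbation is discarded: the second move has no such gain, so the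
  -- Lipschitz constant is of order one anyway.
  have hn0 : (1 : ℝ) ≤ √n := Real.one_le_sqrt.2 (by exact_mod_cast hn)
  have hf := frobNorm_nonneg (A - B)
  set f := frobNorm (A - B) with hfdef
  set κ := ‖z‖ / z.im with hκdef
  have hδ2 : ‖recipCauchy γ (esd B) z‖ ^ 2 * ‖stieltjes (esd A) (recipCauchy γ (esd B) z) -
      stieltjes (esd B) (recipCauchy γ (esd B) z)‖ ≤ κ ^ 2 * f := by
    refine hδ.trans ?_
    gcongr
    exact div_le_self hf hn0
  set δ := ‖recipCauchy γ (esd B) z‖ ^ 2 * ‖stieltjes (esd A) (recipCauchy γ (esd B) z) -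
      stieltjes (esd B) (recipCauchy γ (esd B) z)‖
  by_cases hcase : γ * δ ≤ z.im
  · have h1 := hst hcase
    have hw : (recipCauchy γ (esd A) z).im ≤ ‖recipCauchy γ (esd A) z‖ :=
      (le_abs_self _).trans (Complex.abs_im_le_norm _)
    have hr : ‖recipCauchy γ (esd A) z - recipCauchy γ (esd B) z‖ ≤
        (2 * (γ * (κ ^ 2 * f)) / z.im) * ‖recipCauchy γ (esd A) z‖ := by
      calc _ ≤ 2 * (γ * δ) * (recipCauchy γ (esd A) z).im / z.im := h1
        _ ≤ 2 * (γ * (κ ^ 2 * f)) * ‖recipCauchy γ (esd A) z‖ / z.im := by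
            have := h.im_pos.le
            gcongr
        _ = _ := by ring
    have h2 := specNorm_GBox_sub_le hn hA hγ hz h'.im_pos
      (norm_mul_specNorm_resolvent_le hn hA hB hγ hz) hr
    have hwB : 0 < ‖recipCauchy γ (esd B) z‖ := norm_pos_iff.2 h'.ne_zero
    have hwBy : z.im ≤ ‖recipCauchy γ (esd B) z‖ := (h'.im_le hγ).trans
      ((le_abs_self _).trans (Complex.abs_im_le_norm _))
    have h3 := specNorm_resolventMatrix_sub_le hA hB h'.im_pos (by positivity)
      (dist_recipCauchy_esd_le hn hB hγ hz)
    have h4 : specNorm (z⁻¹ • (recipCauchy γ (esd B) z • resolventMatrix A (recipCauchy γ (esd B) z))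
        - GBox γ B z) ≤ κ / z.im ^ 2 * f := by
      rw [GBox_eq hB.1 (norm_pos_iff.1 hz0) h'.im_pos, ← smul_sub, ← smul_sub, specNorm_smul,
        specNorm_smul, norm_inv]
      set v := ‖recipCauchy γ (esd B) z‖
      have h5 := mul_le_mul_of_nonneg_left (mul_le_mul_of_nonneg_left h3 hwB.le)
        (inv_nonneg.2 hz0.le)
      refine h5.trans ?_
      rw [← hfdef]
      have e : ‖z‖⁻¹ * (v * (f / (z.im * v / ‖z‖) ^ 2)) = ‖z‖ / z.im ^ 2 * f * (1 / v) := by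
        field_simp
      have e2 : κ / z.im ^ 2 * f = ‖z‖ / z.im ^ 2 * f * (1 / z.im) := by
        rw [hκdef]; ring
      rw [e, e2]
      gcongr
    have e : GBox γ A z - GBox γ B z = (GBox γ A z - z⁻¹ • (recipCauchy γ (esd B) z •
        resolventMatrix A (recipCauchy γ (esd B) z))) + (z⁻¹ • (recipCauchy γ (esd B) z •
        resolventMatrix A (recipCauchy γ (esd B) z)) - GBox γ B z) := by abel
    rw [e]
    refine (specNorm_add_le _ _).trans ((add_le_add h2 h4).trans_eq ?_)
    rw [← hκdef]
    field_simp
  · push Not at hcase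
    refine (specNorm_sub_le _ _).trans ((add_le_add (specNorm_GBox_le hn hA hγ hz)
      (specNorm_GBox_le hn hB hγ hz)).trans ?_)
    calc 1 / z.im + 1 / z.im = 2 * z.im / z.im ^ 2 := by field_simp; ring
      _ ≤ 2 * (γ * (κ ^ 2 * f)) / z.im ^ 2 := by
          have := hcase.le.trans (mul_le_mul_of_nonneg_left hδ2 hγ.le)
          gcongr
      _ = κ * (2 * γ * κ * 1 + 0) / z.im ^ 2 * f := by ring
      _ ≤ κ * (2 * γ * κ * (1 + κ) + 1) / z.im ^ 2 * f := by
          gcongr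
          · linarith
          · exact zero_le_one

end Compare

/-! ### Concentration for Lipschitz functions on the positive semi-definite cone -/

section Conc

variable {Ω : Type*} [MeasurableSpace Ω] {P : Measure Ω}

/-- Lipschitz functions on the positive semi-definite cone extend to all matrices. -/
theorem exists_lipschitz_extension {n : ℕ} {φ : Matrix (Fin n) (Fin n) ℝ → ℂ} {L : ℝ} (hL : 0 ≤ L)
    (hφ : ∀ A B : Matrix (Fin n) (Fin n) ℝ, A.PosSemidef → B.PosSemidef →
      ‖φ A - φ B‖ ≤ L * frobNorm (A - B)) :
    ∃ ψ : Matrix (Fin n) (Fin n) ℝ → ℂ, (∀ A B, ‖ψ A - ψ B‖ ≤ 2 * L * frobNorm (A - B)) ∧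
      ∀ A : Matrix (Fin n) (Fin n) ℝ, A.PosSemidef → ψ A = φ A := by
  let _ : NormedAddCommGroup (Matrix (Fin n) (Fin n) ℝ) := Matrix.frobeniusNormedAddCommGroup
  have hd : ∀ A B : Matrix (Fin n) (Fin n) ℝ, dist A B = frobNorm (A - B) := fun A B =>
    dist_eq_norm A B
  let s : Set (Matrix (Fin n) (Fin n) ℝ) := {A | A.PosSemidef}
  have hre : LipschitzOnWith ⟨L, hL⟩ (fun A => (φ A).re) s := by
    refine LipschitzOnWith.of_dist_le_mul fun A hA B hB => ?_
    rw [hd, Real.dist_eq, ← Complex.sub_re]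
    exact (Complex.abs_re_le_norm _).trans (hφ A B hA hB)
  have him : LipschitzOnWith ⟨L, hL⟩ (fun A => (φ A).im) s := by
    refine LipschitzOnWith.of_dist_le_mul fun A hA B hB => ?_
    rw [hd, Real.dist_eq, ← Complex.sub_im]
    exact (Complex.abs_im_le_norm _).trans (hφ A B hA hB)
  -- Real and imaginary parts are extended separately by McShane's theorem, whence the factor `2`.
  obtain ⟨f, hf, hfs⟩ := hre.extend_real
  obtain ⟨g, hg, hgs⟩ := him.extend_real
  refine ⟨fun A => f A + g A * Complex.I, fun A B => ?_, fun A hA => ?_⟩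
  · have h1 : |f A - f B| ≤ L * frobNorm (A - B) := by
      have := hf.dist_le_mul A B
      rwa [hd, Real.dist_eq] at this
    have h2 : |g A - g B| ≤ L * frobNorm (A - B) := by
      have := hg.dist_le_mul A B
      rwa [hd, Real.dist_eq] at this
    refine (Complex.norm_le_abs_re_add_abs_im _).trans ?_
    simp only [Complex.sub_re, Complex.add_re, Complex.ofReal_re, Complex.mul_re, Complex.I_re,
      mul_zero, Complex.ofReal_im, Complex.I_im, mul_one, sub_self, add_zero, Complex.sub_im,
      Complex.add_im, Complex.mul_im, zero_add]
    linarith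
  · have h1 : (φ A).re = f A := hfs hA
    have h2 : (φ A).im = g A := hgs hA
    simp only
    rw [← h1, ← h2, Complex.re_add_im]

/-- Concentration of a function of `X` that is Lipschitz on the positive semi-definite cone. -/
theorem LipConcWith.comp_of_posSemidef {n : ℕ} {X : Ω → Matrix (Fin n) (Fin n) ℝ} {C σ : ℝ}
    (hX : LipConcWith P frobNorm X C σ) (hpsd : ∀ ω, (X ω).PosSemidef)
    {φ : Matrix (Fin n) (Fin n) ℝ → ℂ} {L : ℝ} (hL : 0 < L)
    (hφ : ∀ A B : Matrix (Fin n) (Fin n) ℝ, A.PosSemidef → B.PosSemidef →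
      ‖φ A - φ B‖ ≤ L * frobNorm (A - B)) :
    Integrable (fun ω => φ (X ω)) P ∧ ∀ t : ℝ, 0 ≤ t →
      P.real {ω | t ≤ ‖φ (X ω) - ∫ ω', φ (X ω') ∂P‖} ≤
        C * Real.exp (-(1 / C) * (t / (2 * L * σ)) ^ 2) := by
  obtain ⟨ψ, hψ, hψφ⟩ := exists_lipschitz_extension hL.le hφ
  have h2L : 0 < 2 * L := by positivity
  have h2L' : ((2 * L : ℝ) : ℂ) ≠ 0 := by exact_mod_cast h2L.ne'
  obtain ⟨hi, ht⟩ := hX (fun A => ((2 * L : ℝ) : ℂ)⁻¹ * ψ A) (fun A B => by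
    rw [← mul_sub, norm_mul, norm_inv, Complex.norm_real, Real.norm_of_nonneg h2L.le,
      inv_mul_le_iff₀ h2L]
    exact hψ A B)
  simp only [fun ω => hψφ (X ω) (hpsd ω)] at hi ht
  refine ⟨?_, fun t ht0 => ?_⟩
  · refine (hi.const_mul ((2 * L : ℝ) : ℂ)).congr (ae_of_all _ fun ω => ?_)
    simp only
    rw [mul_inv_cancel_left₀ h2L']
  · have h := ht (t / (2 * L)) (by positivity)
    rw [integral_const_mul] at h
    simp only [← mul_sub, norm_mul, norm_inv, Complex.norm_real, Real.norm_of_nonneg h2L.le] at h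
    have e : ∀ x : ℝ, t / (2 * L) ≤ (2 * L)⁻¹ * x ↔ t ≤ x := by
      intro x
      rw [div_eq_inv_mul]
      exact mul_le_mul_iff_right₀ (by positivity)
    simp only [e] at h
    rwa [div_div] at h

/-- A constant factor `K` in the scale is absorbed by multiplying `C` in the exponent by `K²`. -/
theorem gaussian_tail_mono {C C' σ σ' K : ℝ} (hC : 0 < C) (hσ : 0 < σ) (hσ' : 0 < σ') (hK : 0 < K)
    (h : σ ≤ K * σ') (h1 : C ≤ C') (h2 : C * K ^ 2 ≤ C') (t : ℝ) :
    C * Real.exp (-(1 / C) * (t / σ) ^ 2) ≤ C' * Real.exp (-(1 / C') * (t / σ') ^ 2) := by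
  have hC' : 0 < C' := hC.trans_le h1
  have h3 : (1 / C') * (t / σ') ^ 2 ≤ (1 / C) * (t / σ) ^ 2 := by
    calc (1 / C') * (t / σ') ^ 2 ≤ (1 / (C * K ^ 2)) * (t / σ') ^ 2 := by gcongr
      _ = (1 / C) * (t ^ 2 / (K * σ') ^ 2) := by field_simp
      _ ≤ (1 / C) * (t ^ 2 / σ ^ 2) := by gcongr
      _ = (1 / C) * (t / σ) ^ 2 := by rw [div_pow]
  have h4 : Real.exp (-(1 / C) * (t / σ) ^ 2) ≤ Real.exp (-(1 / C') * (t / σ') ^ 2) := by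
    rw [Real.exp_le_exp]; linarith
  gcongr

theorem LipConcWith.map_of_posSemidef {n : ℕ} {X : Ω → Matrix (Fin n) (Fin n) ℝ} {C σ : ℝ}
    (hX : LipConcWith P frobNorm X C σ) (hpsd : ∀ ω, (X ω).PosSemidef) {E : Type*}
    [AddCommGroup E] {N : E → ℝ} {Φ : Matrix (Fin n) (Fin n) ℝ → E} {L C' σ' K : ℝ} (hL : 0 < L)
    (hΦ : ∀ A B : Matrix (Fin n) (Fin n) ℝ, A.PosSemidef → B.PosSemidef →
      N (Φ A - Φ B) ≤ L * frobNorm (A - B)) (hC : 0 < C) (hσ : 0 < σ) (hσ' : 0 < σ') (hK : 0 < K)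
    (h : 2 * L * σ ≤ K * σ') (h1 : C ≤ C') (h2 : C * K ^ 2 ≤ C') :
    LipConcWith P N (fun ω => Φ (X ω)) C' σ' := by
  intro f hf
  obtain ⟨hi, ht⟩ := hX.comp_of_posSemidef hpsd (φ := fun A => f (Φ A)) hL
    fun A B hA hB => (hf _ _).trans (hΦ A B hA hB)
  exact ⟨hi, fun t ht0 => (ht t ht0).trans
    (gaussian_tail_mono hC (by positivity) hσ' hK h h1 h2 t)⟩

end Conc

/-! ### Regularity of Stieltjes transforms of random matrices -/

section Uniform

theorem norm_stieltjes_sub_le {μ : Measure ℝ} [IsProbabilityMeasure μ] {ξ ξ' : ℂ} (hξ : 0 < ξ.im)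
    (hξ' : 0 < ξ'.im) : ‖stieltjes μ ξ - stieltjes μ ξ'‖ ≤ ‖ξ - ξ'‖ / (ξ.im * ξ'.im) := by
  rw [stieltjes, stieltjes, ← integral_sub (integrable_inv_sub hξ.ne') (integrable_inv_sub hξ'.ne')]
  have := norm_integral_le_of_norm_le_const (μ := μ)
    (f := fun t : ℝ => 1 / ((t : ℂ) - ξ) - 1 / ((t : ℂ) - ξ')) (C := ‖ξ - ξ'‖ / (ξ.im * ξ'.im))
    (ae_of_all _ fun t => by
      have h1 := ofReal_sub_ne_zero hξ.ne' t
      have h2 := ofReal_sub_ne_zero hξ'.ne' t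
      have e : 1 / ((t : ℂ) - ξ) - 1 / ((t : ℂ) - ξ') =
          (ξ - ξ') / (((t : ℂ) - ξ) * ((t : ℂ) - ξ')) := by field_simp; ring
      rw [e, norm_div, norm_mul]
      have := im_le_norm_ofReal_sub t ξ
      have := im_le_norm_ofReal_sub t ξ'
      gcongr)
  simpa using this

theorem norm_matrixStieltjes_sub_le' {n : ℕ} (hn : 1 ≤ n) {A : Matrix (Fin n) (Fin n) ℝ}
    (hA : A.PosSemidef) {ξ ξ' : ℂ} (hξ : 0 < ξ.im) (hξ' : 0 < ξ'.im) :
    ‖matrixStieltjes A ξ - matrixStieltjes A ξ'‖ ≤ ‖ξ - ξ'‖ / (ξ.im * ξ'.im) := by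
  have := esd_isProbabilityMeasure hn hA.1
  rw [← stieltjes_esd hA.1 hξ, ← stieltjes_esd hA.1 hξ']
  exact norm_stieltjes_sub_le hξ hξ'

variable {Ω : Type*} [MeasurableSpace Ω] {P : Measure Ω}
  {S : ∀ n : ℕ, Ω → Matrix (Fin n) (Fin n) ℝ} {C : ℝ}

/-- The scale `1/n` is the product of the Lipschitz constant of order `1/√n` and the concentration
parameter `1/√n`; the `2` comes from the extension off the cone. -/
theorem matrixStieltjes_concentration {n : ℕ} (hn : 1 ≤ n) {X : Ω → Matrix (Fin n) (Fin n) ℝ}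
    (hX : LipConcWith P frobNorm X C (1 / √(n : ℝ))) (hpsd : ∀ ω, (X ω).PosSemidef) {ξ : ℂ}
    (hξ : 0 < ξ.im) :
    Integrable (fun ω => matrixStieltjes (X ω) ξ) P ∧ ∀ t : ℝ, 0 ≤ t →
      P.real {ω | t ≤ ‖matrixStieltjes (X ω) ξ - ∫ ω', matrixStieltjes (X ω') ξ ∂P‖} ≤
        C * Real.exp (-(1 / C) * (t / (2 / (n * ξ.im ^ 2))) ^ 2) := by
  have hn0 : (0 : ℝ) < n := by exact_mod_cast hn
  have hs : (0 : ℝ) < √n := Real.sqrt_pos.2 hn0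
  have h := hX.comp_of_posSemidef hpsd (φ := fun A => matrixStieltjes A ξ)
    (L := 1 / (√n * ξ.im ^ 2)) (by positivity) (fun A B hA hB => by
      refine (norm_matrixStieltjes_sub_le hn hA hB hξ hξ fun t _ =>
        im_le_norm_ofReal_sub t ξ).trans_eq ?_
      ring)
  have e : 2 * (1 / (√(n : ℝ) * ξ.im ^ 2)) * (1 / √(n : ℝ)) = 2 / (n * ξ.im ^ 2) := by
    conv_rhs => rw [← Real.mul_self_sqrt hn0.le]
    field_simp
  rwa [e] at h

/-- The points of a net in the upper half-plane. -/
def netPoint (n : ℕ) (p : ℤ × ℤ) : ℂ := ⟨p.1 / (n : ℝ) ^ 4, p.2 / (n : ℝ) ^ 4⟩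

/-- The indices of the net. -/
def netIndex (n : ℕ) : Finset (ℤ × ℤ) :=
  Finset.Icc (-(n : ℤ) ^ 6) ((n : ℤ) ^ 6) ×ˢ Finset.Icc 1 ((n : ℤ) ^ 6)

theorem card_netIndex_le {n : ℕ} (hn : 1 ≤ n) : ((netIndex n).card : ℝ) ≤ 3 * (n : ℝ) ^ 12 := by
  have h1 : (netIndex n).card = (2 * n ^ 6 + 1) * n ^ 6 := by
    rw [netIndex, Finset.card_product, Int.card_Icc, Int.card_Icc]
    congr 1
    · have : (n : ℤ) ^ 6 + 1 - -(n : ℤ) ^ 6 = ((2 * n ^ 6 + 1 : ℕ) : ℤ) := by push_cast; ring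
      rw [this, Int.toNat_natCast]
    · have : (n : ℤ) ^ 6 + 1 - 1 = ((n ^ 6 : ℕ) : ℤ) := by push_cast; ring
      rw [this, Int.toNat_natCast]
  rw [h1]
  push_cast
  have : (1 : ℝ) ≤ (n : ℝ) ^ 6 := one_le_pow₀ (by exact_mod_cast hn)
  have e : (n : ℝ) ^ 12 = (n : ℝ) ^ 6 * (n : ℝ) ^ 6 := by ring
  rw [e]
  nlinarith

/-- The imaginary part is rounded up, so the net point is at least as high as `ξ` and bounds
involving inverse heights are not lost. -/
theorem exists_netPoint {n : ℕ} (hn : 1 ≤ n) {ξ : ℂ} (h1 : 1 / (n : ℝ) ≤ ξ.im)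
    (h2 : ‖ξ‖ ≤ (n : ℝ) ^ 2) : ∃ p ∈ netIndex n, ξ.im ≤ (netPoint n p).im ∧
      ‖ξ - netPoint n p‖ ≤ 2 / (n : ℝ) ^ 4 := by
  have hn0 : (0 : ℝ) < n := by exact_mod_cast hn
  have h4 : (0 : ℝ) < (n : ℝ) ^ 4 := by positivity
  have hre := (Complex.abs_re_le_norm ξ).trans h2
  have him := ((le_abs_self _).trans (Complex.abs_im_le_norm ξ)).trans h2
  have hξ : 0 < ξ.im := lt_of_lt_of_le (by positivity) h1
  rw [abs_le] at hre
  refine ⟨(⌊(n : ℝ) ^ 4 * ξ.re⌋, ⌈(n : ℝ) ^ 4 * ξ.im⌉), ?_, ?_, ?_⟩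
  · rw [netIndex, Finset.mem_product, Finset.mem_Icc, Finset.mem_Icc]
    refine ⟨⟨?_, ?_⟩, ?_, ?_⟩
    · rw [Int.le_floor]
      push_cast
      nlinarith
    · have : ((⌊(n : ℝ) ^ 4 * ξ.re⌋ : ℤ) : ℝ) ≤ ((n : ℤ) ^ 6 : ℤ) := by
        refine (Int.floor_le _).trans ?_
        push_cast
        nlinarith
      exact_mod_cast this
    · exact Int.one_le_ceil_iff.2 (by positivity)
    · rw [Int.ceil_le]
      push_cast
      nlinarith
  · rw [netPoint]
    simp only
    rw [le_div_iff₀ h4, mul_comm]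
    exact Int.le_ceil _
  · refine (Complex.norm_le_abs_re_add_abs_im _).trans ?_
    simp only [netPoint, Complex.sub_re, Complex.sub_im]
    have e1 : |ξ.re - (⌊(n : ℝ) ^ 4 * ξ.re⌋ : ℝ) / (n : ℝ) ^ 4| ≤ 1 / (n : ℝ) ^ 4 := by
      have : ξ.re - (⌊(n : ℝ) ^ 4 * ξ.re⌋ : ℝ) / (n : ℝ) ^ 4 =
        ((n : ℝ) ^ 4 * ξ.re - ⌊(n : ℝ) ^ 4 * ξ.re⌋) / (n : ℝ) ^ 4 := by field_simp
      rw [this, abs_div, abs_of_pos h4]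
      gcongr
      rw [abs_le]
      have := Int.floor_le ((n : ℝ) ^ 4 * ξ.re)
      have := Int.lt_floor_add_one ((n : ℝ) ^ 4 * ξ.re)
      constructor <;> linarith
    have e2 : |ξ.im - (⌈(n : ℝ) ^ 4 * ξ.im⌉ : ℝ) / (n : ℝ) ^ 4| ≤ 1 / (n : ℝ) ^ 4 := by
      have : ξ.im - (⌈(n : ℝ) ^ 4 * ξ.im⌉ : ℝ) / (n : ℝ) ^ 4 =
        ((n : ℝ) ^ 4 * ξ.im - ⌈(n : ℝ) ^ 4 * ξ.im⌉) / (n : ℝ) ^ 4 := by field_simp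
      rw [this, abs_div, abs_of_pos h4]
      gcongr
      rw [abs_le]
      have := Int.le_ceil ((n : ℝ) ^ 4 * ξ.im)
      have := Int.ceil_lt_add_one ((n : ℝ) ^ 4 * ξ.im)
      constructor <;> linarith
    calc _ ≤ 1 / (n : ℝ) ^ 4 + 1 / (n : ℝ) ^ 4 := add_le_add e1 e2
      _ = 2 / (n : ℝ) ^ 4 := by ring

/-- Almost surely, the Stieltjes transforms are eventually close to their expectations, uniformly
over a region of the upper half-plane that grows polynomially. -/
theorem ae_eventually_norm_matrixStieltjes_sub_le [IsProbabilityMeasure P] (hC : 0 < C)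
    (hS : ∀ n : ℕ, 1 ≤ n → LipConcWith P frobNorm (S n) C (1 / √(n : ℝ)))
    (hpsd : ∀ n ω, (S n ω).PosSemidef) :
    ∀ᵐ ω ∂P, ∀ᶠ n : ℕ in atTop, ∀ ξ : ℂ, 1 / (n : ℝ) ≤ ξ.im → ‖ξ‖ ≤ (n : ℝ) ^ 2 →
      ‖matrixStieltjes (S n ω) ξ - ∫ ω', matrixStieltjes (S n ω') ξ ∂P‖ ≤
        √(56 * C) * (√(Real.log n) / n) / ξ.im ^ 2 + 4 / n := by
  -- At deviation `T` the exponent is `-K² log n / (4 C) = -14 log n`: the tail `C n⁻¹⁴` against at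
  -- most `3 n¹²` net points leaves the summable `n⁻²`.
  set K := √(56 * C) with hK
  let T : ℕ → ℂ → ℝ := fun n ξ => K * (√(Real.log n) / n) / ξ.im ^ 2
  let bad : ℕ → ℤ × ℤ → Set Ω := fun n p =>
    {ω | T n (netPoint n p) ≤ ‖matrixStieltjes (S n ω) (netPoint n p) -
      ∫ ω', matrixStieltjes (S n ω') (netPoint n p) ∂P‖}
  let Bad : ℕ → Set Ω := fun n => ⋃ p ∈ netIndex n, bad n p
  have hbad : ∀ n : ℕ, 1 ≤ n → ∀ p ∈ netIndex n, P.real (bad n p) ≤ C * ((n : ℝ) ^ 14)⁻¹ := by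
    intro n hn p hp
    have hn0 : (0 : ℝ) < n := by exact_mod_cast hn
    have hp2 : 1 ≤ p.2 := by
      rw [netIndex, Finset.mem_product, Finset.mem_Icc, Finset.mem_Icc] at hp
      exact hp.2.1
    have him : 0 < (netPoint n p).im := by
      have : (0 : ℝ) < p.2 := by exact_mod_cast (by omega : 0 < p.2)
      simp only [netPoint]; positivity
    have hl : 0 ≤ Real.log n := Real.log_natCast_nonneg n
    refine ((matrixStieltjes_concentration hn (hS n hn) (hpsd n) him).2 _ (by
      simp only [T]; positivity)).trans ?_
    refine le_of_eq ?_
    congr 1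
    have e : T n (netPoint n p) / (2 / (n * (netPoint n p).im ^ 2)) = K * √(Real.log n) / 2 := by
      simp only [T]; field_simp
    rw [e, div_pow, mul_pow, hK, Real.sq_sqrt (by positivity), Real.sq_sqrt hl]
    have e2 : -(1 / C) * (56 * C * Real.log n / 2 ^ 2) = -(Real.log ((n : ℝ) ^ 14)) := by
      rw [Real.log_pow]; push_cast; field_simp; ring
    rw [e2, Real.exp_neg, Real.exp_log (by positivity)]
  have hBad : ∀ n : ℕ, 1 ≤ n → P.real (Bad n) ≤ 3 * C * ((n : ℝ) ^ 2)⁻¹ := by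
    intro n hn
    have hn0 : (0 : ℝ) < n := by exact_mod_cast hn
    calc P.real (Bad n) ≤ ∑ p ∈ netIndex n, P.real (bad n p) := measureReal_biUnion_finset_le _ _
      _ ≤ ∑ p ∈ netIndex n, C * ((n : ℝ) ^ 14)⁻¹ := Finset.sum_le_sum (hbad n hn)
      _ = (netIndex n).card * (C * ((n : ℝ) ^ 14)⁻¹) := by rw [Finset.sum_const, nsmul_eq_mul]
      _ ≤ 3 * (n : ℝ) ^ 12 * (C * ((n : ℝ) ^ 14)⁻¹) := by
          gcongr; exact card_netIndex_le hn
      _ = 3 * C * ((n : ℝ) ^ 2)⁻¹ := by field_simp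
  have hsum : ∑' n, P (Bad n) ≠ ⊤ := by
    have hs : Summable fun n : ℕ => P.real (Bad n) := by
      refine Summable.of_norm_bounded_eventually_nat
        ((Real.summable_nat_pow_inv.2 one_lt_two).mul_left (3 * C)) ?_
      filter_upwards [eventually_ge_atTop 1] with n hn
      rw [Real.norm_of_nonneg measureReal_nonneg]
      exact hBad n hn
    have := hs.tsum_ofReal_ne_top
    have e : ∀ n, ENNReal.ofReal (P.real (Bad n)) = P (Bad n) := fun n =>
      ofReal_measureReal (measure_ne_top P _)
    simpa only [e] using this
  -- Borel–Cantelli.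
  filter_upwards [ae_eventually_notMem hsum] with ω hω
  filter_upwards [hω, eventually_ge_atTop 1] with n hnω hn ξ h1 h2
  have hn0 : (0 : ℝ) < n := by exact_mod_cast hn
  have hn1 : (1 : ℝ) ≤ n := by exact_mod_cast hn
  obtain ⟨p, hp, him, hdist⟩ := exists_netPoint hn h1 h2
  have hξ : 0 < ξ.im := lt_of_lt_of_le (by positivity) h1
  have hq : 0 < (netPoint n p).im := hξ.trans_le him
  have hgood : ‖matrixStieltjes (S n ω) (netPoint n p) -
      ∫ ω', matrixStieltjes (S n ω') (netPoint n p) ∂P‖ ≤ T n ξ := by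
    have : ω ∉ bad n p := fun h => hnω (Set.mem_biUnion hp h)
    simp only [bad, Set.mem_ofPred_eq, not_le] at this
    refine this.le.trans ?_
    simp only [T]
    gcongr
  -- Mesh `2 n⁻⁴` against inverse heights of at most `n` each; the error occurs twice, for the
  -- sample and for the mean, which gives the final `4 / n`.
  have hlip : ‖ξ - netPoint n p‖ / (ξ.im * (netPoint n p).im) ≤ 2 / n := by
    calc ‖ξ - netPoint n p‖ / (ξ.im * (netPoint n p).im)
        ≤ (2 / (n : ℝ) ^ 4) / ((1 / n) * (1 / n)) := by
          have := h1.trans him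
          gcongr
      _ = 2 / (n : ℝ) ^ 2 := by field_simp
      _ ≤ 2 / n := by
          gcongr
          nlinarith
  have ha := (norm_matrixStieltjes_sub_le' hn (hpsd n ω) hξ hq).trans hlip
  have hb : ‖(∫ ω', matrixStieltjes (S n ω') (netPoint n p) ∂P) -
      ∫ ω', matrixStieltjes (S n ω') ξ ∂P‖ ≤ 2 / n := by
    rw [← integral_sub (matrixStieltjes_concentration hn (hS n hn) (hpsd n) hq).1
      (matrixStieltjes_concentration hn (hS n hn) (hpsd n) hξ).1]
    have := norm_integral_le_of_norm_le_const (μ := P) (C := 2 / (n : ℝ))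
      (f := fun ω' => matrixStieltjes (S n ω') (netPoint n p) - matrixStieltjes (S n ω') ξ)
      (ae_of_all _ fun ω' => by
        rw [norm_sub_rev]
        exact (norm_matrixStieltjes_sub_le' hn (hpsd n ω') hξ hq).trans hlip)
    simpa using this
  have e : matrixStieltjes (S n ω) ξ - ∫ ω', matrixStieltjes (S n ω') ξ ∂P =
      (matrixStieltjes (S n ω) ξ - matrixStieltjes (S n ω) (netPoint n p)) +
      (matrixStieltjes (S n ω) (netPoint n p) -
        ∫ ω', matrixStieltjes (S n ω') (netPoint n p) ∂P) +
      ((∫ ω', matrixStieltjes (S n ω') (netPoint n p) ∂P) -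
        ∫ ω', matrixStieltjes (S n ω') ξ ∂P) := by ring
  rw [e]
  refine (norm_add₃_le).trans ?_
  have : (4 : ℝ) / n = 2 / n + 2 / n := by ring
  rw [this]
  linarith

end Uniform

/-! ### Concentration of the Stieltjes transform and of the matrix function -/

section Concentration

variable {Ω : Type*} [MeasurableSpace Ω] {P : Measure Ω} {γ : ℕ → ℝ} {a b : ℝ}
  {S : ∀ n : ℕ, Ω → Matrix (Fin n) (Fin n) ℝ}

/-- The exponent `4` counts two powers from `(|z| / Im z)²` and two from `1 / Im(z)²`. -/
theorem lipConcOz_stieltjes_mpConv (ha : 0 < a) (hγ : ∀ n, a ≤ γ n)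
    (hSpsd : ∀ n ω, (S n ω).PosSemidef)
    (hSconc : LipConc P (fun _ => frobNorm) S (fun n => 1 / √(n : ℝ))) :
    LipConcOz (E := fun _ => ℂ) P (fun _ w => ‖w‖)
      (fun n z ω => stieltjes (mpConv (γ n) (esd (S n ω))) z) (fun n => 1 / (n : ℝ)) := by
  obtain ⟨C, hC, hS⟩ := hSconc
  refine ⟨((4 : ℕ) : ℝ), by positivity, fun M hM => ⟨max C (C * (4 * M ^ 2) ^ 2),
    hC.trans_le (le_max_left _ _), fun n hn z hz hzM => ?_⟩⟩
  have hn0 : (0 : ℝ) < n := by exact_mod_cast hn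
  have hs : (0 : ℝ) < √n := Real.sqrt_pos.2 hn0
  have hQ := zBase_pos hz
  have hκ := norm_div_im_le hz hzM
  have hκ0 : 0 < ‖z‖ / z.im :=
    div_pos (hz.trans_le ((le_abs_self _).trans (Complex.abs_im_le_norm z))) hz
  have hy := inv_im_le hz
  have hγ0 := ha.trans_le (hγ n)
  rw [zWeight_natCast _ hz]
  refine (hS n hn).map_of_posSemidef (hSpsd n)
    (Φ := fun A => stieltjes (mpConv (γ n) (esd A)) z) (N := fun w : ℂ => ‖w‖)
    (L := 2 * (‖z‖ / z.im) ^ 2 / (√n * z.im ^ 2)) (K := 4 * M ^ 2) (by positivity)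
    (fun A B hA hB => norm_stieltjes_mpConv_esd_sub_le hn hA hB hγ0 hz) hC (by positivity)
    (by positivity) (by positivity) ?_ (le_max_left _ _) (le_max_right _ _)
  calc 2 * (2 * (‖z‖ / z.im) ^ 2 / (√(n : ℝ) * z.im ^ 2)) * (1 / √(n : ℝ))
      = 4 * (‖z‖ / z.im) ^ 2 * (1 / z.im) ^ 2 * (1 / n) := by
        conv_rhs => rw [← Real.mul_self_sqrt hn0.le]
        field_simp
        ring
    _ ≤ 4 * (M * zBase z) ^ 2 * zBase z ^ 2 * (1 / n) := by gcongr
    _ = 4 * M ^ 2 * (1 / n * zBase z ^ 4) := by ring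

/-- The exponent `5` counts three factors `|z| / Im z` and two factors `1 / Im z`; lower-order terms
are raised to this degree by `1 ≤ M * zBase z`. -/
theorem lipConcOz_GBox (ha : 0 < a) (hγ : ∀ n, a ≤ γ n ∧ γ n ≤ b)
    (hSpsd : ∀ n ω, (S n ω).PosSemidef)
    (hSconc : LipConc P (fun _ => frobNorm) S (fun n => 1 / √(n : ℝ))) :
    LipConcOz P (fun _ => specNorm) (fun n z ω => GBox (γ n) (S n ω) z)
      (fun n => 1 / √(n : ℝ)) := by
  obtain ⟨C, hC, hS⟩ := hSconc
  have hb : 0 < b := ha.trans_le ((hγ 0).1.trans (hγ 0).2)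
  refine ⟨((5 : ℕ) : ℝ), by positivity, fun M hM =>
    ⟨max C (C * (2 * (M ^ 3 * (4 * b + 1))) ^ 2),
    hC.trans_le (le_max_left _ _), fun n hn z hz hzM => ?_⟩⟩
  have hn0 : (0 : ℝ) < n := by exact_mod_cast hn
  have hs : (0 : ℝ) < √n := Real.sqrt_pos.2 hn0
  have hQ := zBase_pos hz
  have hκ := norm_div_im_le hz hzM
  have hκ0 : 0 < ‖z‖ / z.im :=
    div_pos (hz.trans_le ((le_abs_self _).trans (Complex.abs_im_le_norm z))) hz
  have h1 := one_le_mul_zBase hz hzM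
  have hy := inv_im_le hz
  have hγ0 := ha.trans_le (hγ n).1
  have hγb := (hγ n).2
  rw [zWeight_natCast _ hz]
  refine (hS n hn).map_of_posSemidef (hSpsd n)
    (Φ := fun A => GBox (γ n) A z) (N := specNorm)
    (L := ‖z‖ / z.im * (2 * γ n * (‖z‖ / z.im) * (1 + ‖z‖ / z.im) + 1) / z.im ^ 2)
    (K := 2 * (M ^ 3 * (4 * b + 1))) (by positivity)
    (fun A B hA hB => specNorm_GBox_sub_GBox_le hn hA hB hγ0 hz) hC (by positivity)
    (by positivity) (by positivity) ?_ (le_max_left _ _) (le_max_right _ _)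
  have e : ‖z‖ / z.im * (2 * γ n * (‖z‖ / z.im) * (1 + ‖z‖ / z.im) + 1) / z.im ^ 2 ≤
      M ^ 3 * (4 * b + 1) * zBase z ^ 5 := by
    calc ‖z‖ / z.im * (2 * γ n * (‖z‖ / z.im) * (1 + ‖z‖ / z.im) + 1) / z.im ^ 2
        = ‖z‖ / z.im * (2 * γ n * (‖z‖ / z.im) * (1 + ‖z‖ / z.im) + 1) * (1 / z.im) ^ 2 := by
          field_simp
      _ ≤ M * zBase z * (2 * b * (M * zBase z) * (M * zBase z + M * zBase z) +
            (M * zBase z) ^ 2) * zBase z ^ 2 := by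
          have := one_le_pow₀ h1 (n := 2)
          gcongr
      _ = M ^ 3 * (4 * b + 1) * zBase z ^ 5 := by ring
  calc _ ≤ 2 * (M ^ 3 * (4 * b + 1) * zBase z ^ 5) * (1 / √(n : ℝ)) := by gcongr
    _ = _ := by ring

end Concentration

/-! ### Comparison with the deterministic measure -/

section Comparison

variable {γ b B M : ℝ} {τ : Measure ℝ} [IsProbabilityMeasure τ] {z : ℂ}

/-- The constant in the bound of the reciprocal Cauchy transform. -/
def recipBound (b B M : ℝ) : ℝ := M ^ 2 + b * (M + B * (M + 1))

theorem recipBound_pos (hb : 0 < b) (hB : 0 ≤ B) (hM : 0 < M) : 0 < recipBound b B M := by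
  rw [recipBound]; positivity

theorem norm_recipCauchy_le (hγ : 0 < γ) (hγb : γ ≤ b) (hτ : τ (Set.Iio 0) = 0)
    (h2 : Integrable (fun t : ℝ => t ^ 2) τ) (hB : ∫ t, t ^ 2 ∂τ ≤ B) (hz : 0 < z.im)
    (hzM : z.im ≤ M) : ‖recipCauchy γ τ z‖ ≤ recipBound b B M * zBase z := by
  have h0 : 0 ≤ ∫ t, t ^ 2 ∂τ := integral_sq_nonneg
  have hB0 := h0.trans hB
  have hb := hγ.le.trans hγb
  have h1 := one_le_mul_zBase hz hzM
  have hy := inv_im_le hz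
  have hQ := zBase_pos hz
  calc ‖recipCauchy γ τ z‖ ≤ ‖z‖ + γ * (1 + (∫ t, t ^ 2 ∂τ) * (1 + 1 / z.im)) :=
        (isSub_recipCauchy hγ hτ h2 hz).1.norm_le hγ hz h2
    _ ≤ M ^ 2 * zBase z + b * (M * zBase z + B * (M * zBase z + zBase z)) := by
        have := norm_le_zBase hz hzM
        gcongr
    _ = recipBound b B M * zBase z := by rw [recipBound]; ring

theorem recipCauchy_im_le (hγ : 0 < γ) (hγb : γ ≤ b) (hτ : τ (Set.Iio 0) = 0)
    (h2 : Integrable (fun t : ℝ => t ^ 2) τ) (hB : ∫ t, t ^ 2 ∂τ ≤ B) (hz : 0 < z.im)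
    (hzM : z.im ≤ M) : (recipCauchy γ τ z).im ≤ max 1 (M + b * B) := by
  have h0 : 0 ≤ ∫ t, t ^ 2 ∂τ := integral_sq_nonneg
  have hb := hγ.le.trans hγb
  refine ((isSub_recipCauchy hγ hτ h2 hz).1.im_bound hγ h2).trans ?_
  gcongr

/-- The point `l(z)` has modulus of order `zBase z` and height at least `Im z`. A bound `O_z` at
`l(z)` thus remains `O_z` in `z`, with exponent tripled. -/
theorem zBase_recipCauchy_le (hγ : 0 < γ) (hγb : γ ≤ b) (hτ : τ (Set.Iio 0) = 0)
    (h2 : Integrable (fun t : ℝ => t ^ 2) τ) (hB : ∫ t, t ^ 2 ∂τ ≤ B) (hz : 0 < z.im)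
    (hzM : z.im ≤ M) : zBase (recipCauchy γ τ z) ≤ recipBound b B M * zBase z ^ 3 := by
  have hl := norm_recipCauchy_le hγ hγb hτ h2 hB hz hzM
  have him := (isSub_recipCauchy hγ hτ h2 hz).1.im_le hγ
  have hy := inv_im_le hz
  have hQ := zBase_pos hz
  have hnn : 0 ≤ recipBound b B M * zBase z := (norm_nonneg _).trans hl
  calc zBase (recipCauchy γ τ z) ≤ recipBound b B M * zBase z / z.im ^ 2 := by
        rw [zBase]; gcongr
    _ = recipBound b B M * zBase z * (1 / z.im) ^ 2 := by field_simp
    _ ≤ recipBound b B M * zBase z * zBase z ^ 2 := by gcongr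
    _ = recipBound b B M * zBase z ^ 3 := by ring

variable {n : ℕ} {A : Matrix (Fin n) (Fin n) ℝ}

theorem norm_stieltjes_mpConv_esd_sub_stieltjes_le (hn : 1 ≤ n) (hA : A.PosSemidef) (hγ : 0 < γ)
    (hγb : γ ≤ b) (hτ : τ (Set.Iio 0) = 0) (h2 : Integrable (fun t : ℝ => t ^ 2) τ)
    (hB : ∫ t, t ^ 2 ∂τ ≤ B) (hz : 0 < z.im) (hzM : z.im ≤ M) :
    ‖stieltjes (mpConv γ (esd A)) z - stieltjes (mpConv γ τ) z‖ ≤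
      2 * recipBound b B M ^ 2 * zBase z ^ 4 *
        ‖matrixStieltjes A (recipCauchy γ τ z) - stieltjes τ (recipCauchy γ τ z)‖ := by
  have := esd_isProbabilityMeasure hn hA.1
  have hl := norm_recipCauchy_le hγ hγb hτ h2 hB hz hzM
  have hpos := (isSub_recipCauchy hγ hτ h2 hz).1.im_pos
  have hy := inv_im_le hz
  have hQ := zBase_pos hz
  refine (norm_stieltjes_mpConv_sub_le hγ (esd_Iio_zero hA) hτ (integrable_sq_esd hn hA.1) h2
    hz).trans ?_
  rw [stieltjes_esd hA.1 hpos]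
  set D := ‖matrixStieltjes A (recipCauchy γ τ z) - stieltjes τ (recipCauchy γ τ z)‖
  have hD : 0 ≤ D := norm_nonneg _
  calc 2 * (‖recipCauchy γ τ z‖ ^ 2 * D) / z.im ^ 2
      = 2 * (‖recipCauchy γ τ z‖ ^ 2 * D) * (1 / z.im) ^ 2 := by field_simp
    _ ≤ 2 * ((recipBound b B M * zBase z) ^ 2 * D) * zBase z ^ 2 := by gcongr
    _ = _ := by ring

theorem norm_stieltjes_mpConv_esd_sub_stieltjes_le_zBase (hn : 1 ≤ n) (hA : A.PosSemidef)
    (hγ : 0 < γ) (hτ : τ (Set.Iio 0) = 0) (h2 : Integrable (fun t : ℝ => t ^ 2) τ)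
    (hz : 0 < z.im) :
    ‖stieltjes (mpConv γ (esd A)) z - stieltjes (mpConv γ τ) z‖ ≤ 2 * zBase z := by
  have := esd_isProbabilityMeasure hn hA.1
  have h1 := norm_stieltjes_mpConv_le hγ (esd_Iio_zero hA) (integrable_sq_esd hn hA.1) hz
  have h2 := norm_stieltjes_mpConv_le hγ hτ h2 hz
  have := inv_im_le hz
  refine (norm_sub_le _ _).trans ?_
  linarith

theorem norm_inv_mul_recipCauchy_le (hγ : 0 < γ)
    (hγb : γ ≤ b) (hτ : τ (Set.Iio 0) = 0) (h2 : Integrable (fun t : ℝ => t ^ 2) τ)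
    (hB : ∫ t, t ^ 2 ∂τ ≤ B) (hz : 0 < z.im) (hzM : z.im ≤ M) :
    ‖z⁻¹ * recipCauchy γ τ z‖ ≤ recipBound b B M * zBase z ^ 2 := by
  have hl := norm_recipCauchy_le hγ hγb hτ h2 hB hz hzM
  have hy := inv_im_le hz
  have hQ := zBase_pos hz
  have hz' : ‖z⁻¹‖ ≤ zBase z := by
    rw [norm_inv, ← one_div]
    refine le_trans ?_ hy
    have : z.im ≤ ‖z‖ := (le_abs_self _).trans (Complex.abs_im_le_norm z)
    gcongr
  rw [norm_mul]
  calc ‖z⁻¹‖ * ‖recipCauchy γ τ z‖ ≤ zBase z * (recipBound b B M * zBase z) := by gcongr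
    _ = _ := by ring

/-- The identity `w - l = -l (1/w - 1/l) w` turns stability of reciprocals into the relative error
required by `specNorm_GBox_sub_le`. The right-hand side involves randomness only through the
Stieltjes transform at the deterministic point `l`. -/
theorem specNorm_GBox_sub_resolvent_le (hn : 1 ≤ n) (hA : A.PosSemidef) (hγ : 0 < γ)
    (hγb : γ ≤ b) (hτ : τ (Set.Iio 0) = 0) (h2 : Integrable (fun t : ℝ => t ^ 2) τ)
    (hB : ∫ t, t ^ 2 ∂τ ≤ B) (hz : 0 < z.im) (hzM : z.im ≤ M) :
    specNorm (GBox γ A z - z⁻¹ • (recipCauchy γ τ z • resolventMatrix A (recipCauchy γ τ z))) ≤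
      2 * b * recipBound b B M ^ 3 * (M ^ 2 + recipBound b B M) * zBase z ^ 8 *
        ‖matrixStieltjes A (recipCauchy γ τ z) - stieltjes τ (recipCauchy γ τ z)‖ := by
  have := esd_isProbabilityMeasure hn hA.1
  have hl := norm_recipCauchy_le hγ hγb hτ h2 hB hz hzM
  have hsub := (isSub_recipCauchy hγ hτ h2 hz).1
  have hsub' := isSub_recipCauchy_esd hn hA hγ hz
  have hinv := hsub'.norm_inv_sub_inv_le hγ hz hsub
  have him := hsub.im_le hγ
  have hpos := hsub.im_pos
  have hl0 := hsub.ne_zero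
  have hw0 := hsub'.ne_zero
  have hy := inv_im_le hz
  have hQ := zBase_pos hz
  have h1 := one_le_mul_zBase hz hzM
  have hb := hγ.le.trans hγb
  rw [norm_subKernel_sub_eq hγ hpos, stieltjes_esd hA.1 hpos] at hinv
  set D := ‖matrixStieltjes A (recipCauchy γ τ z) - stieltjes τ (recipCauchy γ τ z)‖
  have hD : 0 ≤ D := norm_nonneg _
  set l := recipCauchy γ τ z
  set w := recipCauchy γ (esd A) z
  have hC1 : 0 ≤ recipBound b B M := by
    by_contra h
    push Not at h
    have := mul_neg_of_neg_of_pos h hQ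
    linarith [norm_nonneg l]
  have hM : 0 < M := hz.trans_le hzM
  have hc : ‖l‖ * specNorm (resolventMatrix A l) ≤ ‖l‖ * (1 / z.im) :=
    mul_le_mul_of_nonneg_left ((specNorm_resolventMatrix_le_im hA hpos).trans (by gcongr))
      (norm_nonneg _)
  have hr : ‖w - l‖ ≤ ‖l‖ * ‖w⁻¹ - l⁻¹‖ * ‖w‖ := by
    rw [← norm_mul, ← norm_mul]
    have : l * (w⁻¹ - l⁻¹) * w = -(w - l) := by field_simp; ring
    rw [this, norm_neg]
  refine (specNorm_GBox_sub_le hn hA hγ hz hpos hc hr).trans ?_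
  have hinv' : ‖w⁻¹ - l⁻¹‖ ≤ 2 * (b * ((recipBound b B M * zBase z) ^ 2 * D)) * zBase z ^ 2 := by
    refine hinv.trans ?_
    calc 2 * (γ * (‖l‖ ^ 2 * D)) / z.im ^ 2 = 2 * (γ * (‖l‖ ^ 2 * D)) * (1 / z.im) ^ 2 := by
          field_simp
      _ ≤ _ := by gcongr
  calc ‖l‖ * ‖w⁻¹ - l⁻¹‖ * (1 + ‖l‖ * (1 / z.im)) / z.im
      = ‖l‖ * ‖w⁻¹ - l⁻¹‖ * (1 + ‖l‖ * (1 / z.im)) * (1 / z.im) := by field_simp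
    _ ≤ recipBound b B M * zBase z * (2 * (b * ((recipBound b B M * zBase z) ^ 2 * D)) *
          zBase z ^ 2) * ((M * zBase z) ^ 2 + recipBound b B M * zBase z * zBase z) * zBase z := by
        have := one_le_pow₀ h1 (n := 2)
        gcongr
    _ = _ := by ring

end Comparison

/-! ### Almost sure bounds -/

section AlmostSure

variable {Ω : Type*} [MeasurableSpace Ω] {P : Measure Ω} [IsProbabilityMeasure P] {γ : ℕ → ℝ}
  {a b : ℝ} {S : ∀ n : ℕ, Ω → Matrix (Fin n) (Fin n) ℝ} {τ : ℕ → Measure ℝ} {ε : ℕ → ℝ}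

theorem one_div_le_sqrt_log_div {n : ℕ} (hn : 3 ≤ n) : 1 / (n : ℝ) ≤ √(Real.log n) / n := by
  have h3 : (3 : ℝ) ≤ n := by exact_mod_cast hn
  have : 1 ≤ Real.log n := by
    rw [Real.le_log_iff_exp_le (by linarith)]
    exact (Real.exp_one_lt_d9.le.trans (by norm_num)).trans h3
  have := Real.one_le_sqrt.2 this
  gcongr

/-- A bound for `E[g_S(l)] - g_τ(l)` at the reciprocal Cauchy transform `l` of the deterministic
measure. -/
theorem exists_norm_integral_sub_le [∀ n, IsProbabilityMeasure (τ n)] {B : ℝ} (ha : 0 < a)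
    (hγ : ∀ n, a ≤ γ n ∧ γ n ≤ b) (hτ : ∀ n, τ n (Set.Iio 0) = 0)
    (h2 : ∀ n, Integrable (fun t : ℝ => t ^ 2) (τ n)) (hB : ∀ n, ∫ t, t ^ 2 ∂(τ n) ≤ B)
    {ζ : ℕ → ℂ → ℝ} (hε : ∀ n, 0 < ε n) (h : IsOz ζ ε) :
    ∃ k : ℕ, ∀ M : ℝ, 0 < M → ∃ C : ℝ, 0 < C ∧ ∀ n : ℕ, 1 ≤ n → ∀ z : ℂ, 0 < z.im → z.im ≤ M →
      ζ n (recipCauchy (γ n) (τ n) z) ≤ C * (ε n * zBase z ^ k) := by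
  obtain ⟨k, hk⟩ := h.exists_nat hε
  have hb : 0 < b := ha.trans_le ((hγ 0).1.trans (hγ 0).2)
  have hB0 : 0 ≤ B := integral_sq_nonneg.trans (hB 0)
  refine ⟨3 * k, fun M hM => ?_⟩
  -- The hypothesis is invoked with the height bound of `l(z)` in place of `M`.
  obtain ⟨C, hC, hCb⟩ := hk (max 1 (M + b * B)) (by positivity)
  have hR := recipBound_pos hb hB0 hM
  refine ⟨C * recipBound b B M ^ k, by positivity, fun n hn z hz hzM => ?_⟩
  have hγ0 := ha.trans_le (hγ n).1
  have hpos := (isSub_recipCauchy hγ0 (hτ n) (h2 n) hz).1.im_pos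
  have hz3 := zBase_recipCauchy_le hγ0 (hγ n).2 (hτ n) (h2 n) (hB n) hz hzM
  have hεn := hε n
  have hQl := zBase_pos hpos
  calc _ ≤ C * (ε n * zBase (recipCauchy (γ n) (τ n) z) ^ k) := hCb n hn _ hpos
        (recipCauchy_im_le hγ0 (hγ n).2 (hτ n) (h2 n) (hB n) hz hzM)
    _ ≤ C * (ε n * (recipBound b B M * zBase z ^ 3) ^ k) := by gcongr
    _ = _ := by rw [mul_pow, ← pow_mul]; ring

/-- Stability reduces the claim to `g_S - g_τ` at `l(z)`, split into the almost sure fluctuation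
around the mean and the assumed bias. -/
theorem aeIsOz_stieltjes_mpConv_sub [∀ n, IsProbabilityMeasure (τ n)] {B : ℝ} (ha : 0 < a)
    (hγ : ∀ n, a ≤ γ n ∧ γ n ≤ b) (hSpsd : ∀ n ω, (S n ω).PosSemidef)
    (hSconc : LipConc P (fun _ => frobNorm) S (fun n => 1 / √(n : ℝ)))
    (hτ : ∀ n, τ n (Set.Iio 0) = 0) (h2 : ∀ n, Integrable (fun t : ℝ => t ^ 2) (τ n))
    (hB : ∀ n, ∫ t, t ^ 2 ∂(τ n) ≤ B) (hε : ∀ n, 0 < ε n)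
    (h : IsOz (fun n z => ‖(∫ ω, matrixStieltjes (S n ω) z ∂P) - stieltjes (τ n) z‖) ε) :
    AEIsOz P
      (fun n ω z => ‖stieltjes (mpConv (γ n) (esd (S n ω))) z - stieltjes (mpConv (γ n) (τ n)) z‖)
      (fun n => ε n + √(Real.log n) / n) := by
  obtain ⟨C, hC, hS⟩ := hSconc
  obtain ⟨k, hk⟩ := exists_norm_integral_sub_le ha hγ hτ h2 hB hε h
  have hb : 0 < b := ha.trans_le ((hγ 0).1.trans (hγ 0).2)
  have hB0 : 0 ≤ B := integral_sq_nonneg.trans (hB 0)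
  have key : ∀ M : ℝ, 0 < M → ∃ C : ℝ, 0 < C ∧ ∀ᵐ ω ∂P, ∀ᶠ n in atTop,
      ∀ z : ℂ, 0 < z.im → z.im ≤ M →
        ‖stieltjes (mpConv (γ n) (esd (S n ω))) z - stieltjes (mpConv (γ n) (τ n)) z‖ ≤
          C * ((ε n + √(Real.log n) / n) * zBase z ^ (k + 6)) := by
    intro M hM
    obtain ⟨C₂, hC₂, hmean⟩ := hk M hM
    have hR := recipBound_pos hb hB0 hM
    set R := recipBound b B M with hRdef
    set K := √(56 * C) with hK
    have hK0 : 0 ≤ K := Real.sqrt_nonneg _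
    refine ⟨2 * R ^ 2 * ((K + 4 * M ^ 2) * M ^ k + C₂ * M ^ 2) + 2 * M ^ (k + 4), by positivity, ?_⟩
    filter_upwards [ae_eventually_norm_matrixStieltjes_sub_le hC hS hSpsd] with ω hω
    -- From `n ≥ 3` on, `log n ≥ 1`, so `1/n` is dominated by the rate; from `n ≥ R` on, `|l| ≤ R *
    -- zBase z` fits in the disc of radius `n²` when `zBase z < n`.
    filter_upwards [hω, eventually_ge_atTop 3, eventually_ge_atTop ⌈R⌉₊] with n hn hn3 hnR z hz hzM
    have hn1 : 1 ≤ n := by omega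
    have hn0 : (0 : ℝ) < n := by exact_mod_cast hn1
    have hnR' : R ≤ n := (Nat.le_ceil R).trans (by exact_mod_cast hnR)
    have hη := one_div_le_sqrt_log_div hn3
    set η := √(Real.log n) / n with hηdef
    have hη0 : 0 < η := lt_of_lt_of_le (by positivity) hη
    have hQ := zBase_pos hz
    have hεn := hε n
    have hγ0 := ha.trans_le (hγ n).1
    have h1 := one_le_mul_zBase hz hzM
    have hp2 : zBase z ^ 2 ≤ M ^ (k + 4) * zBase z ^ (k + 6) :=
      (zBase_pow_le hz hzM (by omega : 2 ≤ k + 6))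
    have hp6 : zBase z ^ 6 ≤ M ^ k * zBase z ^ (k + 6) := by
      simpa using zBase_pow_le hz hzM (by omega : 6 ≤ k + 6)
    have hpk : zBase z ^ (4 + k) ≤ M ^ 2 * zBase z ^ (k + 6) := by
      have := zBase_pow_le hz hzM (by omega : 4 + k ≤ k + 6)
      rwa [show k + 6 - (4 + k) = 2 by omega] at this
    have hrest : 0 ≤ 2 * M ^ (k + 4) := by positivity
    have hrest' : 0 ≤ 2 * R ^ 2 * ((K + 4 * M ^ 2) * M ^ k + C₂ * M ^ 2) := by positivity
    -- When `zBase z ≥ n`, the weight itself supplies the factor `1/n` for the trivial bound `2 *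
    -- zBase z`. Otherwise `l` has height at least `1/n` and lies in the region of uniform control.
    rcases le_or_gt (n : ℝ) (zBase z) with hlarge | hsmall
    · refine (norm_stieltjes_mpConv_esd_sub_stieltjes_le_zBase hn1 (hSpsd n ω) hγ0 (hτ n) (h2 n)
        hz).trans ?_
      calc 2 * zBase z ≤ 2 * (zBase z * (zBase z * (1 / n))) := by
            have : 1 ≤ zBase z * (1 / n) := by rw [mul_one_div, le_div_iff₀ hn0, one_mul]; exact hlarge
            nlinarith
        _ = 2 * zBase z ^ 2 * (1 / n) := by ring
        _ ≤ 2 * (M ^ (k + 4) * zBase z ^ (k + 6)) * (ε n + η) := by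
            have : 1 / (n : ℝ) ≤ ε n + η := by linarith
            gcongr
        _ = 2 * M ^ (k + 4) * ((ε n + η) * zBase z ^ (k + 6)) := by ring
        _ ≤ _ := by gcongr; linarith
    · refine (norm_stieltjes_mpConv_esd_sub_stieltjes_le hn1 (hSpsd n ω) hγ0 (hγ n).2 (hτ n) (h2 n)
        (hB n) hz hzM).trans ?_
      have hy := inv_im_le hz
      have hl := norm_recipCauchy_le hγ0 (hγ n).2 (hτ n) (h2 n) (hB n) hz hzM
      have him := (isSub_recipCauchy hγ0 (hτ n) (h2 n) hz).1.im_le hγ0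
      rw [← hRdef] at hl ⊢
      have hmean' := hmean n hn1 z hz hzM
      set l := recipCauchy (γ n) (τ n) z
      have hl0 : 0 < l.im := hz.trans_le him
      have hfluct := hn l (by
        refine le_trans ?_ him
        rw [div_le_iff₀ hn0, ← div_le_iff₀' hz]
        exact hy.trans hsmall.le) (by
        refine hl.trans ?_
        rw [sq]; gcongr)
      have hD : ‖matrixStieltjes (S n ω) l - stieltjes (τ n) l‖ ≤
          (K * η * zBase z ^ 2 + 4 * (M * zBase z) ^ 2 * η) + C₂ * (ε n * zBase z ^ k) := by
        have e : matrixStieltjes (S n ω) l - stieltjes (τ n) l =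
          (matrixStieltjes (S n ω) l - ∫ ω', matrixStieltjes (S n ω') l ∂P) +
          ((∫ ω', matrixStieltjes (S n ω') l ∂P) - stieltjes (τ n) l) := by ring
        rw [e]
        refine (norm_add_le _ _).trans (add_le_add (hfluct.trans (add_le_add ?_ ?_)) hmean')
        · calc K * η / l.im ^ 2 ≤ K * η / z.im ^ 2 := by gcongr
            _ = K * η * (1 / z.im) ^ 2 := by field_simp
            _ ≤ _ := by gcongr
        · have := one_le_pow₀ h1 (n := 2)
          calc (4 : ℝ) / n = 4 * 1 * (1 / n) := by ring
            _ ≤ _ := by gcongr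
      calc 2 * R ^ 2 * zBase z ^ 4 * ‖matrixStieltjes (S n ω) l - stieltjes (τ n) l‖
          ≤ 2 * R ^ 2 * zBase z ^ 4 * ((K * η * zBase z ^ 2 + 4 * (M * zBase z) ^ 2 * η) +
            C₂ * (ε n * zBase z ^ k)) := by gcongr
        _ = 2 * R ^ 2 * ((K + 4 * M ^ 2) * zBase z ^ 6 * η + C₂ * zBase z ^ (4 + k) * ε n) := by
            rw [pow_add]; ring
        _ ≤ 2 * R ^ 2 * ((K + 4 * M ^ 2) * (M ^ k * zBase z ^ (k + 6)) * (ε n + η) +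
              C₂ * (M ^ 2 * zBase z ^ (k + 6)) * (ε n + η)) := by
            have : η ≤ ε n + η := by linarith
            have : ε n ≤ ε n + η := by linarith
            gcongr
        _ = 2 * R ^ 2 * ((K + 4 * M ^ 2) * M ^ k + C₂ * M ^ 2) *
              ((ε n + η) * zBase z ^ (k + 6)) := by ring
        _ ≤ _ := by gcongr; linarith
  refine ⟨((k + 6 : ℕ) : ℝ), by positivity, fun M hM => ?_, ?_⟩
  · obtain ⟨C', hC', h'⟩ := key M hM
    refine ⟨C', hC', ?_⟩
    filter_upwards [h'] with ω hω
    filter_upwards [hω] with n hn z hz hzM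
    rw [zWeight_natCast _ hz]
    exact hn z hz hzM
  -- Integer height bounds make the almost sure event a countable intersection. The finitely many
  -- small `n` are then handled by the trivial bound, with a constant depending on the outcome
  -- through `N`.
  · choose! C' hC' h' using fun m : ℕ => key ((m : ℝ) + 1) (by positivity)
    filter_upwards [ae_all_iff.2 h'] with ω hω M hM
    obtain ⟨m, hm⟩ := exists_nat_ge M
    obtain ⟨N, hN⟩ := eventually_atTop.1 (hω m)
    have hδ : ∀ n : ℕ, 0 < ε n + √(Real.log n) / n := fun n => by
      have := hε n
      positivity
    let c : ℕ → ℝ := fun n => 2 * M ^ (k + 5) / (ε n + √(Real.log n) / n)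
    have hc : ∀ n, 0 ≤ c n := fun n => div_nonneg (by positivity) (hδ n).le
    have hsum : 0 ≤ ∑ n ∈ Finset.range N, c n := Finset.sum_nonneg fun n _ => hc n
    refine ⟨C' m + ∑ n ∈ Finset.range N, c n, add_pos_of_pos_of_nonneg (hC' m) hsum,
      fun n hn1 z hz hzM => ?_⟩
    rw [zWeight_natCast _ hz]
    have hQ := zBase_pos hz
    have hδn := hδ n
    rcases le_or_gt N n with hNn | hnN
    · refine (hN n hNn z hz (by linarith)).trans ?_
      gcongr
      linarith
    · refine (norm_stieltjes_mpConv_esd_sub_stieltjes_le_zBase hn1 (hSpsd n ω)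
        (ha.trans_le (hγ n).1) (hτ n) (h2 n) hz).trans ?_
      have hp1 : zBase z ≤ M ^ (k + 5) * zBase z ^ (k + 6) := by
        simpa using zBase_pow_le hz hzM (by omega : 1 ≤ k + 6)
      calc 2 * zBase z ≤ 2 * (M ^ (k + 5) * zBase z ^ (k + 6)) := by gcongr
        _ = c n * ((ε n + √(Real.log n) / n) * zBase z ^ (k + 6)) := by
            simp only [c]
            rw [← mul_assoc (_ / _), div_mul_cancel₀ _ hδn.ne']
            ring
        _ ≤ _ := by
            gcongr
            have := Finset.single_le_sum (fun n _ => hc n) (Finset.mem_range.2 hnN)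
            linarith [hC' m]

end AlmostSure

/-! ### Linear concentration -/

section Linear

variable {Ω : Type*} [MeasurableSpace Ω] {P : Measure Ω}

theorem norm_entry_le_specNorm {n : ℕ} (A : Matrix (Fin n) (Fin n) ℂ) (i j : Fin n) :
    ‖A i j‖ ≤ specNorm A := by
  have h := sum_norm_mulVec_sq_le A (Pi.single j 1)
  rw [Matrix.mulVec_single_one] at h
  have h1 : ∑ x, ‖(Pi.single j 1 : Fin n → ℂ) x‖ ^ 2 = 1 := by
    rw [Finset.sum_eq_single j] <;> simp +contextual
  rw [h1, mul_one] at h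
  have h2 := Finset.single_le_sum (f := fun i => ‖A.col j i‖ ^ 2) (fun i _ => sq_nonneg _)
    (Finset.mem_univ i)
  exact (sq_le_sq₀ (norm_nonneg _) (specNorm_nonneg A)).1 (h2.trans h)

/-- A linear functional commutes with the entrywise expectation. -/
theorem linearMap_expMatrix {n : ℕ} (f : Matrix (Fin n) (Fin n) ℂ →ₗ[ℂ] ℂ)
    {X : Ω → Matrix (Fin n) (Fin n) ℂ} (hX : ∀ i j, Integrable (fun ω => X ω i j) P) :
    f (expMatrix P X) = ∫ ω, f (X ω) ∂P := by
  have e : ∀ A : Matrix (Fin n) (Fin n) ℂ,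
      f A = ∑ i, ∑ j, A i j * f (Matrix.single i j 1) := by
    intro A
    conv_lhs => rw [Matrix.matrix_eq_sum_single A]
    simp only [map_sum]
    refine Finset.sum_congr rfl fun i _ => Finset.sum_congr rfl fun j _ => ?_
    rw [← smul_eq_mul, ← map_smul, Matrix.smul_single, smul_eq_mul, mul_one]
  rw [e]
  simp only [fun ω => e (X ω)]
  rw [integral_finsetSum _ fun i _ => integrable_finsetSum _ fun j _ => (hX i j).mul_const _]
  refine Finset.sum_congr rfl fun i _ => ?_
  rw [integral_finsetSum _ fun j _ => (hX i j).mul_const _]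
  refine Finset.sum_congr rfl fun j _ => ?_
  rw [integral_mul_const, expMatrix, Matrix.of_apply]

/-- Without the averaging of the trace the resolvent is only `1 / Im(ξ)²`-Lipschitz, so the scale is
`1/√n`; this is the term that fixes the rate in the third claim. -/
theorem resolventMatrix_linear_concentration {n : ℕ} {C : ℝ}
    {X : Ω → Matrix (Fin n) (Fin n) ℝ}
    (hX : LipConcWith P frobNorm X C (1 / √(n : ℝ))) (hpsd : ∀ ω, (X ω).PosSemidef) {ξ : ℂ}
    (hξ : 0 < ξ.im) (f : Matrix (Fin n) (Fin n) ℂ →ₗ[ℂ] ℂ) (hf : ∀ A, ‖f A‖ ≤ specNorm A) :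
    ∀ t : ℝ, 0 ≤ t → P.real {ω | t ≤ ‖f (resolventMatrix (X ω) ξ) -
      f (expMatrix P fun ω => resolventMatrix (X ω) ξ)‖} ≤
        C * Real.exp (-(1 / C) * (t / (2 / (√n * ξ.im ^ 2))) ^ 2) := by
  have hlip : ∀ A B : Matrix (Fin n) (Fin n) ℝ, A.PosSemidef → B.PosSemidef →
      specNorm (resolventMatrix A ξ - resolventMatrix B ξ) ≤ 1 / ξ.im ^ 2 * frobNorm (A - B) := by
    intro A B hA hB
    refine (specNorm_resolventMatrix_sub_le hA hB hξ hξ fun t _ =>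
        im_le_norm_ofReal_sub t ξ).trans_eq ?_
    ring
  rw [linearMap_expMatrix f fun i j => (hX.comp_of_posSemidef hpsd
    (φ := fun A => resolventMatrix A ξ i j) (L := 1 / ξ.im ^ 2) (by positivity)
    fun A B hA hB => (norm_entry_le_specNorm (resolventMatrix A ξ - resolventMatrix B ξ) i j).trans
      (hlip A B hA hB)).1]
  have h := (hX.comp_of_posSemidef hpsd (φ := fun A => f (resolventMatrix A ξ))
    (L := 1 / ξ.im ^ 2) (by positivity) fun A B hA hB => by
      rw [← map_sub]
      exact (hf _).trans (hlip A B hA hB)).2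
  have e : 2 * (1 / ξ.im ^ 2) * (1 / √(n : ℝ)) = 2 / (√n * ξ.im ^ 2) := by ring
  rwa [e] at h

/-- The tail of a random variable that is dominated by two variables with Gaussian tails and a
constant. -/
theorem measureReal_tail_add_le [IsProbabilityMeasure P] {X Y W : Ω → ℝ} {d α β C σ₁ σ₂ σ K C' : ℝ}
    (hα : 0 < α) (hβ : 0 < β) (hW : ∀ ω, W ω ≤ α * X ω + β * Y ω + d) (hC : 0 < C) (hσ₁ : 0 < σ₁)
    (hσ₂ : 0 < σ₂) (hσ : 0 < σ) (hK : 0 < K)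
    (hX : ∀ t : ℝ, 0 ≤ t → P.real {ω | t ≤ X ω} ≤ C * Real.exp (-(1 / C) * (t / σ₁) ^ 2))
    (hY : ∀ t : ℝ, 0 ≤ t → P.real {ω | t ≤ Y ω} ≤ C * Real.exp (-(1 / C) * (t / σ₂) ^ 2))
    (h1 : α * σ₁ ≤ K * σ) (h2 : β * σ₂ ≤ K * σ) (hd : d ≤ K * σ) (hC3 : 3 ≤ C')
    (hCK : 9 * K ^ 2 ≤ C') (hCC : 2 * C ≤ C') (hCCK : 18 * C * K ^ 2 ≤ C') {t : ℝ} (ht : 0 ≤ t) :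
    P.real {ω | t ≤ W ω} ≤ C' * Real.exp (-(1 / C') * (t / σ) ^ 2) := by
  have hC' : 0 < C' := by linarith
  -- For small `t` the probability is at most `1 ≤ 3 exp(-1)`, and `C'` is large enough for this.
  -- For large `t` the constant `d` uses up at most a third of `t`, so `X` or `Y` must contribute a
  -- third.
  rcases le_or_gt t (3 * (K * σ)) with hsmall | hlarge
  · refine measureReal_le_one.trans ?_
    have e1 : (1 / C') * (t / σ) ^ 2 ≤ 1 := by
      rw [one_div, inv_mul_le_iff₀ hC', mul_one]
      refine le_trans ?_ hCK
      have : t / σ ≤ 3 * K := by rw [div_le_iff₀ hσ]; linarith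
      calc (t / σ) ^ 2 ≤ (3 * K) ^ 2 := by gcongr
        _ = 9 * K ^ 2 := by ring
    have e2 : Real.exp (-1) ≤ Real.exp (-(1 / C') * (t / σ) ^ 2) := by
      rw [Real.exp_le_exp]; linarith
    have e3 : (1 : ℝ) / 3 ≤ Real.exp (-1) := by
      rw [Real.exp_neg, ← one_div]
      have := Real.exp_one_lt_d9
      have := Real.exp_pos 1
      gcongr
      linarith
    calc (1 : ℝ) = 3 * (1 / 3) := by norm_num
      _ ≤ C' * Real.exp (-(1 / C') * (t / σ) ^ 2) := by gcongr; exact e3.trans e2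
  · have hsub : {ω | t ≤ W ω} ⊆ {ω | t / (3 * α) ≤ X ω} ∪ {ω | t / (3 * β) ≤ Y ω} := by
      intro ω hω
      by_contra hcon
      simp only [Set.mem_union, Set.mem_ofPred_eq, not_or, not_le] at hcon hω
      have c1 := hcon.1
      have c2 := hcon.2
      rw [lt_div_iff₀ (by positivity)] at c1 c2
      linarith [hW ω]
    have key : ∀ {α s : ℝ}, 0 < α → 0 < s → α * s ≤ K * σ →
        C * Real.exp (-(1 / C) * (t / (3 * α) / s) ^ 2) ≤
          C' / 2 * Real.exp (-(1 / C') * (t / σ) ^ 2) := by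
      intro α s hα hs hle
      rw [div_div]
      refine (gaussian_tail_mono (C' := C' / 2) (σ' := σ) (K := 3 * K) hC (by positivity) hσ
        (by positivity) (by linarith) (by linarith) (by linarith) t).trans ?_
      have : 1 / C' * (t / σ) ^ 2 ≤ 1 / (C' / 2) * (t / σ) ^ 2 := by
        gcongr
        linarith
      gcongr C' / 2 * Real.exp ?_
      linarith
    calc P.real {ω | t ≤ W ω}
        ≤ P.real ({ω | t / (3 * α) ≤ X ω} ∪ {ω | t / (3 * β) ≤ Y ω}) := measureReal_mono hsub
      _ ≤ P.real {ω | t / (3 * α) ≤ X ω} + P.real {ω | t / (3 * β) ≤ Y ω} :=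
        measureReal_union_le _ _
      _ ≤ C' / 2 * Real.exp (-(1 / C') * (t / σ) ^ 2) +
          C' / 2 * Real.exp (-(1 / C') * (t / σ) ^ 2) :=
        add_le_add ((hX _ (by positivity)).trans (key hα hσ₁ h1))
          ((hY _ (by positivity)).trans (key hβ hσ₂ h2))
      _ = _ := by ring

variable {γ : ℕ → ℝ} {a b : ℝ} {S : ∀ n : ℕ, Ω → Matrix (Fin n) (Fin n) ℝ} {τ : ℕ → Measure ℝ}
  {ε ε' : ℕ → ℝ} {H : ∀ n : ℕ, ℂ → Matrix (Fin n) (Fin n) ℂ}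

/-- Three errors occur: moving the subordination point to `l`, the fluctuation of the resolvent at
`l`, and the distance of its mean from `H(l)`. The first in turn splits into the fluctuation and the
bias of the Stieltjes transform; both biases are deterministic and are absorbed into the scale. -/
theorem linConcOz_GBox [IsProbabilityMeasure P] [∀ n, IsProbabilityMeasure (τ n)] {B : ℝ}
    (ha : 0 < a) (hγ : ∀ n, a ≤ γ n ∧ γ n ≤ b) (hSpsd : ∀ n ω, (S n ω).PosSemidef)
    (hSconc : LipConc P (fun _ => frobNorm) S (fun n => 1 / √(n : ℝ)))
    (hτ : ∀ n, τ n (Set.Iio 0) = 0) (h2 : ∀ n, Integrable (fun t : ℝ => t ^ 2) (τ n))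
    (hB : ∀ n, ∫ t, t ^ 2 ∂(τ n) ≤ B) (hε : ∀ n, 0 < ε n)
    (h : IsOz (fun n z => ‖(∫ ω, matrixStieltjes (S n ω) z ∂P) - stieltjes (τ n) z‖) ε)
    (hε' : ∀ n, 0 < ε' n)
    (h' : IsOz (fun n z => specNorm (expMatrix P (fun ω => resolventMatrix (S n ω) z) - H n z))
      ε') :
    LinConcOz P (fun _ => specNorm) (fun n z ω => GBox (γ n) (S n ω) z)
      (fun n z => KMat (γ n) (τ n) (H n) z) (fun n => ε n + ε' n + 1 / √(n : ℝ)) := by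
  obtain ⟨C, hC, hS⟩ := hSconc
  obtain ⟨k, hk⟩ := exists_norm_integral_sub_le ha hγ hτ h2 hB hε h
  obtain ⟨k', hk'⟩ := exists_norm_integral_sub_le ha hγ hτ h2 hB hε' h'
  have hb : 0 < b := ha.trans_le ((hγ 0).1.trans (hγ 0).2)
  have hB0 : 0 ≤ B := integral_sq_nonneg.trans (hB 0)
  -- The worst fluctuation term has degree `8 + 2`, with `8` from the comparison at `l` and `2` from
  -- `1 / Im(l)²`; the biases add `k` and `k'`.
  refine ⟨((10 + k + k' : ℕ) : ℝ), by positivity, fun M hM => ?_⟩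
  obtain ⟨C₂, hC₂, hmean⟩ := hk M hM
  obtain ⟨C₃, hC₃, hmean'⟩ := hk' M hM
  have hR := recipBound_pos hb hB0 hM
  set R := recipBound b B M with hRdef
  set c := 2 * b * R ^ 3 * (M ^ 2 + R) with hc
  have hc0 : 0 < c := by positivity
  -- One summand for each of the two fluctuations and the two biases; each power of `M` raises its
  -- term to the common degree `10 + k + k'`.
  set K := 2 * c * M ^ (k + k') + 2 * R * M ^ (6 + k + k') + c * C₂ * M ^ (2 + k') +
    R * C₃ * M ^ (8 + k) with hK
  have hK0 : 0 < K := by positivity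
  clear_value K
  have hK1 : 0 ≤ K ^ 2 := by positivity
  have hK2 : 0 ≤ 18 * C * K ^ 2 := by positivity
  refine ⟨3 + 9 * K ^ 2 + 2 * C + 18 * C * K ^ 2, by positivity, fun n hn z hz hzM f hf t ht => ?_⟩
  have hn0 : (0 : ℝ) < n := by exact_mod_cast hn
  have hs : (0 : ℝ) < √n := Real.sqrt_pos.2 hn0
  have hQ := zBase_pos hz
  have hεn := hε n
  have hεn' := hε' n
  have hγ0 := ha.trans_le (hγ n).1
  have him := (isSub_recipCauchy hγ0 (hτ n) (h2 n) hz).1.im_le hγ0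
  have hprod := norm_inv_mul_recipCauchy_le hγ0 (hγ n).2 (hτ n) (h2 n) (hB n) hz hzM
  have hmeanz := hmean n hn z hz hzM
  have hmeanz' := hmean' n hn z hz hzM
  have hG : ∀ ω, _ := fun ω => specNorm_GBox_sub_resolvent_le hn (hSpsd n ω) hγ0 (hγ n).2 (hτ n)
    (h2 n) (hB n) hz hzM
  simp only [KMat]
  rw [← hRdef] at hprod hG
  rw [← hc] at hG
  rw [zWeight_natCast _ hz]
  set l := recipCauchy (γ n) (τ n) z
  clear_value l
  have hl0 : 0 < l.im := hz.trans_le him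
  have hy : 1 / l.im ^ 2 ≤ zBase z ^ 2 := by
    have := inv_im_le hz
    calc 1 / l.im ^ 2 ≤ 1 / z.im ^ 2 := by gcongr
      _ = (1 / z.im) ^ 2 := by rw [one_div_pow]
      _ ≤ _ := by gcongr
  have hpow : ∀ i j : ℕ, i + j = 10 + k + k' →
      zBase z ^ i ≤ M ^ j * zBase z ^ (10 + k + k') := fun i j hij => by
    have := zBase_pow_le hz hzM (by omega : i ≤ 10 + k + k')
    rwa [show 10 + k + k' - i = j by omega] at this
  set s := ε n + ε' n + 1 / √(n : ℝ) with hsdef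
  have hs1 : 1 / √(n : ℝ) ≤ s := by linarith
  have hsinv : 0 < 1 / √(n : ℝ) := by positivity
  have hs2 : ε n ≤ s := by linarith
  have hs3 : ε' n ≤ s := by linarith
  have hs0 : 0 < s := by linarith
  have hn2 : 1 / (n : ℝ) ≤ 1 / √(n : ℝ) := by
    have h1 : (1 : ℝ) ≤ n := by exact_mod_cast hn
    have : √(n : ℝ) ≤ n := (Real.sqrt_le_left hn0.le).2 (by nlinarith)
    gcongr
  refine measureReal_tail_add_le
    (X := fun ω => ‖matrixStieltjes (S n ω) l - ∫ ω', matrixStieltjes (S n ω') l ∂P‖)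
    (Y := fun ω => ‖f (resolventMatrix (S n ω) l) -
      f (expMatrix P fun ω => resolventMatrix (S n ω) l)‖)
    (α := c * zBase z ^ 8) (β := R * zBase z ^ 2)
    (d := c * zBase z ^ 8 * (C₂ * (ε n * zBase z ^ k)) +
      R * zBase z ^ 2 * (C₃ * (ε' n * zBase z ^ k')))
    (K := K) (C := C) (σ₁ := 2 / (n * l.im ^ 2)) (σ₂ := 2 / (√n * l.im ^ 2))
    (by positivity) (by positivity) (fun ω => ?_) hC (by positivity) (by positivity)
    (by positivity) hK0
    (matrixStieltjes_concentration hn (hS n hn) (hSpsd n) hl0).2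
    (resolventMatrix_linear_concentration (hS n hn) (hSpsd n) hl0 f hf) ?_ ?_ ?_ ?_ ?_ ?_ ?_ ht
  · have e : f (GBox (γ n) (S n ω) z) - f ((z⁻¹ * l) • H n l) =
        f (GBox (γ n) (S n ω) z - z⁻¹ • (l • resolventMatrix (S n ω) l)) +
        (z⁻¹ * l) * (f (resolventMatrix (S n ω) l) -
          f (expMatrix P fun ω => resolventMatrix (S n ω) l)) +
        (z⁻¹ * l) * f ((expMatrix P fun ω => resolventMatrix (S n ω) l) - H n l) := by
      simp only [map_sub, map_smul, smul_eq_mul]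
      ring
    have hD : ‖matrixStieltjes (S n ω) l - stieltjes (τ n) l‖ ≤
        ‖matrixStieltjes (S n ω) l - ∫ ω', matrixStieltjes (S n ω') l ∂P‖ +
          C₂ * (ε n * zBase z ^ k) := by
      have := norm_sub_le_norm_sub_add_norm_sub (matrixStieltjes (S n ω) l)
        (∫ ω', matrixStieltjes (S n ω') l ∂P) (stieltjes (τ n) l)
      linarith
    have hE := (hf ((expMatrix P fun ω => resolventMatrix (S n ω) l) - H n l)).trans hmeanz'
    have hF := (hf _).trans (hG ω)
    rw [e]
    refine norm_add₃_le.trans ?_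
    rw [norm_mul (z⁻¹ * l), norm_mul (z⁻¹ * l)]
    set y := ‖f (resolventMatrix (S n ω) l) - f (expMatrix P fun ω => resolventMatrix (S n ω) l)‖
    have hy0 : 0 ≤ y := norm_nonneg _
    have t1 := hF.trans (mul_le_mul_of_nonneg_left hD (by positivity))
    have t2 := mul_le_mul_of_nonneg_right hprod hy0
    have t3 := mul_le_mul hprod hE (norm_nonneg _) (by positivity)
    refine (add_le_add (add_le_add t1 t2) t3).trans_eq ?_
    ring
  · calc c * zBase z ^ 8 * (2 / (n * l.im ^ 2))
        = 2 * c * (zBase z ^ 8 * (1 / l.im ^ 2)) * (1 / n) := by field_simp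
      _ ≤ 2 * c * (zBase z ^ 8 * zBase z ^ 2) * s := by
          have := hn2.trans hs1
          gcongr
      _ = 2 * c * zBase z ^ 10 * s := by ring
      _ ≤ 2 * c * (M ^ (k + k') * zBase z ^ (10 + k + k')) * s := by
          have := hpow 10 (k + k') (by omega)
          gcongr
      _ = 2 * c * M ^ (k + k') * (s * zBase z ^ (10 + k + k')) := by ring
      _ ≤ _ := by
          gcongr
          have : 0 ≤ 2 * R * M ^ (6 + k + k') + c * C₂ * M ^ (2 + k') + R * C₃ * M ^ (8 + k) := by
            positivity
          linarith
  · calc R * zBase z ^ 2 * (2 / (√n * l.im ^ 2))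
        = 2 * R * (zBase z ^ 2 * (1 / l.im ^ 2)) * (1 / √n) := by field_simp
      _ ≤ 2 * R * (zBase z ^ 2 * zBase z ^ 2) * s := by gcongr
      _ = 2 * R * zBase z ^ 4 * s := by ring
      _ ≤ 2 * R * (M ^ (6 + k + k') * zBase z ^ (10 + k + k')) * s := by
          have := hpow 4 (6 + k + k') (by omega)
          gcongr
      _ = 2 * R * M ^ (6 + k + k') * (s * zBase z ^ (10 + k + k')) := by ring
      _ ≤ _ := by
          gcongr
          have : 0 ≤ 2 * c * M ^ (k + k') + c * C₂ * M ^ (2 + k') + R * C₃ * M ^ (8 + k) := by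
            positivity
          linarith
  · calc c * zBase z ^ 8 * (C₂ * (ε n * zBase z ^ k)) +
          R * zBase z ^ 2 * (C₃ * (ε' n * zBase z ^ k'))
        = c * C₂ * zBase z ^ (8 + k) * ε n + R * C₃ * zBase z ^ (2 + k') * ε' n := by ring
      _ ≤ c * C₂ * (M ^ (2 + k') * zBase z ^ (10 + k + k')) * s +
          R * C₃ * (M ^ (8 + k) * zBase z ^ (10 + k + k')) * s := by
          have := hpow (8 + k) (2 + k') (by omega)
          have := hpow (2 + k') (8 + k) (by omega)
          gcongr
      _ = (c * C₂ * M ^ (2 + k') + R * C₃ * M ^ (8 + k)) * (s * zBase z ^ (10 + k + k')) := by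
          ring
      _ ≤ _ := by
          gcongr
          have : 0 ≤ 2 * c * M ^ (k + k') + 2 * R * M ^ (6 + k + k') := by positivity
          linarith
  all_goals linarith

end Linear

end

theorem mainTheorem10 {Ω : Type*} [MeasurableSpace Ω] (P : Measure Ω) [IsProbabilityMeasure P]
    (γ : ℕ → ℝ) (hγ : ∃ a b : ℝ, 0 < a ∧ ∀ n, a ≤ γ n ∧ γ n ≤ b)
    (S : ∀ n : ℕ, Ω → Matrix (Fin n) (Fin n) ℝ)
    (hSmeas : ∀ n i j, Measurable (fun ω => S n ω i j))
    (hSpsd : ∀ n ω, (S n ω).PosSemidef)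
    (hSconc : LipConc P (fun _ => frobNorm) S (fun n => 1 / √(n : ℝ))) :
    (LipConcOz (E := fun _ => ℂ) P (fun _ w => ‖w‖)
        (fun n z ω => stieltjes (mpConv (γ n) (esd (S n ω))) z) (fun n => 1 / (n : ℝ)) ∧
      LipConcOz P (fun _ => specNorm)
        (fun n z ω => GBox (γ n) (S n ω) z) (fun n => 1 / √(n : ℝ))) ∧
    (∀ (τ : ℕ → Measure ℝ) (ε : ℕ → ℝ),
      (∀ n, IsProbabilityMeasure (τ n)) → (∀ n, τ n (Set.Iio 0) = 0) →
      (∃ B : ℝ, ∀ n, Integrable (fun t => t ^ 2) (τ n) ∧ ∫ t, t ^ 2 ∂(τ n) ≤ B) →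
      (∀ n, 0 < ε n) →
      IsOz (fun n z => ‖(∫ ω, matrixStieltjes (S n ω) z ∂P) - stieltjes (τ n) z‖) ε →
      AEIsOz P
          (fun n ω z => ‖stieltjes (mpConv (γ n) (esd (S n ω))) z
            - stieltjes (mpConv (γ n) (τ n)) z‖)
          (fun n => ε n + √(Real.log n) / n) ∧
      ∀ (H : ∀ n : ℕ, ℂ → Matrix (Fin n) (Fin n) ℂ) (ε' : ℕ → ℝ),
        (∀ n, 0 < ε' n) →
        IsOz (fun n z => specNorm (expMatrix P (fun ω => resolventMatrix (S n ω) z) - H n z)) ε' →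
        LinConcOz P (fun _ => specNorm)
          (fun n z ω => GBox (γ n) (S n ω) z)
          (fun n z => KMat (γ n) (τ n) (H n) z)
          (fun n => ε n + ε' n + 1 / √(n : ℝ))) := by
  obtain ⟨a, b, ha, hγ⟩ := hγ
  refine ⟨⟨lipConcOz_stieltjes_mpConv ha (fun n => (hγ n).1) hSpsd hSconc,
    lipConcOz_GBox ha hγ hSpsd hSconc⟩, ?_⟩
  rintro τ ε hτp hτ ⟨B, hB⟩ hε h
  exact ⟨aeIsOz_stieltjes_mpConv_sub ha hγ hSpsd hSconc hτ (fun n => (hB n).1)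
    (fun n => (hB n).2) hε h, fun H ε' hε' h' => linConcOz_GBox ha hγ hSpsd hSconc hτ
    (fun n => (hB n).1) (fun n => (hB n).2) hε h hε' h'⟩
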